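/- **Setting.** For each sample size $n$ let $F_u,F_{\mathrm{DP}}$ be known seed distributions (they may depend on $n$), and let data from $\theta\in\Theta\subseteq\mathbb R^q$ be $D=G(\theta,u)$, $u\sim F_u$. For a criterion $\rho_n(\beta;D,u_{\mathrm{DP}})$ and $\mathbb B\subseteq\mathbb R^p$, the released statistic is a measurable choice of $s=\operatorname{argmin}_{\beta\in\mathbb B}\rho_n(\beta;D,u_{\mathrm{DP}})$, $u_{\mathrm{DP}}\sim F_{\mathrm{DP}}$. Simulated seeds $(u^r,u^r_{\mathrm{DP}})$, $r\le R$, are i.i.d. copies, independent of the data; $s^r(\theta)$ is the statistic of $G(\theta,u^r)$ with $u^r_{\mathrm{DP}}$; $m^R(\theta)$ and $S^R(\theta)$ are the sample mean and the sample covariance matrix (divisor $R-1$) of $s^1(\theta),\dots,s^R(\theta)$; $\|a\|_A:=a^{\top}Aa$. Measurable estimators are $$\hat\theta_{\mathrm{IND}}=\operatorname*{argmin}_{\theta\in\Theta}\|s-m^R(\theta)\|_{\Omega_n},\qquad \hat\theta_{\mathrm{ADI}}=\operatorname*{argmin}_{\theta\in\Theta}\|s-m^{R_n}(\theta)\|_{S^{R_n}(\theta)^{-1}}$$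 ($\hat\theta_{\mathrm{ADI}}\in\Theta$ is arbitrary if some $S^{R_n}(\theta)$, $\theta\in\Theta$, is singular). The true parameter $\theta^*$ is an interior point of $\Theta$. **Assumptions.** - (A1) $\rho_\infty(\cdot;\theta^*)$ is non-random and continuous, and $\sup_{\beta\in\mathbb B}|\rho_n(\beta;D,u_{\mathrm{DP}})-\rho_\infty(\beta;\theta^*)|\to0$ in probability, $D=G(\theta^*,u)$. - (A2) For each $\theta\in\Theta$, $b(\theta)$ is the unique minimizer of $\rho_\infty(\cdot;\theta)$ over $\mathbb B$; $b$ is continuous and injective on $\Theta$, and differentiable with injective derivative on $\operatorname{int}\Theta$; $\beta^*:=b(\theta^*)$ and always $s$ lie in $\operatorname{int}\mathbb B$. Moreover $\inf\{\|b(\theta)-\beta^*\|:\theta\in\Theta,\ \|\theta-\theta^*\|\ge\varepsilon\}>0$ for each $\varepsilon>0$ (automatic if $\Theta$ is compact). - (A3) $\sup_{\theta\in\Theta}\|s^r(\theta)-b(\theta)\|\to0$ in probability. - (A4) $\Omega_n\to\Omega$, all deterministic symmetric positive definite. - (A5) $s^r$ (for all seeds) and $b$ are $C^1$ on $\operatorname{int}\Theta$,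 and $\partial_\theta s^r(\theta_n)\to B^*:=\partial_\theta b(\theta^*)$ in probability for all random $\theta_n\to\theta^*$ in probability. - (A6) $\rho_n$ is $C^1$ in $\beta$ on $\operatorname{int}\mathbb B$, and $-\sqrt n\,\partial_\beta\rho_n(\beta^*;D,u_{\mathrm{DP}})\to F^*$ in distribution, with $D=G(\theta^*,u)$. - (A7) $\rho_n$ is $C^2$ in $\beta$ on $\operatorname{int}\mathbb B$; $\rho_\infty(\cdot;\theta^*)$ is differentiable near $\beta^*$ and twice differentiable at $\beta^*$, with invertible Hessian $J^*$; and, with $D=G(\theta^*,u)$, $\partial^2_\beta\rho_n(\beta_n;D,u_{\mathrm{DP}})\to J^*$ in probability for all random $\beta_n\to\beta^*$ in probability. - (A8) For each $\theta\in\Theta$, $s^r(\theta)$ has finite second moments for large $n$, and $\sqrt n(s^r(\theta)-b(\theta))$ converges in distribution to a law with finite second moments; $\Sigma(\theta)\succ0$ is both the variance of that law and the limit of the variances of $\sqrt n(s^r(\theta)-b(\theta))$. $\Sigma$ is continuous on $\Theta$, with eigenvalues bounded away from $0$ and $\infty$ over $\Theta$ (automatic if $\Theta$ is compact). In probability, $\sqrt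 n(m^{R_n}(\theta^*)-\beta^*)\to0$, $\sup_{\theta\in\Theta}\|m^{R_n}(\theta)-b(\theta)\|\to0$ and $\sup_{\theta\in\Theta}\|nS^{R_n}(\theta)-\Sigma(\theta)\|\to0$. - (A9) For all random $\theta_n\to\theta^*$ in probability, $\partial_\theta m^{R_n}(\theta_n)\to B^*$ in probability and $\partial_\theta(nS^{R_n})(\theta_n)=O_p(1)$. **Bootstrap.** Let $\hat\tau,\hat\sigma$ be functions of the statistic and the simulation seeds, and let $K_n(t;\theta)$ be the distribution function of $(\hat\tau(s)-\tau(\theta))/\hat\sigma(s)$ when the data come from $\theta$. The bootstrap draws $s_b$ and new simulation seeds from the model with parameter $\hat\theta(s)$, so the conditional distribution function of its root is $K_n(t;\hat\theta(s))$. The parametric-bootstrap (PB) estimator $\hat\tau(s_b)$ is *consistent* if $\sup_t|K_n(t;\hat\theta(s))-K_n(t;\theta^*)|\to0$ in probability under $\theta^*$. **Theorem.** Let $\eta_1:\mathbb R^q\to\mathbb R$ and $\eta_2:\mathbb R^p\to\mathbb R$ be measurable, and continuously differentiable near $\theta^*$ and $\beta^*$ respectively. Put $A_\Omega:=((B^*)^{\top}\Omega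 B^*)^{-1}(B^*)^{\top}\Omega$. Let $v,v_0,\dots,v_R$ be i.i.d. from $F^*$. 1. Assume (A1)–(A7), with $R\ge1$ fixed, $\hat\theta=\hat\theta_{\mathrm{IND}}$ and $\hat\sigma=1/\sqrt n$. Then $\hat\tau_1(s_b)=\eta_1(\hat\theta(s_b))$ with $\tau=\eta_1$ is consistent if $\eta_1'(\theta^*)A_\Omega(J^*)^{-1}(v_0-\frac1R\sum_{r=1}^Rv_r)$ has a continuous distribution function; and $\hat\tau_2(s_b)=\eta_2(s_b)$ with $\tau=\eta_2\circ b$ is consistent if $\eta_2'(\beta^*)(J^*)^{-1}v$ has a continuous distribution function. 2. Assume (A1)–(A3), (A5)–(A9), with $R_n\to\infty$ and $\hat\theta=\hat\theta_{\mathrm{ADI}}$. With $\hat\sigma=1/\sqrt n$, both conclusions of part 1 hold, the condition for $\hat\tau_1$ now being that $\eta_1'(\theta^*)A_{\Sigma(\theta^*)^{-1}}(J^*)^{-1}v$ has a continuous distribution function. 3. In the setting of part 2 let instead $\hat\tau(s)=\eta_1(\hat\theta(s))$, $\tau=\eta_1$ and $\hat\sigma(s)=\eta_3(\hat\theta(s))/\sqrt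 n$, where $$\eta_3(\theta)=\Big(\eta_1'(\theta)\big(b'(\theta)^{\top}\Sigma(\theta)^{-1}b'(\theta)\big)^{-1}\eta_1'(\theta)^{\top}\Big)^{1/2}.$$ If $\eta_1'(\theta^*)A_{\Sigma(\theta^*)^{-1}}(J^*)^{-1}v$ has a continuous distribution function, then the PB estimator $\hat\tau(s_b)$ is consistent. If $\eta_1'(\theta^*)\ne0$, then the studentized statistic is an approximate pivot in the following sense: along all sequences $\theta_n\in\Theta$ with $\sqrt n(\theta_n-\theta^*)\to h$, for any $h$, the statistic $(\hat\tau(s)-\tau(\theta_n))/\hat\sigma(s)$ under $\theta_n$ converges in distribution to the same variable $$T=\eta_1'(\theta^*)A_{\Sigma(\theta^*)^{-1}}(J^*)^{-1}v/\eta_3(\theta^*),$$ which has mean $0$ and variance $1$; and $T\sim N(0,1)$ if $F^*$ is Gaussian. -/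

import Mathlib

open MeasureTheory ProbabilityTheory Filter Topology Matrix

noncomputable section

namespace IndirectInference

/-- The Euclidean space `ℝᵏ`. -/
abbrev Vec (k : ℕ) : Type := EuclideanSpace ℝ (Fin k)

/-! ### Modes of convergence for variables living on spaces that change with `n` -/

/-- `X n → x` in probability. -/
def TendstoInProb {Ω : ℕ → Type*} [∀ n, MeasurableSpace (Ω n)] {F : Type*} [NormedAddCommGroup F]
    (μ : ∀ n, Measure (Ω n)) (X : ∀ n, Ω n → F) (x : F) : Prop :=
  ∀ ε : ℝ, 0 < ε → Tendsto (fun n => μ n {ω | ε ≤ ‖X n ω - x‖}) atTop (𝓝 0)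

/-- `sup_{t ∈ S} ‖X n t - x t‖ → 0` in probability. -/
def TendstoInProbUniformlyOn {Ω : ℕ → Type*} [∀ n, MeasurableSpace (Ω n)] {T F : Type*}
    [NormedAddCommGroup F] (μ : ∀ n, Measure (Ω n)) (X : ∀ n, T → Ω n → F) (x : T → F)
    (S : Set T) : Prop :=
  ∀ ε : ℝ, 0 < ε → Tendsto (fun n => μ n {ω | ∃ t ∈ S, ε ≤ ‖X n t ω - x t‖}) atTop (𝓝 0)

/-- `X n = O_p(1)`. -/
def BoundedInProb {Ω : ℕ → Type*} [∀ n, MeasurableSpace (Ω n)] {F : Type*}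
    [NormedAddCommGroup F] (μ : ∀ n, Measure (Ω n)) (X : ∀ n, Ω n → F) : Prop :=
  ∀ ε : ℝ, 0 < ε → ∃ C : ℝ, ∀ᶠ n in atTop, μ n {ω | C < ‖X n ω‖} ≤ ENNReal.ofReal ε

/-! ### Derivatives in coordinates, quadratic forms -/

/-- The Jacobian matrix of `f : ℝ^q → ℝ^p`, with entries `∂ f_i / ∂ θ_j`. -/
def jacobian {p q : ℕ} (f : Vec q → Vec p) (θ : Vec q) : Matrix (Fin p) (Fin q) ℝ :=
  Matrix.of fun i j => fderiv ℝ f θ (EuclideanSpace.single j 1) i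

/-- The Hessian of `f : ℝ^p → ℝ` as a linear map, the derivative of the gradient. -/
def hessianMap {p : ℕ} (f : Vec p → ℝ) (β : Vec p) : Vec p →L[ℝ] Vec p :=
  fderiv ℝ (gradient f) β

/-- The Hessian matrix of `f : ℝ^p → ℝ`. -/
def hessian {p : ℕ} (f : Vec p → ℝ) (β : Vec p) : Matrix (Fin p) (Fin p) ℝ :=
  jacobian (gradient f) β

/-- `aᵀ A a`, the criterion written `‖a‖_A`. -/
def quadForm {p : ℕ} (A : Matrix (Fin p) (Fin p) ℝ) (a : Vec p) : ℝ :=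
  a.ofLp ⬝ᵥ (A *ᵥ a.ofLp)

/-! ### The model -/

/-- A parametric model with data generating equations `D = G n θ u`, `u ∼ Fu n`, and a released
statistic `s = argmin_{β ∈ 𝔹} ρ n β D w`, where `w ∼ Fdp n` is the randomness of the privacy
mechanism; `n` is the sample size.  When the minimizer is not unique, `s` is a fixed measurable
choice of it. -/
structure Model (p q : ℕ) (U W 𝒟 : ℕ → Type*) [∀ n, MeasurableSpace (U n)]
    [∀ n, MeasurableSpace (W n)] [∀ n, MeasurableSpace (𝒟 n)] where
  Θ : Set (Vec q)
  𝔹 : Set (Vec p)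
  Fu : ∀ n, Measure (U n)
  Fdp : ∀ n, Measure (W n)
  prob_Fu : ∀ n, IsProbabilityMeasure (Fu n)
  prob_Fdp : ∀ n, IsProbabilityMeasure (Fdp n)
  G : ∀ n, Vec q → U n → 𝒟 n
  measurable_G : ∀ n, ∀ θ ∈ Θ, Measurable (G n θ)
  ρ : ∀ n, Vec p → 𝒟 n → W n → ℝ
  s : ∀ n, 𝒟 n → W n → Vec p
  s_mem : ∀ n D w, s n D w ∈ 𝔹
  s_min : ∀ n D w, ∀ β ∈ 𝔹, ρ n (s n D w) D w ≤ ρ n β D w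
  measurable_s : ∀ n, Measurable fun z : 𝒟 n × W n => s n z.1 z.2

attribute [instance] Model.prob_Fu Model.prob_Fdp

namespace Model

variable {p q : ℕ} {U W 𝒟 : ℕ → Type*} [∀ n, MeasurableSpace (U n)]
  [∀ n, MeasurableSpace (W n)] [∀ n, MeasurableSpace (𝒟 n)] (M : Model p q U W 𝒟)

/-- The law of one pair of seeds `(u, u_DP)`. -/
def seedLaw (n : ℕ) : Measure (U n × W n) := (M.Fu n).prod (M.Fdp n)

instance (n : ℕ) : IsProbabilityMeasure (M.seedLaw n) := by
  unfold seedLaw; infer_instance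

/-- The law of the `R` pairs of seeds `(u^r, u_DP^r)` used for simulation. -/
def simLaw (n R : ℕ) : Measure (Fin R → U n × W n) := Measure.pi fun _ => M.seedLaw n

instance (n R : ℕ) : IsProbabilityMeasure (M.simLaw n R) := by
  unfold simLaw; infer_instance

/-- The joint law of the seeds of the observed data and of the simulation seeds. -/
def law (n R : ℕ) : Measure ((U n × W n) × (Fin R → U n × W n)) :=
  (M.seedLaw n).prod (M.simLaw n R)

instance (n R : ℕ) : IsProbabilityMeasure (M.law n R) := by
  unfold law; infer_instance

/-- The released statistic under the parameter `θ`, as a function of its seeds: `s` for the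
observed data, `s^r(θ)` for the simulated ones. -/
def stat (n : ℕ) (θ : Vec q) (ω : U n × W n) : Vec p := M.s n (M.G n θ ω.1) ω.2

/-- What the analyst holds when the data come from `θ`: the released statistic and the
simulation seeds. -/
def draw (n R : ℕ) (θ : Vec q) (ω : (U n × W n) × (Fin R → U n × W n)) :
    Vec p × (Fin R → U n × W n) :=
  (M.stat n θ ω.1, ω.2)

/-- `m^R(θ)`, the mean of the simulated statistics. -/
def simMean (n R : ℕ) (r : Fin R → U n × W n) (θ : Vec q) : Vec p :=
  (R : ℝ)⁻¹ • ∑ k, M.stat n θ (r k)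

/-- `S^R(θ)`, the sample covariance matrix of the simulated statistics. -/
def simCov (n R : ℕ) (r : Fin R → U n × W n) (θ : Vec q) : Matrix (Fin p) (Fin p) ℝ :=
  ((R : ℝ) - 1)⁻¹ • ∑ k, Matrix.vecMulVec (M.stat n θ (r k) - M.simMean n R r θ).ofLp
    (M.stat n θ (r k) - M.simMean n R r θ).ofLp

/-! ### The estimators -/

/-- `est` is an indirect estimator with weights `Ω n`: a measurable choice of
`argmin_{θ ∈ Θ} ‖s - m^R(θ)‖_{Ω n}`. -/
structure IsIND (R : ℕ → ℕ) (Ω : ℕ → Matrix (Fin p) (Fin p) ℝ)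
    (est : ∀ n, Vec p × (Fin (R n) → U n × W n) → Vec q) : Prop where
  measurable : ∀ n, Measurable (est n)
  mem : ∀ n, ∀ s ∈ M.𝔹, ∀ r, est n (s, r) ∈ M.Θ
  min : ∀ n, ∀ s ∈ M.𝔹, ∀ r, ∀ θ ∈ M.Θ,
    quadForm (Ω n) (s - M.simMean n (R n) r (est n (s, r))) ≤
      quadForm (Ω n) (s - M.simMean n (R n) r θ)

/-- `est` is an adaptive indirect estimator: a measurable choice of
`argmin_{θ ∈ Θ} ‖s - m^R(θ)‖_{S^R(θ)⁻¹}`.  For simulation seeds where the criterion is undefined,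
because some `S^R(θ)` is singular, the value of `est` is an arbitrary point of `Θ`. -/
structure IsADI (R : ℕ → ℕ)
    (est : ∀ n, Vec p × (Fin (R n) → U n × W n) → Vec q) : Prop where
  measurable : ∀ n, Measurable (est n)
  mem : ∀ n, ∀ s ∈ M.𝔹, ∀ r, est n (s, r) ∈ M.Θ
  min : ∀ n, ∀ s ∈ M.𝔹, ∀ r, (∀ θ ∈ M.Θ, IsUnit (M.simCov n (R n) r θ).det) → ∀ θ ∈ M.Θ,
    quadForm (M.simCov n (R n) r (est n (s, r)))⁻¹
        (s - M.simMean n (R n) r (est n (s, r))) ≤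
      quadForm (M.simCov n (R n) r θ)⁻¹ (s - M.simMean n (R n) r θ)

/-! ### Assumptions -/

/-- Uniform convergence of the criterion at the true parameter. -/
structure A1 (θs : Vec q) (ρinf : Vec q → Vec p → ℝ) : Prop where
  continuousOn : ContinuousOn (ρinf θs) M.𝔹
  tendsto : TendstoInProbUniformlyOn M.seedLaw
    (fun n β ω => M.ρ n β (M.G n θs ω.1) ω.2) (ρinf θs) M.𝔹

/-- The binding function `b(θ) = argmin_{β ∈ 𝔹} ρ_∞(β; θ)` and its regularity. -/
structure A2 (θs : Vec q) (ρinf : Vec q → Vec p → ℝ) (b : Vec q → Vec p) : Prop where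
  b_mem : ∀ θ ∈ M.Θ, b θ ∈ M.𝔹
  b_min : ∀ θ ∈ M.Θ, ∀ β ∈ M.𝔹, β ≠ b θ → ρinf θ (b θ) < ρinf θ β
  b_interior : b θs ∈ interior M.𝔹
  s_interior : ∀ n D w, M.s n D w ∈ interior M.𝔹
  continuousOn : ContinuousOn b M.Θ
  injOn : Set.InjOn b M.Θ
  differentiableAt : ∀ θ ∈ interior M.Θ, DifferentiableAt ℝ b θ
  full_rank : ∀ θ ∈ interior M.Θ, Function.Injective (fderiv ℝ b θ)

/-- Identification: `b(θ)` stays away from `b(θ*)` when `θ` stays away from `θ*` (a consequence of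
the continuity and the injectivity of `b` when `Θ` is compact). -/
def WellSeparated (θs : Vec q) (b : Vec q → Vec p) : Prop :=
  ∀ ε : ℝ, 0 < ε → ∃ δ : ℝ, 0 < δ ∧ ∀ θ ∈ M.Θ, ε ≤ ‖θ - θs‖ → δ ≤ ‖b θ - b θs‖

/-- `sup_{θ ∈ Θ} ‖s^r(θ) - b(θ)‖ → 0` in probability. -/
def A3 (b : Vec q → Vec p) : Prop :=
  TendstoInProbUniformlyOn M.seedLaw M.stat b M.Θ

/-- Smoothness of `s^r` and `b`, and convergence of the Jacobian of `s^r` to that of `b`, along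
every random sequence `θ_n → θ*` in probability. -/
structure A5 (θs : Vec q) (b : Vec q → Vec p) : Prop where
  stat_smooth : ∀ n ω, ContDiffOn ℝ 1 (fun θ => M.stat n θ ω) (interior M.Θ)
  b_smooth : ContDiffOn ℝ 1 b (interior M.Θ)
  tendsto : ∀ θn : ∀ n, U n × W n → Vec q, TendstoInProb M.seedLaw θn θs →
    TendstoInProb M.seedLaw (fun n ω => fderiv ℝ (fun θ => M.stat n θ ω) (θn n ω))
      (fderiv ℝ b θs)

/-- Asymptotic law `F` of the score at `β* = b(θ*)`. -/
structure A6 (θs : Vec q) (b : Vec q → Vec p) (F : Measure (Vec p)) [IsProbabilityMeasure F] :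
    Prop where
  smooth : ∀ n D w, ContDiffOn ℝ 1 (fun β => M.ρ n β D w) (interior M.𝔹)
  tendsto : TendstoInDistribution
    (fun (n : ℕ) (ω : U n × W n) =>
      √(n : ℝ) • (-gradient (fun β => M.ρ n β (M.G n θs ω.1) ω.2) (b θs)))
    atTop id M.seedLaw F

/-- Convergence of the Hessian of the criterion to the invertible matrix
`J* = ∂²ρ_∞(β*; θ*)`, along every random sequence `β_n → β*` in probability. -/
structure A7 (θs : Vec q) (ρinf : Vec q → Vec p → ℝ) (b : Vec q → Vec p) : Prop where
  smooth : ∀ n D w, ContDiffOn ℝ 2 (fun β => M.ρ n β D w) (interior M.𝔹)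
  limit_differentiable : ∀ᶠ β in 𝓝 (b θs), DifferentiableAt ℝ (ρinf θs) β
  limit_twice_differentiable : DifferentiableAt ℝ (gradient (ρinf θs)) (b θs)
  tendsto : ∀ βn : ∀ n, U n × W n → Vec p, TendstoInProb M.seedLaw βn (b θs) →
    TendstoInProb M.seedLaw
      (fun n ω => hessianMap (fun β => M.ρ n β (M.G n θs ω.1) ω.2) (βn n ω))
      (hessianMap (ρinf θs) (b θs))
  invertible : IsUnit (hessian (ρinf θs) (b θs)).det

/-- The asymptotic variance `Σ(θ)` of `√n (s^r(θ) - b(θ))`, the limit of the variances and the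
variance of the limit law, and its estimation by simulation. -/
structure A8 (R : ℕ → ℕ) (θs : Vec q) (b : Vec q → Vec p)
    (Sig : Vec q → Matrix (Fin p) (Fin p) ℝ) : Prop where
  memLp : ∀ θ ∈ M.Θ, ∀ᶠ n in atTop, MemLp (M.stat n θ) 2 (M.seedLaw n)
  tendsto_var : ∀ θ ∈ M.Θ, ∀ i j, Tendsto
    (fun n : ℕ => cov[fun ω => √(n : ℝ) * (M.stat n θ ω i - b θ i),
      fun ω => √(n : ℝ) * (M.stat n θ ω j - b θ j); M.seedLaw n]) atTop (𝓝 (Sig θ i j))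
  var_limit : ∀ θ ∈ M.Θ, ∃ L : ProbabilityMeasure (Vec p),
    TendstoInDistribution (fun (n : ℕ) ω => √(n : ℝ) • (M.stat n θ ω - b θ)) atTop id
      M.seedLaw (L : Measure (Vec p)) ∧
    MemLp id 2 (L : Measure (Vec p)) ∧
    ∀ i j, cov[fun x : Vec p => x i, fun x => x j; (L : Measure (Vec p))] = Sig θ i j
  posDef : ∀ θ ∈ M.Θ, (Sig θ).PosDef
  continuousOn : ContinuousOn Sig M.Θ
  simMean_rate : TendstoInProb (fun n => M.simLaw n (R n))
    (fun n r => √(n : ℝ) • (M.simMean n (R n) r θs - b θs)) 0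
  simMean_uniform : TendstoInProbUniformlyOn (fun n => M.simLaw n (R n))
    (fun n θ r => M.simMean n (R n) r θ) b M.Θ
  simCov_uniform : ∀ i j, TendstoInProbUniformlyOn (fun n => M.simLaw n (R n))
    (fun n θ r => (n : ℝ) * M.simCov n (R n) r θ i j) (fun θ => Sig θ i j) M.Θ

/-- The eigenvalues of `Σ(θ)` are bounded away from `0` and `∞` over `Θ` (a consequence of the
continuity and the positive definiteness of `Σ` when `Θ` is compact). -/
def UniformlyElliptic (Sig : Vec q → Matrix (Fin p) (Fin p) ℝ) : Prop :=
  ∃ c C : ℝ, 0 < c ∧ ∀ θ ∈ M.Θ, ∀ x : Vec p,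
    c * ‖x‖ ^ 2 ≤ quadForm (Sig θ) x ∧ quadForm (Sig θ) x ≤ C * ‖x‖ ^ 2

/-- Behaviour of the derivatives of `m^R` and `n S^R` along random sequences `θ_n → θ*`. -/
structure A9 (R : ℕ → ℕ) (θs : Vec q) (b : Vec q → Vec p) : Prop where
  mean : ∀ θn : ∀ n, (Fin (R n) → U n × W n) → Vec q,
    TendstoInProb (fun n => M.simLaw n (R n)) θn θs →
    TendstoInProb (fun n => M.simLaw n (R n))
      (fun n r => fderiv ℝ (M.simMean n (R n) r) (θn n r)) (fderiv ℝ b θs)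
  cov : ∀ θn : ∀ n, (Fin (R n) → U n × W n) → Vec q,
    TendstoInProb (fun n => M.simLaw n (R n)) θn θs →
    ∀ i j, BoundedInProb (fun n => M.simLaw n (R n))
      (fun n r => fderiv ℝ (fun θ => (n : ℝ) * M.simCov n (R n) r θ i j) (θn n r))

/-! ### The parametric bootstrap -/

/-- The root `(τ̂(s) - τ(θ)) / σ̂(s)` when the data come from `θ`.  The statistics may use the
simulation seeds. -/
def root (R : ℕ → ℕ) (tauHat sigHat : ∀ n, Vec p × (Fin (R n) → U n × W n) → ℝ)
    (tau : Vec q → ℝ) (n : ℕ) (θ : Vec q) (ω : (U n × W n) × (Fin (R n) → U n × W n)) : ℝ :=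
  (tauHat n (M.draw n (R n) θ ω) - tau θ) / sigHat n (M.draw n (R n) θ ω)

/-- The distribution function of the root when the data come from `θ`. -/
def rootCdf (R : ℕ → ℕ) (tauHat sigHat : ∀ n, Vec p × (Fin (R n) → U n × W n) → ℝ)
    (tau : Vec q → ℝ) (n : ℕ) (θ : Vec q) (t : ℝ) : ℝ :=
  (M.law n (R n)).real {ω | M.root R tauHat sigHat tau n θ ω ≤ t}

/-- Consistency of the parametric bootstrap in Kolmogorov-Smirnov distance.  Given the observation,
the bootstrap draw follows the model with parameter `θ̂(s)`, with seeds independent of the observed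
ones, so that the conditional distribution function of the bootstrap root is
`rootCdf` evaluated at the parameter `θ̂(s)`. -/
def PBConsistent (R : ℕ → ℕ) (θs : Vec q)
    (est : ∀ n, Vec p × (Fin (R n) → U n × W n) → Vec q)
    (tauHat sigHat : ∀ n, Vec p × (Fin (R n) → U n × W n) → ℝ) (tau : Vec q → ℝ) : Prop :=
  TendstoInProbUniformlyOn (fun n => M.law n (R n))
    (fun n t ω => M.rootCdf R tauHat sigHat tau n (est n (M.draw n (R n) θs ω)) t
      - M.rootCdf R tauHat sigHat tau n θs t)
    (fun _ : ℝ => (0 : ℝ)) Set.univ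

end Model

/-! ### Limit variables and the studentization -/

/-- `(Bᵀ Ω B)⁻¹ Bᵀ Ω`. -/
def gain {p q : ℕ} (Ω : Matrix (Fin p) (Fin p) ℝ) (B : Matrix (Fin p) (Fin q) ℝ) :
    Matrix (Fin q) (Fin p) ℝ :=
  (Bᵀ * Ω * B)⁻¹ * Bᵀ * Ω

/-- `η'(x) A J⁻¹ v`: with `v` drawn from the limit law of the score, the limit in distribution of
`√n (η(estimator) - η(x))` for an estimator of `x` that is asymptotically `A (s - β*)`. -/
def limitVar {p k : ℕ} (η : Vec k → ℝ) (x : Vec k) (A : Matrix (Fin k) (Fin p) ℝ)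
    (J : Matrix (Fin p) (Fin p) ℝ) (v : Vec p) : ℝ :=
  (gradient η x).ofLp ⬝ᵥ (A *ᵥ (J⁻¹ *ᵥ v.ofLp))

/-- `η₃(θ) = (η₁'(θ) (b'(θ)ᵀ Σ(θ)⁻¹ b'(θ))⁻¹ η₁'(θ)ᵀ)^{1/2}`. -/
def eta3 {p q : ℕ} (η₁ : Vec q → ℝ) (b : Vec q → Vec p)
    (Sig : Vec q → Matrix (Fin p) (Fin p) ℝ) (θ : Vec q) : ℝ :=
  √(quadForm ((jacobian b θ)ᵀ * (Sig θ)⁻¹ * jacobian b θ)⁻¹ (gradient η₁ θ))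

/-- The limit of the studentized statistic: `η₁'(θ*) (Bᵀ Σ⁻¹ B)⁻¹ Bᵀ Σ⁻¹ J⁻¹ v / η₃(θ*)`. -/
def studentizedLimit {p q : ℕ} (η₁ : Vec q → ℝ) (b : Vec q → Vec p)
    (Sig : Vec q → Matrix (Fin p) (Fin p) ℝ) (J : Matrix (Fin p) (Fin p) ℝ) (θs : Vec q)
    (v : Vec p) : ℝ :=
  limitVar η₁ θs (gain (Sig θs)⁻¹ (jacobian b θs)) J v / eta3 η₁ b Sig θs

/-- The law `P` on `ℝ` has a continuous distribution function. -/
def HasContinuousCdf (P : Measure ℝ) : Prop := Continuous fun t : ℝ => P.real (Set.Iic t)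

/-- The root is an approximate pivot at `θs`, with limit variable `T` under the law `F`: along every
local sequence of parameters `θ_n = θs + h_n / √n` with `h_n → h`, the root converges in
distribution to `T`, whatever `h` is; `T` is standardized, and it is standard normal if `F` is
Gaussian. -/
structure Model.IsApproxPivot {p q : ℕ} {U W 𝒟 : ℕ → Type*} [∀ n, MeasurableSpace (U n)]
    [∀ n, MeasurableSpace (W n)] [∀ n, MeasurableSpace (𝒟 n)] (M : Model p q U W 𝒟)
    (R : ℕ → ℕ) (θs : Vec q) (tauHat sigHat : ∀ n, Vec p × (Fin (R n) → U n × W n) → ℝ)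
    (tau : Vec q → ℝ) (F : Measure (Vec p)) [IsProbabilityMeasure F] (T : Vec p → ℝ) : Prop where
  tendsto : ∀ (h : Vec q) (θn : ℕ → Vec q), (∀ n, θn n ∈ M.Θ) →
    Tendsto (fun n : ℕ => √(n : ℝ) • (θn n - θs)) atTop (𝓝 h) →
    TendstoInDistribution (fun n ω => M.root R tauHat sigHat tau n (θn n) ω) atTop T
      (fun n => M.law n (R n)) F
  memLp : MemLp T 2 F
  mean : ∫ v, T v ∂F = 0
  variance : Var[T; F] = 1
  gaussian : IsGaussian F → F.map T = gaussianReal 0 1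

end IndirectInference

end

/-!
The parametric bootstrap is consistent as soon as its root converges in distribution to one
variable `Z` with a continuous distribution function along every sequence of parameters `θ_n` with
`√n (θ_n - θ*)` bounded, and `θ̂(s)` is itself `√n`-consistent
(`pbConsistent_of_tendstoInDistribution`): by Pólya's theorem (`eventually_forall_abs_cdf_sub_lt`)
the distribution functions then converge uniformly over the real line, and, by a choice of nearly
worst parameters, uniformly over balls of radius `C / √n` around `θ*`, in which `θ̂(s)` lies with
high probability.  All that remains is to find the limits of the roots along such sequences.

Under `θ*`, the released statistic is an interior minimizer of a criterion whose Hessian converges,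
so that `√n (s - β*)` is asymptotically `J⁻¹` applied to the scaled score
(`Model.tendsto_scaledStat_sub`).  The seeds are fixed while the parameter moves, so under `θ_n` the
same seeds give a statistic that is shifted by `B (θ_n - θ*) + o(1 / √n)`
(`Model.tendsto_scaledStat_local`), and no change of measure is needed.

Both estimators are minimum distance estimators, with weights `Ω` that may be random and depend on
the parameter.  The derivative of the criterion at the minimizer shows that
`θ̂ - θ* = A (s - m^R(θ*)) + o(s - m^R(θ*))`, with `A = (Bᵀ Ω B)⁻¹ Bᵀ Ω`
(`isLittleO_minimumDistance_gain`).  The derivative of the weights is only bounded in probability,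
but it enters multiplied by the square of a vanishing residual.  Since `A B = 1`, the shift
`B (θ_n - θ*)` of the statistic becomes `θ_n - θ*`, which is what the root subtracts, and the limit
does not depend on the sequence `θ_n`.

For the approximate pivot, the variance of the limit of `√n (s - β*)` is `Σ(θ*)`, and
`A Σ Aᵀ = (Bᵀ Σ⁻¹ B)⁻¹` for the weights `Σ⁻¹` (`gain_mul_mul_transpose`), which gives variance one.
That the limit is centered follows from the rate assumed for the simulated mean: the latter has the
same bias as the statistic and a variance that is smaller by the factor `1 / R_n`, so the bias is
`o(1 / √n)` (`Model.tendsto_integral_scaledStat`), and bounded second moments carry the means to the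
limit.

Convergence in probability on spaces that vary with `n` is handled as convergence along a single
filter `probFilter μ` on the disjoint union of these spaces, which makes the calculus of filters and
of Landau symbols available.  A hypothesis about all random sequences `θ_n → θ*` becomes one about
all functions that converge along that filter.
-/

noncomputable section

namespace IndirectInference

open Asymptotics

/-! ### Convergence in probability as convergence along a filter -/

section ProbFilter

variable {Ω Ω' : ℕ → Type*} [∀ n, MeasurableSpace (Ω n)] [∀ n, MeasurableSpace (Ω' n)]
  {μ : ∀ n, Measure (Ω n)} {ν : ∀ n, Measure (Ω' n)}
  {E F : Type*} [NormedAddCommGroup E] [NormedAddCommGroup F]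

/-- The filter of the events whose probability tends to `1` as `n → ∞`.  The events are subsets of
the disjoint union of the probability spaces, and need not be measurable: `μ n` is used as an outer
measure. -/
def probFilter (μ : ∀ n, Measure (Ω n)) : Filter (Σ n, Ω n) where
  sets := {A | Tendsto (fun n => μ n {ω | (⟨n, ω⟩ : Σ n, Ω n) ∉ A}) atTop (𝓝 0)}
  univ_sets := by simp
  sets_of_superset {A B} hA hAB :=
    tendsto_of_tendsto_of_tendsto_of_le_of_le tendsto_const_nhds hA (fun _ => zero_le)
      fun n => measure_mono fun ω hω h => hω (hAB h)
  inter_sets {A B} hA hB := by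
    have h := Tendsto.add hA hB
    rw [add_zero] at h
    refine tendsto_of_tendsto_of_tendsto_of_le_of_le tendsto_const_nhds h (fun _ => zero_le)
      fun n => (measure_mono ?_).trans (measure_union_le _ _)
    intro ω hω
    by_contra hcon
    simp only [Set.mem_union, Set.mem_ofPred_eq, not_or, not_not] at hcon
    exact hω ⟨hcon.1, hcon.2⟩

theorem eventually_probFilter {P : (Σ n, Ω n) → Prop} :
    (∀ᶠ z in probFilter μ, P z) ↔ Tendsto (fun n => μ n {ω | ¬ P ⟨n, ω⟩}) atTop (𝓝 0) :=
  Iff.rfl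

theorem tendstoInProb_iff {X : ∀ n, Ω n → F} {x : F} :
    TendstoInProb μ X x ↔ Tendsto (fun z : Σ n, Ω n => X z.1 z.2) (probFilter μ) (𝓝 x) := by
  rw [Metric.tendsto_nhds]
  refine forall₂_congr fun ε _ => ?_
  rw [eventually_probFilter]
  simp only [dist_eq_norm, not_lt]

theorem TendstoInProbUniformlyOn.eventually {T : Type*} {X : ∀ n, T → Ω n → F} {x : T → F}
    {S : Set T} (h : TendstoInProbUniformlyOn μ X x S) {ε : ℝ} (hε : 0 < ε) :
    ∀ᶠ z in probFilter μ, ∀ t ∈ S, ‖X z.1 t z.2 - x t‖ < ε := by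
  rw [eventually_probFilter]
  simpa only [not_forall, not_lt, exists_prop] using h ε hε

theorem tendsto_fst_probFilter : Tendsto Sigma.fst (probFilter μ) atTop := by
  rw [tendsto_atTop]
  intro N
  rw [eventually_probFilter]
  refine tendsto_const_nhds.congr' ?_
  filter_upwards [eventually_ge_atTop N] with n hn
  simp [hn]

/-- Events of high probability pull back along maps that preserve the probabilities. -/
theorem tendsto_map_probFilter {π : ∀ n, Ω' n → Ω n}
    (hπ : ∀ n, MeasurePreserving (π n) (ν n) (μ n)) :
    Tendsto (fun z : Σ n, Ω' n => (⟨z.1, π z.1 z.2⟩ : Σ n, Ω n)) (probFilter ν)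
      (probFilter μ) := by
  intro A hA
  refine tendsto_of_tendsto_of_tendsto_of_le_of_le tendsto_const_nhds hA (fun _ => zero_le)
    fun n => ?_
  exact (measure_mono fun ω hω => hω).trans ((hπ n).measure_preimage_le _)

/-- A convergence in probability that does not involve the random element is a convergence of
numbers. -/
theorem tendsto_of_tendsto_fst [∀ n, IsProbabilityMeasure (μ n)] {a : ℕ → F} {x : F}
    (h : Tendsto (fun z : Σ n, Ω n => a z.1) (probFilter μ) (𝓝 x)) :
    Tendsto a atTop (𝓝 x) := by
  intro A hA
  have h1 := eventually_probFilter.1 (h hA)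
  have h2 : ∀ᶠ n in atTop, μ n {ω | ¬ a n ∈ A} < 1 := h1.eventually_lt_const one_pos
  change ∀ᶠ n in atTop, a n ∈ A
  filter_upwards [h2] with n hn
  by_contra hcon
  have : {ω : Ω n | ¬ a n ∈ A} = Set.univ := by
    ext ω
    simpa using hcon
  simp [this] at hn

/-- A sequence that converges in probability stays within a deterministic, shrinking distance of
its limit with probability tending to `1`. -/
theorem exists_tendsto_zero_eventually_dist_le [∀ n, IsProbabilityMeasure (μ n)]
    {g : (Σ n, Ω n) → E} {x₀ : E} (hg : Tendsto g (probFilter μ) (𝓝 x₀)) :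
    ∃ δ : ℕ → ℝ, (∀ n, 0 ≤ δ n) ∧ Tendsto δ atTop (𝓝 0) ∧
      ∀ᶠ z in probFilter μ, dist (g z) x₀ ≤ δ z.1 := by
  -- the Ky Fan distance between `g` and `x₀`, increased a little
  set S : ℕ → Set ℝ := fun n =>
    {δ | 0 ≤ δ ∧ μ n {ω | δ < dist (g ⟨n, ω⟩) x₀} ≤ ENNReal.ofReal δ} with hS
  have hne : ∀ n, (S n).Nonempty := fun n => ⟨1, zero_le_one, by simpa using prob_le_one⟩
  have hbdd : ∀ n, BddBelow (S n) := fun n => ⟨0, fun δ hδ => hδ.1⟩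
  have h0 : ∀ n, 0 ≤ sInf (S n) := fun n => le_csInf (hne n) fun δ hδ => hδ.1
  have hpos : ∀ n : ℕ, (0 : ℝ) < 1 / ((n : ℝ) + 1) := fun n => Nat.one_div_pos_of_nat
  have hlim : Tendsto (fun n => sInf (S n)) atTop (𝓝 0) := by
    rw [Metric.tendsto_atTop']
    intro ε hε
    have h1 := (eventually_probFilter.1
      (hg (Metric.ball_mem_nhds x₀ (half_pos hε)))).eventually_lt_const
      (ENNReal.ofReal_pos.2 (half_pos hε))
    obtain ⟨N, hN⟩ := eventually_atTop.1 h1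
    refine ⟨N, fun n hn => ?_⟩
    rw [Real.dist_eq, sub_zero, abs_of_nonneg (h0 n)]
    refine lt_of_le_of_lt (csInf_le (hbdd n) ⟨(half_pos hε).le, ?_⟩) (half_lt_self hε)
    refine (measure_mono fun ω hω => ?_).trans (hN n hn.le).le
    simp only [Set.mem_ofPred_eq, Metric.mem_ball, not_lt] at hω ⊢
    exact hω.le
  have hlim' : Tendsto (fun n : ℕ => sInf (S n) + 1 / ((n : ℝ) + 1)) atTop (𝓝 0) := by
    simpa using hlim.add tendsto_one_div_add_atTop_nhds_zero_nat
  refine ⟨fun n => sInf (S n) + 1 / ((n : ℝ) + 1), fun n => add_nonneg (h0 n) (hpos n).le,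
    hlim', ?_⟩
  rw [eventually_probFilter]
  have hlim'' := ENNReal.tendsto_ofReal hlim'
  rw [ENNReal.ofReal_zero] at hlim''
  refine tendsto_of_tendsto_of_tendsto_of_le_of_le tendsto_const_nhds hlim'' (fun _ => zero_le)
    fun n => ?_
  obtain ⟨δ, hδ, hlt⟩ := exists_lt_of_csInf_lt (hne n) (lt_add_of_pos_right (sInf (S n)) (hpos n))
  refine (measure_mono fun ω hω => ?_).trans (hδ.2.trans (ENNReal.ofReal_le_ofReal hlt.le))
  simp only [Set.mem_ofPred_eq, not_le] at hω ⊢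
  exact hlt.trans hω

/-- A convergence that holds along every random sequence `g → x₀` defined on the spaces `Ω n` also
holds along the random sequences defined on larger spaces: the worst point in a shrinking ball is a
sequence of the first kind. -/
theorem tendsto_comp_of_forall_tendsto [∀ n, IsProbabilityMeasure (ν n)] {π : ∀ n, Ω' n → Ω n}
    (hπ : ∀ n, MeasurePreserving (π n) (ν n) (μ n)) {Y : (Σ n, Ω n) → E → F} {x₀ : E} {y : F}
    (h : ∀ g : (Σ n, Ω n) → E, Tendsto g (probFilter μ) (𝓝 x₀) →
      Tendsto (fun z => Y z (g z)) (probFilter μ) (𝓝 y))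
    {g : (Σ n, Ω' n) → E} (hg : Tendsto g (probFilter ν) (𝓝 x₀)) :
    Tendsto (fun z => Y ⟨z.1, π z.1 z.2⟩ (g z)) (probFilter ν) (𝓝 y) := by
  classical
  obtain ⟨δ, hδ0, hδ, hgδ⟩ := exists_tendsto_zero_eventually_dist_le hg
  rw [Metric.tendsto_nhds]
  intro ε hε
  -- a point of the shrinking ball at which the convergence fails, if there is one
  set g' : (Σ n, Ω n) → E := fun z =>
    if hz : ∃ x, dist x x₀ ≤ δ z.1 ∧ ε ≤ dist (Y z x) y then hz.choose else x₀ with hg'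
  have hg'δ : ∀ z, dist (g' z) x₀ ≤ δ z.1 := by
    intro z
    simp only [hg']
    split_ifs with hz
    · exact hz.choose_spec.1
    · simpa using hδ0 z.1
  have hg'lim : Tendsto g' (probFilter μ) (𝓝 x₀) :=
    tendsto_iff_dist_tendsto_zero.2
      (squeeze_zero (fun _ => dist_nonneg) hg'δ (hδ.comp tendsto_fst_probFilter))
  have h1 := (h g' hg'lim).eventually (Metric.ball_mem_nhds y hε)
  filter_upwards [hgδ, (tendsto_map_probFilter hπ).eventually h1] with z hz1 hz2
  by_contra hcon
  have hz : ∃ x, dist x x₀ ≤ δ z.1 ∧ ε ≤ dist (Y ⟨z.1, π z.1 z.2⟩ x) y :=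
    ⟨g z, hz1, not_lt.1 hcon⟩
  have h3 : g' ⟨z.1, π z.1 z.2⟩ = hz.choose := dif_pos hz
  rw [h3] at hz2
  exact absurd hz2 (not_lt.2 hz.choose_spec.2)

/-- Uniform convergence in probability, evaluated at a random point of the index set. -/
theorem TendstoInProbUniformlyOn.tendsto_comp {T : Type*} {X : ∀ n, T → Ω n → F} {x : T → F}
    {S : Set T} (h : TendstoInProbUniformlyOn μ X x S) {π : ∀ n, Ω' n → Ω n}
    (hπ : ∀ n, MeasurePreserving (π n) (ν n) (μ n)) {g : (Σ n, Ω' n) → T} (hg : ∀ z, g z ∈ S) :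
    Tendsto (fun z => X z.1 (g z) (π z.1 z.2) - x (g z)) (probFilter ν) (𝓝 0) := by
  rw [Metric.tendsto_nhds]
  intro ε hε
  filter_upwards [(tendsto_map_probFilter hπ).eventually (h.eventually hε)] with z hz
  rw [dist_zero_right]
  exact hz (g z) (hg z)

/-! ### Stochastic boundedness -/

theorem BoundedInProb.comp {X : ∀ n, Ω n → F} (h : BoundedInProb μ X) {π : ∀ n, Ω' n → Ω n}
    (hπ : ∀ n, MeasurePreserving (π n) (ν n) (μ n)) :
    BoundedInProb ν fun n ω => X n (π n ω) := by
  intro ε hε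
  obtain ⟨C, hC⟩ := h ε hε
  refine ⟨C, hC.mono fun n hn => ?_⟩
  exact ((measure_mono fun ω hω => hω).trans ((hπ n).measure_preimage_le _)).trans hn

theorem BoundedInProb.of_isBigO {X : ∀ n, Ω n → E} {Y : ∀ n, Ω n → F} (h : BoundedInProb μ X)
    (hY : (fun z : Σ n, Ω n => Y z.1 z.2) =O[probFilter μ] fun z => X z.1 z.2) :
    BoundedInProb μ Y := by
  intro ε hε
  obtain ⟨C, hC⟩ := h (ε / 2) (half_pos hε)
  obtain ⟨K, hK, hKY⟩ := hY.exists_pos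
  refine ⟨K * C, ?_⟩
  have h1 := (eventually_probFilter.1 hKY.bound).eventually_lt_const
    (ENNReal.ofReal_pos.2 (half_pos hε))
  filter_upwards [hC, h1] with n hn1 hn2
  have hsub : {ω | K * C < ‖Y n ω‖} ⊆ {ω | C < ‖X n ω‖} ∪ {ω | ¬ ‖Y n ω‖ ≤ K * ‖X n ω‖} := by
    intro ω hω
    by_contra hcon
    simp only [Set.mem_union, Set.mem_ofPred_eq, not_or, not_not, not_lt] at hcon hω
    exact absurd hω (not_lt.2 (hcon.2.trans (by gcongr; exact hcon.1)))
  calc μ n {ω | K * C < ‖Y n ω‖} ≤ _ := (measure_mono hsub).trans (measure_union_le _ _)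
    _ ≤ ENNReal.ofReal (ε / 2) + ENNReal.ofReal (ε / 2) := add_le_add hn1 hn2.le
    _ = ENNReal.ofReal ε := by
      rw [← ENNReal.ofReal_add (half_pos hε).le (half_pos hε).le, add_halves]

theorem BoundedInProb.add {X Y : ∀ n, Ω n → F} (hX : BoundedInProb μ X)
    (hY : BoundedInProb μ Y) : BoundedInProb μ fun n ω => X n ω + Y n ω := by
  intro ε hε
  obtain ⟨C, hC⟩ := hX (ε / 2) (half_pos hε)
  obtain ⟨D, hD⟩ := hY (ε / 2) (half_pos hε)
  refine ⟨C + D, ?_⟩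
  filter_upwards [hC, hD] with n hn1 hn2
  have hsub : {ω | C + D < ‖X n ω + Y n ω‖} ⊆ {ω | C < ‖X n ω‖} ∪ {ω | D < ‖Y n ω‖} := by
    intro ω hω
    by_contra hcon
    simp only [Set.mem_union, Set.mem_ofPred_eq, not_or, not_lt] at hcon hω
    exact absurd hω (not_lt.2 ((norm_add_le _ _).trans (add_le_add hcon.1 hcon.2)))
  calc μ n {ω | C + D < ‖X n ω + Y n ω‖} ≤ _ := (measure_mono hsub).trans (measure_union_le _ _)
    _ ≤ ENNReal.ofReal (ε / 2) + ENNReal.ofReal (ε / 2) := add_le_add hn1 hn2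
    _ = ENNReal.ofReal ε := by
      rw [← ENNReal.ofReal_add (half_pos hε).le (half_pos hε).le, add_halves]

theorem boundedInProb_of_eventually_le {X : ∀ n, Ω n → F} {C : ℝ}
    (h : ∀ᶠ z in probFilter μ, ‖X z.1 z.2‖ ≤ C) : BoundedInProb μ X := by
  intro ε hε
  refine ⟨C, ?_⟩
  filter_upwards [(eventually_probFilter.1 h).eventually_lt_const (ENNReal.ofReal_pos.2 hε)]
    with n hn
  simpa only [not_le] using hn.le

theorem boundedInProb_of_tendsto {X : ∀ n, Ω n → F} {x : F}
    (h : Tendsto (fun z : Σ n, Ω n => X z.1 z.2) (probFilter μ) (𝓝 x)) : BoundedInProb μ X :=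
  boundedInProb_of_eventually_le (C := ‖x‖ + 1)
    ((h.norm.eventually (gt_mem_nhds (lt_add_one _))).mono fun _ hz => le_of_lt hz)

theorem BoundedInProb.sum {ι : Type*} {X : ι → ∀ n, Ω n → F} (s : Finset ι)
    (h : ∀ i ∈ s, BoundedInProb μ (X i)) : BoundedInProb μ fun n ω => ∑ i ∈ s, X i n ω := by
  classical
  induction s using Finset.induction_on with
  | empty =>
    exact boundedInProb_of_eventually_le (C := 0) (Eventually.of_forall fun z => by simp)
  | insert i s hi ih =>
    simp only [Finset.sum_insert hi]
    exact (h i (Finset.mem_insert_self i s)).add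
      (ih fun j hj => h j (Finset.mem_insert_of_mem hj))

theorem BoundedInProb.tendsto_zero_of_isLittleO {X : ∀ n, Ω n → E} (hX : BoundedInProb μ X)
    {Y : (Σ n, Ω n) → F} (hY : Y =o[probFilter μ] fun z => X z.1 z.2) :
    Tendsto Y (probFilter μ) (𝓝 0) := by
  rw [Metric.tendsto_nhds]
  intro ε hε
  rw [eventually_probFilter, ENNReal.tendsto_nhds_zero]
  intro η hη
  obtain ⟨η', hη', hle⟩ : ∃ η' : ℝ, 0 < η' ∧ ENNReal.ofReal η' ≤ η := by
    rcases eq_or_ne η ⊤ with rfl | h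
    · exact ⟨1, one_pos, le_top⟩
    · exact ⟨η.toReal, ENNReal.toReal_pos hη.ne' h, (ENNReal.ofReal_toReal h).le⟩
  obtain ⟨C, hC⟩ := hX (η' / 2) (half_pos hη')
  have hC1 : 0 < |C| + 1 := by positivity
  have h1 := (eventually_probFilter.1 (hY.bound (half_pos (div_pos hε hC1)))).eventually_lt_const
    (ENNReal.ofReal_pos.2 (half_pos hη'))
  filter_upwards [hC, h1] with n hn1 hn2
  have hsub : {ω | ¬ dist (Y ⟨n, ω⟩) 0 < ε} ⊆
      {ω | C < ‖X n ω‖} ∪ {ω | ¬ ‖Y ⟨n, ω⟩‖ ≤ ε / (|C| + 1) / 2 * ‖X n ω‖} := by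
    intro ω hω
    by_contra hcon
    simp only [Set.mem_union, Set.mem_ofPred_eq, not_or, not_not, not_lt, dist_zero_right]
      at hcon hω
    have h2 : ε / (|C| + 1) / 2 * ‖X n ω‖ ≤ ε / (|C| + 1) / 2 * (|C| + 1) := by
      gcongr
      exact hcon.1.trans ((le_abs_self C).trans (lt_add_one _).le)
    have h3 : ε / (|C| + 1) / 2 * (|C| + 1) = ε / 2 := by field_simp
    linarith [hcon.2]
  calc μ n {ω | ¬ dist (Y ⟨n, ω⟩) 0 < ε}
      ≤ _ := (measure_mono hsub).trans (measure_union_le _ _)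
    _ ≤ ENNReal.ofReal (η' / 2) + ENNReal.ofReal (η' / 2) := add_le_add hn1 hn2.le
    _ = ENNReal.ofReal η' := by
      rw [← ENNReal.ofReal_add (half_pos hη').le (half_pos hη').le, add_halves]
    _ ≤ η := hle

theorem BoundedInProb.tendsto_smul_zero [NormedSpace ℝ F] {X : ∀ n, Ω n → F}
    (hX : BoundedInProb μ X) {a : (Σ n, Ω n) → ℝ} (ha : Tendsto a (probFilter μ) (𝓝 0)) :
    Tendsto (fun z => a z • X z.1 z.2) (probFilter μ) (𝓝 0) := by
  refine hX.tendsto_zero_of_isLittleO ?_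
  have h := ((isLittleO_one_iff ℝ).2 ha).smul_isBigO
    (isBigO_refl (fun z : Σ n, Ω n => X z.1 z.2) (probFilter μ))
  simpa using h

/-- A stochastic boundedness that holds along every random sequence `g → x₀` defined on the spaces
`Ω n` also holds along the random sequences defined on larger spaces, in the form that a product
with a factor that tends to zero tends to zero. -/
theorem tendsto_norm_mul_of_forall_boundedInProb [NormedSpace ℝ F]
    [∀ n, IsProbabilityMeasure (ν n)] {π : ∀ n, Ω' n → Ω n}
    (hπ : ∀ n, MeasurePreserving (π n) (ν n) (μ n)) {Y : ∀ n, Ω n → E → F} {x₀ : E}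
    (h : ∀ g : ∀ n, Ω n → E, TendstoInProb μ g x₀ → BoundedInProb μ fun n ω => Y n ω (g n ω))
    {g : (Σ n, Ω' n) → E} (hg : Tendsto g (probFilter ν) (𝓝 x₀)) {a : (Σ n, Ω' n) → ℝ}
    (ha : Tendsto a (probFilter ν) (𝓝 0)) :
    Tendsto (fun z => ‖Y z.1 (π z.1 z.2) (g z)‖ * a z) (probFilter ν) (𝓝 0) := by
  -- a deterministic bound for `a` makes the product a function on the spaces `Ω n`
  obtain ⟨δ, hδ0, hδ, haδ⟩ := exists_tendsto_zero_eventually_dist_le ha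
  have hY : ∀ g : (Σ n, Ω n) → E, Tendsto g (probFilter μ) (𝓝 x₀) →
      Tendsto (fun z : Σ n, Ω n => δ z.1 • Y z.1 z.2 (g z)) (probFilter μ) (𝓝 0) := fun g hg =>
    (h (fun n ω => g ⟨n, ω⟩) (tendstoInProb_iff.2 hg)).tendsto_smul_zero
      (hδ.comp tendsto_fst_probFilter)
  have h1 : Tendsto (fun z : Σ n, Ω' n => δ z.1 • Y z.1 (π z.1 z.2) (g z)) (probFilter ν)
      (𝓝 0) := tendsto_comp_of_forall_tendsto hπ
        (Y := fun (z : Σ n, Ω n) x => δ z.1 • Y z.1 z.2 x) hY hg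
  refine squeeze_zero_norm' ?_ (tendsto_zero_iff_norm_tendsto_zero.1 h1)
  filter_upwards [haδ] with z hz
  rw [dist_zero_right] at hz
  rw [norm_mul, norm_norm, norm_smul, Real.norm_of_nonneg (hδ0 z.1), mul_comm]
  exact mul_le_mul_of_nonneg_right hz (norm_nonneg _)

end ProbFilter

/-! ### Expansions along a filter -/

section Expansions

variable {Z : Type*} {l : Filter Z} {E F : Type*} [NormedAddCommGroup E] [NormedSpace ℝ E]
  [NormedAddCommGroup F] [NormedSpace ℝ F]

/-- First-order expansion of functions whose derivatives converge along every family of points that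
converges to `x₀`: the mean value inequality, applied at the worst point between `x₀` and `g z`. -/
theorem isLittleO_sub_of_forall_tendsto_fderiv {f : Z → E → F} {x₀ : E} {D : E →L[ℝ] F} {r : ℝ}
    (hr : 0 < r) (hf : ∀ z, ∀ x ∈ Metric.ball x₀ r, DifferentiableAt ℝ (f z) x)
    (h : ∀ g : Z → E, Tendsto g l (𝓝 x₀) → Tendsto (fun z => fderiv ℝ (f z) (g z)) l (𝓝 D))
    {g : Z → E} (hg : Tendsto g l (𝓝 x₀)) :
    (fun z => f z (g z) - f z x₀ - D (g z - x₀)) =o[l] fun z => g z - x₀ := by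
  classical
  rw [isLittleO_iff]
  intro c hc
  -- a point where the derivative is not yet within `c` of `D`, if there is one
  set ξ : Z → E := fun z =>
    if hz : ∃ x ∈ Metric.closedBall x₀ (dist (g z) x₀), c < ‖fderiv ℝ (f z) x - D‖
      then hz.choose else x₀ with hξ
  have hξd : ∀ z, dist (ξ z) x₀ ≤ dist (g z) x₀ := by
    intro z
    simp only [hξ]
    split_ifs with hz
    · exact hz.choose_spec.1
    · simp
  have hξlim : Tendsto ξ l (𝓝 x₀) := tendsto_iff_dist_tendsto_zero.2
    (squeeze_zero (fun _ => dist_nonneg) hξd (tendsto_iff_dist_tendsto_zero.1 hg))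
  filter_upwards [(h ξ hξlim).eventually (Metric.closedBall_mem_nhds D hc),
    hg.eventually (Metric.ball_mem_nhds x₀ hr)] with z hz1 hz2
  have hnot : ¬ ∃ x ∈ Metric.closedBall x₀ (dist (g z) x₀), c < ‖fderiv ℝ (f z) x - D‖ := by
    intro hz
    have h3 : ξ z = hz.choose := dif_pos hz
    rw [h3, dist_eq_norm] at hz1
    exact absurd hz.choose_spec.2 (not_lt.2 hz1)
  push Not at hnot
  exact (convex_closedBall x₀ (dist (g z) x₀)).norm_image_sub_le_of_norm_fderiv_le'
    (fun x hx => hf z x (lt_of_le_of_lt hx hz2)) hnot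
    (Metric.mem_closedBall_self dist_nonneg) (Metric.mem_closedBall.2 le_rfl)

/-- Inversion of a linear equation that holds up to a relative error. -/
theorem isLittleO_sub_of_leftInverse {e : Z → E} {y : Z → F} {A : E →L[ℝ] F} {A' : F →L[ℝ] E}
    (hA : ∀ x, A' (A x) = x) (h : (fun z => A (e z) - y z) =o[l] e) :
    (fun z => e z - A' (y z)) =o[l] y := by
  have h1 : (fun z => e z - A' (y z)) =o[l] e := by
    refine ((A'.isBigO_comp _ l).trans_isLittleO h).congr_left fun z => ?_
    rw [map_sub, hA]
  have h2 : e =O[l] fun z => A' (y z) :=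
    h1.right_isBigO_sub.congr_right fun z => sub_sub_cancel _ _
  exact h1.trans_isBigO (h2.trans (A'.isBigO_comp _ l))

/-- If a projection `G` along the range of `B` nearly annihilates the residual `w = y - B e`, then
`e` is nearly `G y`. -/
theorem isLittleO_sub_of_residual {e : Z → E} {y w : Z → F} {B : E →L[ℝ] F} {G : F →L[ℝ] E}
    (hGB : ∀ x, G (B x) = x) (hw : (fun z => w z - (y z - B (e z))) =o[l] e)
    (hG : (fun z => G (w z)) =o[l] w) :
    (fun z => e z - G (y z)) =o[l] y := by
  set M : Z → ℝ := fun z => ‖y z‖ + ‖e z‖ with hM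
  have hMn : ∀ z, ‖M z‖ = ‖y z‖ + ‖e z‖ := fun z => Real.norm_of_nonneg (by positivity)
  have heM : e =O[l] M := isBigO_of_le _ fun z => by rw [hMn]; linarith [norm_nonneg (y z)]
  have hyM : y =O[l] M := isBigO_of_le _ fun z => by rw [hMn]; linarith [norm_nonneg (e z)]
  have hwM : w =O[l] M := by
    have h1 : (fun z => y z - B (e z)) =O[l] M := hyM.sub ((B.isBigO_comp e l).trans heM)
    exact ((hw.isBigO.trans heM).add h1).congr_left fun z => sub_add_cancel _ _
  have hd : (fun z => e z - G (y z)) =o[l] M := by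
    have h1 : (fun z => G (w z - (y z - B (e z)))) =o[l] M :=
      ((G.isBigO_comp _ l).trans_isLittleO hw).trans_isBigO heM
    refine (h1.sub (hG.trans_isBigO hwM)).congr_left fun z => ?_
    simp only [map_sub, hGB]
    abel
  -- `‖e‖ ≤ ‖e - G y‖ + ‖G‖ ‖y‖ ≤ (‖y‖ + ‖e‖) / 2 + ‖G‖ ‖y‖` turns `o(M)` into `o(y)`
  refine hd.trans_isBigO (IsBigO.of_bound (2 * (1 + ‖G‖)) ?_)
  filter_upwards [hd.bound (half_pos one_pos)] with z hz
  rw [hMn] at hz ⊢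
  have h1 : ‖e z‖ ≤ ‖e z - G (y z)‖ + ‖G (y z)‖ := by
    simpa using norm_add_le (e z - G (y z)) (G (y z))
  linarith [G.le_opNorm (y z)]

end Expansions

/-! ### Minimum distance estimation -/

section MinimumDistance

open ContinuousLinearMap
open scoped InnerProductSpace

variable {E F : Type*} [NormedAddCommGroup E] [InnerProductSpace ℝ E] [CompleteSpace E]
  [NormedAddCommGroup F] [InnerProductSpace ℝ F] [CompleteSpace F]

/-- First-order condition for a weighted distance whose weight depends on the parameter: the term
that comes from the derivative of the weight is quadratic in the residual. -/
theorem norm_adjoint_fderiv_le_of_isLocalMin {m : E → F} {K : E → F →L[ℝ] F} {s : F} {θ : E}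
    (hm : DifferentiableAt ℝ m θ) (hK : DifferentiableAt ℝ K θ)
    (hsym : ∀ x y, ⟪K θ x, y⟫_ℝ = ⟪x, K θ y⟫_ℝ)
    (hmin : IsLocalMin (fun t => ⟪s - m t, K t (s - m t)⟫_ℝ) θ) :
    ‖adjoint (fderiv ℝ m θ) (K θ (s - m θ))‖ ≤ ‖fderiv ℝ K θ‖ * ‖s - m θ‖ ^ 2 := by
  have hW : HasFDerivAt (fun t => s - m t) (-fderiv ℝ m θ) θ := hm.hasFDerivAt.const_sub s
  have hQ := hW.inner ℝ (hK.hasFDerivAt.clm_apply hW)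
  have h0 := hmin.hasFDerivAt_eq_zero hQ
  set a := adjoint (fderiv ℝ m θ) (K θ (s - m θ)) with ha
  -- the derivative of the criterion vanishes; it is evaluated in the direction `a` itself
  have h1 := congrArg (fun L : E →L[ℝ] ℝ => L a) h0
  have h2 : ⟪fderiv ℝ m θ a, K θ (s - m θ)⟫_ℝ = ‖a‖ ^ 2 := by
    rw [← adjoint_inner_right, ← ha, real_inner_self_eq_norm_sq]
  have h3 : ⟪s - m θ, K θ (fderiv ℝ m θ a)⟫_ℝ = ‖a‖ ^ 2 := by
    rw [← hsym, real_inner_comm, h2]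
  have h4 : 2 * ‖a‖ ^ 2 = ⟪s - m θ, (fderiv ℝ K θ a) (s - m θ)⟫_ℝ := by
    simp [fderivInnerCLM_apply, inner_add_right, h2, h3, -map_sub] at h1
    linarith
  have h5 : ⟪s - m θ, (fderiv ℝ K θ a) (s - m θ)⟫_ℝ ≤
      ‖s - m θ‖ * (‖fderiv ℝ K θ‖ * ‖a‖ * ‖s - m θ‖) :=
    (real_inner_le_norm _ _).trans (by
      gcongr
      exact (le_opNorm _ _).trans (by gcongr; exact le_opNorm _ _))
  rcases (norm_nonneg a).eq_or_lt with h6 | h6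
  · rw [← h6]
    positivity
  · have h7 : ‖a‖ * (2 * ‖a‖) ≤ ‖a‖ * (‖fderiv ℝ K θ‖ * ‖s - m θ‖ ^ 2) := by linarith
    have h8 := le_of_mul_le_mul_left h7 h6
    linarith

variable {Z : Type*} {l : Filter Z}

/-- Linearization of a minimum distance estimator `est`, a local minimizer of the distance from `s`
to `m` for the weights `K`.  The weights may depend on the parameter; `Om` is their limit. -/
theorem isLittleO_minimumDistance {m : Z → E → F} {K : Z → E → F →L[ℝ] F} {s : Z → F}
    {est : Z → E} {θs : E} {B : E →L[ℝ] F} {Om : F →L[ℝ] F} {G : F →L[ℝ] E} {G' : E →L[ℝ] E}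
    (hmin : ∀ᶠ z in l, IsLocalMin (fun t => ⟪s z - m z t, K z t (s z - m z t)⟫_ℝ) (est z))
    (hm : ∀ᶠ z in l, DifferentiableAt ℝ (m z) (est z))
    (hK : ∀ᶠ z in l, DifferentiableAt ℝ (K z) (est z))
    (hsym : ∀ᶠ z in l, ∀ x y, ⟪K z (est z) x, y⟫_ℝ = ⟪x, K z (est z) y⟫_ℝ)
    (hDm : Tendsto (fun z => fderiv ℝ (m z) (est z)) l (𝓝 B))
    (hKlim : Tendsto (fun z => K z (est z)) l (𝓝 Om))
    (hDK : Tendsto (fun z => ‖fderiv ℝ (K z) (est z)‖ * ‖s z - m z (est z)‖) l (𝓝 0))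
    (hexp : (fun z => m z (est z) - m z θs - B (est z - θs)) =o[l] fun z => est z - θs)
    (hG : ∀ x, G x = G' (adjoint B (Om x))) (hGB : ∀ x, G (B x) = x) :
    (fun z => est z - θs - G (s z - m z θs)) =o[l] fun z => s z - m z θs := by
  set w : Z → F := fun z => s z - m z (est z) with hw
  refine isLittleO_sub_of_residual (w := w) hGB ?_ ?_
  · refine hexp.neg_left.congr_left fun z => ?_
    simp only [hw]
    abel
  · have h1 : (fun z => adjoint (fderiv ℝ (m z) (est z)) (K z (est z) (w z))) =o[l] w := by
      rw [isLittleO_iff]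
      intro c hc
      filter_upwards [hmin, hm, hK, hsym, hDK.eventually (ge_mem_nhds hc)] with z h1 h2 h3 h4 h5
      refine (norm_adjoint_fderiv_le_of_isLocalMin h2 h3 h4 h1).trans ?_
      rw [pow_two, ← mul_assoc]
      gcongr
    have h2 : Tendsto (fun z => adjoint B ∘L Om -
        adjoint (fderiv ℝ (m z) (est z)) ∘L K z (est z)) l (𝓝 0) := by
      have h3 : Tendsto (fun z => adjoint (fderiv ℝ (m z) (est z))) l (𝓝 (adjoint B)) :=
        (adjoint.continuous.tendsto B).comp hDm
      have h4 := (tendsto_const_nhds (x := adjoint B ∘L Om)).sub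
        ((isBoundedBilinearMap_comp.continuous.tendsto (adjoint B, Om)).comp
          (h3.prodMk_nhds hKlim))
      simpa using h4
    have h3 : (fun z => (adjoint B ∘L Om -
        adjoint (fderiv ℝ (m z) (est z)) ∘L K z (est z)) (w z)) =o[l] w := by
      rw [isLittleO_iff]
      intro c hc
      filter_upwards [h2.eventually (Metric.closedBall_mem_nhds 0 hc)] with z hz
      rw [dist_zero_right] at hz
      exact le_of_opNorm_le _ hz _
    have h4 : (fun z => adjoint B (Om (w z))) =o[l] w :=
      (h3.add h1).congr_left fun z => by simp
    exact ((G'.isBigO_comp _ l).trans_isLittleO h4).congr_left fun z => (hG _).symm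

end MinimumDistance

/-! ### Convergence in distribution -/

section Distribution

variable {Ω : ℕ → Type*} [∀ n, MeasurableSpace (Ω n)] {μ : ∀ n, Measure (Ω n)}
  [∀ n, IsProbabilityMeasure (μ n)] {Ω'' : Type*} [MeasurableSpace Ω''] {μ'' : Measure Ω''}
  [IsProbabilityMeasure μ'']

/-- Slutsky's lemma for variables that live on spaces that change with `n`, deduced from the case
of a fixed space by passing to the infinite product. -/
theorem tendstoInDistribution_of_tendsto_sub {E : Type*} [NormedAddCommGroup E]
    [SecondCountableTopology E] [MeasurableSpace E] [BorelSpace E] {X Y : ∀ n, Ω n → E}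
    {Z : Ω'' → E} (h : TendstoInDistribution X atTop Z μ μ'') (hY : ∀ n, AEMeasurable (Y n) (μ n))
    (hXY : Tendsto (fun z : Σ n, Ω n => Y z.1 z.2 - X z.1 z.2) (probFilter μ) (𝓝 0)) :
    TendstoInDistribution Y atTop Z μ μ'' := by
  have hev : ∀ n, MeasurePreserving (Function.eval n) (Measure.infinitePi μ) (μ n) :=
    measurePreserving_eval_infinitePi μ
  have hmap : ∀ {W : ∀ n, Ω n → E}, (∀ n, AEMeasurable (W n) (μ n)) → ∀ n,
      (Measure.infinitePi μ).map (fun ω => W n (ω n)) = (μ n).map (W n) := by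
    intro W hW n
    rw [← (hev n).map_eq, AEMeasurable.map_map_of_aemeasurable
      (by rw [(hev n).map_eq]; exact hW n) (hev n).measurable.aemeasurable]
    rfl
  have hX := h.forall_aemeasurable
  have hX' : ∀ n, AEMeasurable (fun ω : ∀ n, Ω n => X n (ω n)) (Measure.infinitePi μ) :=
    fun n => (hX n).comp_quasiMeasurePreserving (hev n).quasiMeasurePreserving
  have hY' : ∀ n, AEMeasurable (fun ω : ∀ n, Ω n => Y n (ω n)) (Measure.infinitePi μ) :=
    fun n => (hY n).comp_quasiMeasurePreserving (hev n).quasiMeasurePreserving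
  have h1 : TendstoInDistribution (fun n (ω : ∀ n, Ω n) => X n (ω n)) atTop Z
      (fun _ => Measure.infinitePi μ) μ'' := by
    refine ⟨hX', h.aemeasurable_limit, ?_⟩
    refine h.tendsto.congr fun n => Subtype.ext ?_
    exact (hmap hX n).symm
  have h2 : TendstoInMeasure (Measure.infinitePi μ) ((fun n (ω : ∀ n, Ω n) => Y n (ω n)) -
      fun n (ω : ∀ n, Ω n) => X n (ω n)) atTop 0 := by
    rw [tendstoInMeasure_iff_norm]
    intro ε hε
    have h3 : Tendsto (fun n => μ n {ω | ε ≤ ‖Y n ω - X n ω - 0‖}) atTop (𝓝 0) :=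
      (tendstoInProb_iff (X := fun n ω => Y n ω - X n ω)).2 hXY ε hε
    refine tendsto_of_tendsto_of_tendsto_of_le_of_le tendsto_const_nhds h3 (fun _ => zero_le)
      fun n => ?_
    exact le_trans (measure_mono fun ω hω => hω)
      ((hev n).measure_preimage_le {ω | ε ≤ ‖Y n ω - X n ω - 0‖})
  have h4 := tendstoInDistribution_of_tendstoInMeasure_sub _ Z h1 h2 hY'
  refine ⟨hY, h.aemeasurable_limit, ?_⟩
  refine h4.tendsto.congr fun n => Subtype.ext ?_
  exact hmap hY n

/-- Variables that converge in distribution are stochastically bounded. -/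
theorem boundedInProb_of_tendstoInDistribution {E : Type*} [NormedAddCommGroup E]
    [InnerProductSpace ℝ E] [FiniteDimensional ℝ E] [MeasurableSpace E] [BorelSpace E]
    {X : ∀ n, Ω n → E} {Z : Ω'' → E} (h : TendstoInDistribution X atTop Z μ μ'') :
    BoundedInProb μ X := by
  have : ∀ n, IsProbabilityMeasure ((μ n).map (X n)) :=
    fun n => Measure.isProbabilityMeasure_map (h.forall_aemeasurable n)
  have : IsProbabilityMeasure (μ''.map Z) :=
    Measure.isProbabilityMeasure_map h.aemeasurable_limit
  have h1 : IsTightMeasureSet (Set.range fun n => (μ n).map (X n)) :=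
    isTightMeasureSet_of_tendsto_charFun
      (continuous_charFun (μ := μ''.map Z)).continuousAt
      (ProbabilityMeasure.tendsto_iff_tendsto_charFun.1 h.tendsto)
  have h2 := tendsto_measure_norm_gt_of_isTightMeasureSet h1
  intro ε hε
  obtain ⟨C, hC⟩ := (h2.eventually_lt_const (ENNReal.ofReal_pos.2 hε)).exists
  refine ⟨C, Eventually.of_forall fun n => ?_⟩
  have h3 : (μ n).map (X n) {x | C < ‖x‖} ≤ ENNReal.ofReal ε :=
    (le_iSup₂ (f := fun (ν : Measure E) (_ : ν ∈ Set.range fun n => (μ n).map (X n)) =>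
      ν {x | C < ‖x‖}) _ (Set.mem_range_self n)).trans hC.le
  rwa [Measure.map_apply_of_aemeasurable (h.forall_aemeasurable n)
    (measurableSet_lt measurable_const measurable_norm)] at h3

/-- A convergence in distribution for `n → ∞` transfers to independent copies. -/
theorem TendstoInDistribution.cons_pi {E : Type*} [NormedAddCommGroup E]
    [SecondCountableTopology E] [MeasurableSpace E] [BorelSpace E] {V : ∀ n, Ω n → E}
    {F : Measure E} [IsProbabilityMeasure F] (h : TendstoInDistribution V atTop id μ F) (R : ℕ) :
    TendstoInDistribution (fun n (ω : Ω n × (Fin R → Ω n)) =>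
        (Fin.cons (V n ω.1) fun k => V n (ω.2 k) : Fin (R + 1) → E)) atTop id
      (fun n => (μ n).prod (Measure.pi fun _ => μ n)) (Measure.pi fun _ : Fin (R + 1) => F) := by
  have hV := h.forall_aemeasurable
  have hmp : ∀ n, MeasurePreserving
      (MeasurableEquiv.piFinSuccAbove (fun _ : Fin (R + 1) => Ω n) 0).symm
      ((μ n).prod (Measure.pi fun _ => μ n)) (Measure.pi fun _ : Fin (R + 1) => μ n) :=
    fun n => (measurePreserving_piFinSuccAbove (fun _ : Fin (R + 1) => μ n) 0).symm
  have hV' : ∀ n, AEMeasurable (fun (ω : Fin (R + 1) → Ω n) i => V n (ω i))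
      (Measure.pi fun _ : Fin (R + 1) => μ n) := fun n => aemeasurable_pi_lambda _ fun i =>
    (hV n).comp_quasiMeasurePreserving (Measure.quasiMeasurePreserving_eval _ i)
  have hcons : ∀ n, (fun ω : Ω n × (Fin R → Ω n) =>
      (Fin.cons (V n ω.1) fun k => V n (ω.2 k) : Fin (R + 1) → E)) =
      (fun (ω : Fin (R + 1) → Ω n) i => V n (ω i)) ∘
        (MeasurableEquiv.piFinSuccAbove (fun _ : Fin (R + 1) => Ω n) 0).symm := by
    intro n
    ext ω i
    refine Fin.cases ?_ (fun k => ?_) i <;>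
      simp [MeasurableEquiv.piFinSuccAbove]
  have hmeas : ∀ n, AEMeasurable (fun ω : Ω n × (Fin R → Ω n) =>
      (Fin.cons (V n ω.1) fun k => V n (ω.2 k) : Fin (R + 1) → E))
      ((μ n).prod (Measure.pi fun _ => μ n)) := fun n => by
    rw [hcons]
    exact (hV' n).comp_quasiMeasurePreserving (hmp n).quasiMeasurePreserving
  have : ∀ n, IsProbabilityMeasure ((μ n).map (V n)) :=
    fun n => Measure.isProbabilityMeasure_map (hV n)
  refine ⟨hmeas, aemeasurable_id, ?_⟩
  have h1 := (ProbabilityMeasure.continuous_pi (α := fun _ : Fin (R + 1) => E)).tendsto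
    (fun _ => ⟨F.map id, Measure.isProbabilityMeasure_map aemeasurable_id⟩)
  have h2 := h1.comp (tendsto_pi_nhds.2 fun _ : Fin (R + 1) => h.tendsto)
  have h3 : ProbabilityMeasure.pi (fun _ : Fin (R + 1) =>
      (⟨F.map id, Measure.isProbabilityMeasure_map aemeasurable_id⟩ : ProbabilityMeasure E)) =
      ⟨(Measure.pi fun _ : Fin (R + 1) => F).map id,
        Measure.isProbabilityMeasure_map aemeasurable_id⟩ := by
    refine Subtype.ext ?_
    simp [ProbabilityMeasure.pi]
  rw [h3] at h2
  refine h2.congr fun n => Subtype.ext ?_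
  change Measure.pi (fun _ : Fin (R + 1) => (μ n).map (V n)) = _
  rw [← Measure.pi_map_pi fun _ => hV n, ← (hmp n).map_eq,
    AEMeasurable.map_map_of_aemeasurable (by rw [(hmp n).map_eq]; exact hV' n)
      (hmp n).measurable.aemeasurable, ← hcons]

/-- Pólya's theorem: convergence in distribution to a continuous distribution function is uniform
convergence of the distribution functions. -/
theorem eventually_forall_abs_cdf_sub_lt {X : ∀ n, Ω n → ℝ} {Z : Ω'' → ℝ}
    (h : TendstoInDistribution X atTop Z μ μ'') (hZ : HasContinuousCdf (μ''.map Z)) {ε : ℝ}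
    (hε : 0 < ε) :
    ∀ᶠ n in atTop, ∀ t, |(μ n).real {ω | X n ω ≤ t} - (μ''.map Z).real (Set.Iic t)| < ε := by
  have : IsProbabilityMeasure (μ''.map Z) :=
    Measure.isProbabilityMeasure_map h.aemeasurable_limit
  set P := μ''.map Z with hP
  have hcdf : ⇑(cdf P) = fun t => P.real (Set.Iic t) := funext fun t => cdf_eq_real P t
  have hcont : Continuous (cdf P) := by rw [hcdf]; exact hZ
  have hsing : ∀ t, P {t} = 0 := by
    intro t
    rw [← measure_cdf P, StieltjesFunction.measure_singleton,
      (monotone_cdf P).continuousWithinAt_Iio_iff_leftLim_eq.1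
        hcont.continuousAt.continuousWithinAt, sub_self, ENNReal.ofReal_zero]
  have hpt : ∀ t, Tendsto (fun n => (μ n).real {ω | X n ω ≤ t}) atTop (𝓝 (cdf P t)) := by
    intro t
    have h1 := ProbabilityMeasure.tendsto_measure_of_null_frontier_of_tendsto' h.tendsto
      (E := Set.Iic t) (by rw [frontier_Iic]; exact hsing t)
    have h2 := (ENNReal.tendsto_toReal (measure_ne_top P (Set.Iic t))).comp h1
    rw [cdf_eq_real]
    refine h2.congr fun n => ?_
    simp only [Function.comp_apply, ProbabilityMeasure.coe_mk]
    rw [Measure.map_apply_of_aemeasurable (h.forall_aemeasurable n) measurableSet_Iic]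
    rfl
  obtain ⟨k, hk⟩ := exists_nat_gt (3 / ε)
  have hk0 : (0 : ℝ) < k := (by positivity : 0 < 3 / ε).trans hk
  have hk3 : 3 / (k : ℝ) < ε := by
    rw [div_lt_iff₀ hk0]
    rw [div_lt_iff₀ hε] at hk
    linarith
  -- quantiles of the limit at the levels `j / k`
  have hq : ∀ j : ℕ, 0 < j → j < k → ∃ t, cdf P t = (j : ℝ) / k := by
    intro j hj hjk
    have h0 : (0 : ℝ) < (j : ℝ) / k := div_pos (by exact_mod_cast hj) hk0
    have h1 : (j : ℝ) / k < 1 := (div_lt_one hk0).2 (by exact_mod_cast hjk)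
    obtain ⟨a, ha⟩ := ((tendsto_cdf_atBot P).eventually_lt_const h0).exists
    obtain ⟨b, hb⟩ := ((tendsto_cdf_atTop P).eventually_const_lt h1).exists
    exact mem_range_of_exists_le_of_exists_ge hcont ⟨a, ha.le⟩ ⟨b, hb.le⟩
  choose! τ hτ using hq
  have hev : ∀ᶠ n in atTop, ∀ j ∈ Finset.range k,
      |(μ n).real {ω | X n ω ≤ τ j} - cdf P (τ j)| < 1 / k := by
    rw [eventually_all_finset]
    intro j _
    have h1 := (hpt (τ j)).eventually (Metric.ball_mem_nhds _ (one_div_pos.2 hk0))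
    simpa only [Metric.mem_ball, Real.dist_eq] using h1
  filter_upwards [hev] with n hn t
  rw [← cdf_eq_real]
  have hmono : ∀ {a b : ℝ}, a ≤ b → (μ n).real {ω | X n ω ≤ a} ≤ (μ n).real {ω | X n ω ≤ b} :=
    fun hab => measureReal_mono fun ω hω => le_trans hω hab
  set x := cdf P t with hx
  have hx0 : 0 ≤ x := cdf_nonneg P t
  -- `j / k ≤ x` may be an equality, and then the quantile at the level `j / k` may lie to the right
  -- of `t`; the lower bound therefore uses the level `(j - 1) / k`
  set j := ⌊(k : ℝ) * x⌋₊ with hj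
  have hj1 : (j : ℝ) ≤ k * x := Nat.floor_le (by positivity)
  have hj2 : (k : ℝ) * x < j + 1 := Nat.lt_floor_add_one _
  have e1 : (1 : ℝ) / k * k = 1 := by field_simp
  have e3 : (3 : ℝ) / k = 3 * (1 / k) := by ring
  have hup : (μ n).real {ω | X n ω ≤ t} - x < ε := by
    by_cases hjk : j + 1 < k
    · have h1 := hτ (j + 1) j.succ_pos hjk
      have h2 : t ≤ τ (j + 1) := by
        by_contra hcon
        have h3 := monotone_cdf P (not_le.1 hcon).le
        rw [h1, div_le_iff₀ hk0] at h3
        push_cast at h3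
        linarith
      have h3 := (abs_lt.1 (hn (j + 1) (Finset.mem_range.2 hjk))).2
      have h4 : ((j + 1 : ℕ) : ℝ) / k ≤ x + 1 / k := by
        rw [div_le_iff₀ hk0, add_mul, e1]
        push_cast
        linarith
      rw [h1] at h3
      have : 0 < 1 / (k : ℝ) := one_div_pos.2 hk0
      linarith [hmono h2]
    · have h1 : (k : ℝ) ≤ j + 1 := by exact_mod_cast not_lt.1 hjk
      have h2 : 1 ≤ x + 1 / k := by
        have : 1 * (k : ℝ) ≤ (x + 1 / k) * k := by
          rw [add_mul, e1]
          linarith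
        exact le_of_mul_le_mul_right this hk0
      have h3 : (μ n).real {ω | X n ω ≤ t} ≤ 1 := measureReal_le_one
      have : 0 < 1 / (k : ℝ) := one_div_pos.2 hk0
      linarith
  have hlo : -ε < (μ n).real {ω | X n ω ≤ t} - x := by
    by_cases hj3 : 2 ≤ j
    · have hxk : x ≤ 1 := cdf_le_one P t
      have hjk : j - 1 < k := by
        have : (j : ℝ) ≤ k := hj1.trans (by nlinarith)
        have : j ≤ k := by exact_mod_cast this
        omega
      have h1 := hτ (j - 1) (by omega) hjk
      have hcast : ((j - 1 : ℕ) : ℝ) = j - 1 := by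
        rw [Nat.cast_sub (by omega), Nat.cast_one]
      have h2 : τ (j - 1) ≤ t := by
        by_contra hcon
        have h3 := monotone_cdf P (not_le.1 hcon).le
        rw [h1, le_div_iff₀ hk0, hcast] at h3
        linarith
      have h3 := (abs_lt.1 (hn (j - 1) (Finset.mem_range.2 hjk))).1
      have h4 : x - 2 * (1 / k) ≤ ((j - 1 : ℕ) : ℝ) / k := by
        rw [le_div_iff₀ hk0, hcast, sub_mul, mul_assoc, e1]
        linarith
      rw [h1] at h3
      linarith [hmono h2]
    · have h1 : (j : ℝ) ≤ 1 := by
        have : j ≤ 1 := by omega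
        exact_mod_cast this
      have h2 : x < 3 * (1 / k) := by
        have : x * k < 3 * (1 / k) * k := by
          rw [mul_assoc, e1]
          linarith
        exact lt_of_mul_lt_mul_right this hk0.le
      have h3 : 0 ≤ (μ n).real {ω | X n ω ≤ t} := measureReal_nonneg
      linarith
  exact abs_lt.2 ⟨hlo, hup⟩

end Distribution

/-! ### A criterion for the consistency of the parametric bootstrap -/

section Criterion

variable {p q : ℕ} {U W 𝒟 : ℕ → Type*} [∀ n, MeasurableSpace (U n)]
  [∀ n, MeasurableSpace (W n)] [∀ n, MeasurableSpace (𝒟 n)] (M : Model p q U W 𝒟)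

/-- The parametric bootstrap is consistent if the estimator is `√n`-consistent and the root has the
same limit law, with a continuous distribution function, along all parameter sequences at distance
`O(1 / √n)` from `θs`: by contradiction, the convergence of the distribution functions is uniform
over balls of radius `C / √n`. -/
theorem pbConsistent_of_tendstoInDistribution {Ω'' : Type*} [MeasurableSpace Ω'']
    {μ'' : Measure Ω''} [IsProbabilityMeasure μ''] {R : ℕ → ℕ} {θs : Vec q} (hθs : θs ∈ M.Θ)
    {est : ∀ n, Vec p × (Fin (R n) → U n × W n) → Vec q}
    {tauHat sigHat : ∀ n, Vec p × (Fin (R n) → U n × W n) → ℝ} {tau : Vec q → ℝ} {Z : Ω'' → ℝ}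
    (hZ : HasContinuousCdf (μ''.map Z))
    (hmem : ∀ n ω, est n (M.draw n (R n) θs ω) ∈ M.Θ)
    (hest : BoundedInProb (fun n => M.law n (R n))
      fun n ω => √(n : ℝ) • (est n (M.draw n (R n) θs ω) - θs))
    (hroot : ∀ θn : ℕ → Vec q, (∀ n, θn n ∈ M.Θ) →
      (∃ C, ∀ n : ℕ, ‖√(n : ℝ) • (θn n - θs)‖ ≤ C) →
      TendstoInDistribution (fun n ω => M.root R tauHat sigHat tau n (θn n) ω) atTop Z
        (fun n => M.law n (R n)) μ'') :
    M.PBConsistent R θs est tauHat sigHat tau := by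
  classical
  have key : ∀ C ε : ℝ, 0 < ε → ∀ᶠ n : ℕ in atTop, ∀ θ ∈ M.Θ, ‖√(n : ℝ) • (θ - θs)‖ ≤ C →
      ∀ t, |M.rootCdf R tauHat sigHat tau n θ t - (μ''.map Z).real (Set.Iic t)| < ε := by
    intro C ε hε
    let bad : ℕ → Vec q → Prop := fun n θ => θ ∈ M.Θ ∧ ‖√(n : ℝ) • (θ - θs)‖ ≤ C ∧
      ∃ t, ε ≤ |M.rootCdf R tauHat sigHat tau n θ t - (μ''.map Z).real (Set.Iic t)|
    -- a sequence that violates the bound whenever some parameter in the ball does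
    let θn : ℕ → Vec q := fun n => if h : ∃ θ, bad n θ then h.choose else θs
    have hθn : ∀ n, θn n ∈ M.Θ ∧ ‖√(n : ℝ) • (θn n - θs)‖ ≤ max C 0 := by
      intro n
      by_cases h : ∃ θ, bad n θ
      · have h1 : θn n = h.choose := dif_pos h
        rw [h1]
        exact ⟨h.choose_spec.1, h.choose_spec.2.1.trans (le_max_left _ _)⟩
      · have h1 : θn n = θs := dif_neg h
        rw [h1]
        exact ⟨hθs, by simp⟩
    filter_upwards [eventually_forall_abs_cdf_sub_lt
      (hroot θn (fun n => (hθn n).1) ⟨_, fun n => (hθn n).2⟩) hZ hε] with n hn θ hθ hC t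
    by_contra hcon
    have h : ∃ θ, bad n θ := ⟨θ, hθ, hC, t, not_lt.1 hcon⟩
    have h1 : θn n = h.choose := dif_pos h
    obtain ⟨-, -, t', ht'⟩ := h.choose_spec
    rw [← h1] at ht'
    exact absurd (hn t') (not_lt.2 ht')
  intro ε hε
  rw [ENNReal.tendsto_nhds_zero]
  intro η hη
  obtain ⟨η', hη', hle⟩ : ∃ η' : ℝ, 0 < η' ∧ ENNReal.ofReal η' ≤ η := by
    rcases eq_or_ne η ⊤ with rfl | h
    · exact ⟨1, one_pos, le_top⟩
    · exact ⟨η.toReal, ENNReal.toReal_pos hη.ne' h, (ENNReal.ofReal_toReal h).le⟩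
  obtain ⟨C, hC⟩ := hest η' hη'
  filter_upwards [hC, key C (ε / 2) (half_pos hε), key 0 (ε / 2) (half_pos hε)]
    with n hn1 hn2 hn3
  refine (measure_mono fun ω hω => ?_).trans (hn1.trans hle)
  obtain ⟨t, -, ht⟩ := hω
  rw [Set.mem_ofPred_eq]
  by_contra hcon
  have h1 := hn2 _ (hmem n ω) (not_lt.1 hcon) t
  have h2 := hn3 θs hθs (by simp) t
  rw [sub_zero, Real.norm_eq_abs] at ht
  rw [abs_lt] at h1 h2
  rcases le_abs'.1 ht with h3 | h3 <;> linarith [h1.1, h1.2, h2.1, h2.2]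

end Criterion

/-! ### Matrices as continuous linear maps -/

section Matrices

open scoped InnerProductSpace

variable {k m p q : ℕ}

/-- The continuous linear map `x ↦ A x` between Euclidean spaces, as a linear function of the
matrix `A`. -/
def matCLM : Matrix (Fin m) (Fin k) ℝ →ₗ[ℝ] (Vec k →L[ℝ] Vec m) :=
  (LinearMap.toContinuousLinearMap.toLinearMap) ∘ₗ (Matrix.toLpLin 2 2).toLinearMap

theorem ofLp_matCLM (A : Matrix (Fin m) (Fin k) ℝ) (x : Vec k) :
    (matCLM A x).ofLp = A *ᵥ x.ofLp := rfl

theorem continuous_matCLM :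
    Continuous (matCLM : Matrix (Fin m) (Fin k) ℝ → (Vec k →L[ℝ] Vec m)) :=
  LinearMap.continuous_of_finiteDimensional _

theorem matCLM_mul_apply (A : Matrix (Fin m) (Fin k) ℝ) (B : Matrix (Fin k) (Fin p) ℝ)
    (x : Vec p) : matCLM (A * B) x = matCLM A (matCLM B x) :=
  WithLp.ofLp_injective 2 (by simp [ofLp_matCLM])

theorem matCLM_one_apply (x : Vec k) : matCLM (1 : Matrix (Fin k) (Fin k) ℝ) x = x :=
  WithLp.ofLp_injective 2 (by simp [ofLp_matCLM])

theorem inner_eq_dotProduct (x y : Vec k) : ⟪x, y⟫_ℝ = x.ofLp ⬝ᵥ y.ofLp := by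
  simp [PiLp.inner_apply, dotProduct, mul_comm]

theorem inner_matCLM (A : Matrix (Fin m) (Fin k) ℝ) (x : Vec m) (y : Vec k) :
    ⟪x, matCLM A y⟫_ℝ = ⟪matCLM Aᵀ x, y⟫_ℝ := by
  simp only [inner_eq_dotProduct, ofLp_matCLM, mulVec_transpose, dotProduct_mulVec]

theorem adjoint_matCLM (A : Matrix (Fin m) (Fin k) ℝ) :
    ContinuousLinearMap.adjoint (matCLM A) = matCLM Aᵀ := by
  symm
  rw [ContinuousLinearMap.eq_adjoint_iff]
  intro x y
  exact (inner_matCLM A x y).symm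

theorem quadForm_eq_inner (A : Matrix (Fin p) (Fin p) ℝ) (x : Vec p) :
    quadForm A x = ⟪x, matCLM A x⟫_ℝ := by
  rw [inner_eq_dotProduct, ofLp_matCLM, quadForm]

theorem quadForm_le (A : Matrix (Fin p) (Fin p) ℝ) (x : Vec p) :
    quadForm A x ≤ ‖matCLM A‖ * ‖x‖ ^ 2 := by
  rw [quadForm_eq_inner]
  calc _ ≤ ‖x‖ * (‖matCLM A‖ * ‖x‖) :=
        (real_inner_le_norm _ _).trans (by gcongr; exact ContinuousLinearMap.le_opNorm _ _)
    _ = ‖matCLM A‖ * ‖x‖ ^ 2 := by ring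

theorem matCLM_jacobian (f : Vec q → Vec p) (θ : Vec q) :
    matCLM (jacobian f θ) = fderiv ℝ f θ := by
  ext x i
  have hx : x = ∑ j, x j • EuclideanSpace.single j (1 : ℝ) := by
    simpa using ((EuclideanSpace.basisFun (Fin q) ℝ).sum_repr x).symm
  rw [ofLp_matCLM]
  conv_rhs => rw [hx, map_sum]
  simp [jacobian, mulVec, dotProduct, mul_comm]

theorem matCLM_inv_apply {A : Matrix (Fin p) (Fin p) ℝ} (hA : IsUnit A.det) (x : Vec p) :
    matCLM A⁻¹ (matCLM A x) = x := by
  rw [← matCLM_mul_apply, nonsing_inv_mul A hA, matCLM_one_apply]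

theorem matCLM_apply_inv {A : Matrix (Fin p) (Fin p) ℝ} (hA : IsUnit A.det) (x : Vec p) :
    matCLM A (matCLM A⁻¹ x) = x := by
  rw [← matCLM_mul_apply, mul_nonsing_inv A hA, matCLM_one_apply]

theorem limitVar_eq_inner (η : Vec k → ℝ) (x : Vec k) (A : Matrix (Fin k) (Fin p) ℝ)
    (J : Matrix (Fin p) (Fin p) ℝ) (v : Vec p) :
    limitVar η x A J v = ⟪gradient η x, matCLM A (matCLM J⁻¹ v)⟫_ℝ := by
  rw [inner_eq_dotProduct, ofLp_matCLM, ofLp_matCLM, limitVar]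

theorem posDef_iff_quadForm {A : Matrix (Fin p) (Fin p) ℝ} :
    A.PosDef ↔ Aᵀ = A ∧ ∀ x, x ≠ 0 → 0 < quadForm A x := by
  rw [posDef_iff_dotProduct_mulVec, IsHermitian, conjTranspose_eq_transpose_of_trivial]
  refine and_congr_right fun _ => ⟨fun h x hx => ?_, fun h x hx => ?_⟩
  · have h1 : x.ofLp ≠ 0 := fun h0 => hx (WithLp.ofLp_injective 2 h0)
    simpa [quadForm] using h h1
  · have h1 : WithLp.toLp 2 x ≠ 0 := fun h0 => hx (congrArg WithLp.ofLp h0)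
    simpa [quadForm] using h _ h1

theorem _root_.Matrix.PosDef.isUnit_det {A : Matrix (Fin p) (Fin p) ℝ} (hA : A.PosDef) :
    IsUnit A.det :=
  (isUnit_iff_isUnit_det A).1 hA.isUnit

theorem tendsto_matrix_inv {Z : Type*} {l : Filter Z} {A : Z → Matrix (Fin p) (Fin p) ℝ}
    {A₀ : Matrix (Fin p) (Fin p) ℝ} (hA : Tendsto A l (𝓝 A₀)) (h : IsUnit A₀.det) :
    Tendsto (fun z => (A z)⁻¹) l (𝓝 A₀⁻¹) := by
  have h1 : ContinuousAt Ring.inverse A₀.det := by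
    rw [Ring.inverse_eq_inv']
    exact continuousAt_inv₀ h.ne_zero
  exact (continuousAt_matrix_inv A₀ h1).tendsto.comp hA

/-- The Gram matrix `Bᵀ Ω B` of an injective matrix is positive definite. -/
theorem posDef_gram {Om : Matrix (Fin p) (Fin p) ℝ} (hOm : Om.PosDef)
    {B : Matrix (Fin p) (Fin q) ℝ} (hB : Function.Injective (matCLM B)) :
    (Bᵀ * Om * B).PosDef := by
  have h1 : Function.Injective B.mulVec := by
    intro x y hxy
    have h2 : matCLM B (WithLp.toLp 2 x) = matCLM B (WithLp.toLp 2 y) :=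
      WithLp.ofLp_injective 2 (by simpa [ofLp_matCLM] using hxy)
    exact congrArg WithLp.ofLp (hB h2)
  rw [← conjTranspose_eq_transpose_of_trivial]
  exact hOm.conjTranspose_mul_mul_same h1

theorem isUnit_det_gram {Om : Matrix (Fin p) (Fin p) ℝ} (hOm : Om.PosDef)
    {B : Matrix (Fin p) (Fin q) ℝ} (hB : Function.Injective (matCLM B)) :
    IsUnit (Bᵀ * Om * B).det :=
  (posDef_gram hOm hB).isUnit_det

theorem matCLM_gain_apply (Om : Matrix (Fin p) (Fin p) ℝ) (B : Matrix (Fin p) (Fin q) ℝ)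
    (x : Vec p) : matCLM (gain Om B) x = matCLM (Bᵀ * Om * B)⁻¹
      (ContinuousLinearMap.adjoint (matCLM B) (matCLM Om x)) := by
  rw [adjoint_matCLM, gain, matCLM_mul_apply, matCLM_mul_apply]

theorem matCLM_gain_apply_self {Om : Matrix (Fin p) (Fin p) ℝ} {B : Matrix (Fin p) (Fin q) ℝ}
    (h : IsUnit (Bᵀ * Om * B).det) (x : Vec q) : matCLM (gain Om B) (matCLM B x) = x := by
  rw [← matCLM_mul_apply, gain, Matrix.mul_assoc _ Bᵀ Om, Matrix.mul_assoc,
    nonsing_inv_mul _ h, matCLM_one_apply]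

/-- An upper bound for a quadratic form is a lower bound for the form of the inverse matrix. -/
theorem le_quadForm_inv {N : Matrix (Fin p) (Fin p) ℝ} (hN : N.PosDef) {C : ℝ} (hC : 0 < C)
    (h : ∀ x, quadForm N x ≤ C * ‖x‖ ^ 2) (w : Vec p) : C⁻¹ * ‖w‖ ^ 2 ≤ quadForm N⁻¹ w := by
  have hT : Nᵀ = N := (posDef_iff_quadForm.1 hN).1
  set y := matCLM N⁻¹ w with hy
  have hNy : matCLM N y = w := matCLM_apply_inv hN.isUnit_det w
  -- expanding this square gives the claim
  have h0 : 0 ≤ quadForm N (y - C⁻¹ • w) := by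
    rcases eq_or_ne (y - C⁻¹ • w) 0 with h1 | h1
    · rw [h1]
      simp [quadForm]
    · exact ((posDef_iff_quadForm.1 hN).2 _ h1).le
  have h2 : ⟪y, matCLM N w⟫_ℝ = ‖w‖ ^ 2 := by
    rw [inner_matCLM, hT, hNy, real_inner_self_eq_norm_sq]
  have h3 := h w
  rw [quadForm_eq_inner] at h0 h3
  rw [map_sub, map_smul, hNy, inner_sub_left, inner_sub_right, inner_sub_right,
    real_inner_smul_left, real_inner_smul_right, real_inner_smul_left, real_inner_smul_right, h2,
    real_inner_self_eq_norm_sq] at h0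
  rw [quadForm_eq_inner, ← hy, real_inner_comm]
  have h4 : C⁻¹ * (C⁻¹ * ⟪w, matCLM N w⟫_ℝ) ≤ C⁻¹ * (C⁻¹ * (C * ‖w‖ ^ 2)) := by gcongr
  have h5 : C⁻¹ * (C * ‖w‖ ^ 2) = ‖w‖ ^ 2 := by field_simp
  rw [h5] at h4
  linarith

theorem quadForm_inv_smul {c : ℝ} (hc : c ≠ 0)
    {A : Matrix (Fin p) (Fin p) ℝ} (hA : IsUnit A.det) (x : Vec p) :
    quadForm (c • A)⁻¹ x = c⁻¹ * quadForm A⁻¹ x := by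
  have h1 : (c • A)⁻¹ = c⁻¹ • A⁻¹ := by
    refine Matrix.inv_eq_left_inv ?_
    rw [Matrix.smul_mul, Matrix.mul_smul, smul_smul, inv_mul_cancel₀ hc, one_smul,
      nonsing_inv_mul A hA]
  rw [h1, quadForm, quadForm, smul_mulVec, dotProduct_smul, smul_eq_mul]

theorem matCLM_inv_eq_ringInverse {N : Matrix (Fin p) (Fin p) ℝ} (hN : IsUnit N.det) :
    matCLM N⁻¹ = Ring.inverse (matCLM N) := by
  let u : (Vec p →L[ℝ] Vec p)ˣ :=
    ⟨matCLM N, matCLM N⁻¹, ContinuousLinearMap.ext (matCLM_apply_inv hN),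
      ContinuousLinearMap.ext (matCLM_inv_apply hN)⟩
  exact (Ring.inverse_unit u).symm

theorem hasFDerivAt_sum_sum_smul {E V : Type*} [NormedAddCommGroup E] [NormedSpace ℝ E]
    [NormedAddCommGroup V] [NormedSpace ℝ V] {a : Fin k → Fin m → E → ℝ} (v : Fin k → Fin m → V)
    {θ : E} (ha : ∀ i j, DifferentiableAt ℝ (a i j) θ) :
    HasFDerivAt (fun t => ∑ i, ∑ j, a i j t • v i j)
      (∑ i, ∑ j, (fderiv ℝ (a i j) θ).smulRight (v i j)) θ :=
  HasFDerivAt.fun_sum fun i _ => HasFDerivAt.fun_sum fun j _ =>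
    (ha i j).hasFDerivAt.smul_const (v i j)

theorem exists_hasFDerivAt_ringInverse {E A : Type*} [NormedAddCommGroup E] [NormedSpace ℝ E]
    [NormedRing A] [NormedAlgebra ℝ A] [HasSummableGeomSeries A] {f : E → A} {f' : E →L[ℝ] A}
    {θ : E} (hf : HasFDerivAt f f' θ) (u : Aˣ) (hu : f θ = u) :
    ∃ g : E →L[ℝ] A, HasFDerivAt (fun t => Ring.inverse (f t)) g θ ∧
      ‖g‖ ≤ ‖(↑u⁻¹ : A)‖ ^ 2 * ‖f'‖ := by
  have h1 := hasFDerivAt_ringInverse (𝕜 := ℝ) u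
  rw [← hu] at h1
  refine ⟨_, h1.comp θ hf, ?_⟩
  refine (ContinuousLinearMap.opNorm_comp_le _ _).trans ?_
  gcongr
  rw [norm_neg, pow_two]
  exact ContinuousLinearMap.opNorm_mulLeftRight_apply_apply_le ℝ A _ _

/-- The inverse of a differentiable family of invertible matrices is differentiable, and its
derivative is controlled by the derivatives of the entries. -/
theorem differentiableAt_matCLM_inv {N : Vec q → Matrix (Fin p) (Fin p) ℝ} {θ : Vec q}
    (hN : ∀ i j, DifferentiableAt ℝ (fun t => N t i j) θ) (hdet : IsUnit (N θ).det) :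
    DifferentiableAt ℝ (fun t => matCLM (N t)⁻¹) θ ∧
      ‖fderiv ℝ (fun t => matCLM (N t)⁻¹) θ‖ ≤ ‖matCLM (N θ)⁻¹‖ ^ 2 *
        ∑ i, ∑ j, ‖fderiv ℝ (fun t => N t i j) θ‖ *
          ‖matCLM (Matrix.single i j (1 : ℝ) : Matrix (Fin p) (Fin p) ℝ)‖ := by
  have hsum : ∀ t, matCLM (N t) = ∑ i, ∑ j, N t i j • matCLM (Matrix.single i j (1 : ℝ)) := by
    intro t
    conv_lhs => rw [matrix_eq_sum_single (N t)]
    simp only [map_sum]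
    refine Finset.sum_congr rfl fun i _ => Finset.sum_congr rfl fun j _ => ?_
    rw [← map_smul, smul_single, smul_eq_mul, mul_one]
  have hD := hasFDerivAt_sum_sum_smul
    (fun i j => matCLM (Matrix.single i j (1 : ℝ) : Matrix (Fin p) (Fin p) ℝ)) hN
  simp only [← hsum] at hD
  have hcont : ContinuousAt (fun t => (N t).det) θ := by
    refine (Continuous.matrix_det continuous_id).continuousAt.comp (f := N) ?_
    exact continuousAt_pi.2 fun i => continuousAt_pi.2 fun j => (hN i j).continuousAt
  have hev : (fun t => matCLM (N t)⁻¹) =ᶠ[𝓝 θ] fun t => Ring.inverse (matCLM (N t)) := by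
    filter_upwards [hcont.eventually_ne hdet.ne_zero] with t ht
    exact matCLM_inv_eq_ringInverse (isUnit_iff_ne_zero.2 ht)
  obtain ⟨g, hg, hgn⟩ := exists_hasFDerivAt_ringInverse hD
    ⟨matCLM (N θ), matCLM (N θ)⁻¹, ContinuousLinearMap.ext (matCLM_apply_inv hdet),
      ContinuousLinearMap.ext (matCLM_inv_apply hdet)⟩ rfl
  have hK := hg.congr_of_eventuallyEq hev
  refine ⟨hK.differentiableAt, ?_⟩
  rw [hK.fderiv]
  refine hgn.trans ?_
  refine mul_le_mul_of_nonneg_left ?_ (by positivity)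
  refine (norm_sum_le _ _).trans (Finset.sum_le_sum fun i _ => ?_)
  refine (norm_sum_le _ _).trans (Finset.sum_le_sum fun j _ => ?_)
  rw [ContinuousLinearMap.norm_smulRight_apply]

end Matrices

/-! ### Consistency and linearization of minimum distance estimators -/

section MinimumDistanceEstimator

open scoped InnerProductSpace

variable {p q : ℕ} {Z : Type*} {l : Filter Z} {Θ : Set (Vec q)} {θs : Vec q}
  {b : Vec q → Vec p} {m : Z → Vec q → Vec p} {S : Z → Vec p} {e : Z → Vec q}
  {N : Z → Vec q → Matrix (Fin p) (Fin p) ℝ} {Sig₀ : Matrix (Fin p) (Fin p) ℝ}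

theorem tendsto_quadForm {A : Z → Matrix (Fin p) (Fin p) ℝ} {A₀ : Matrix (Fin p) (Fin p) ℝ}
    {x : Z → Vec p} {x₀ : Vec p} (hA : Tendsto A l (𝓝 A₀)) (hx : Tendsto x l (𝓝 x₀)) :
    Tendsto (fun z => quadForm (A z) (x z)) l (𝓝 (quadForm A₀ x₀)) := by
  have h1 : Continuous fun P : Matrix (Fin p) (Fin p) ℝ × Vec p => quadForm P.1 P.2 := by
    have h2 : Continuous fun P : Matrix (Fin p) (Fin p) ℝ × Vec p => P.2.ofLp :=
      (PiLp.continuous_ofLp 2 _).comp continuous_snd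
    exact h2.dotProduct (continuous_fst.matrix_mulVec h2)
  exact (h1.tendsto (A₀, x₀)).comp (hA.prodMk_nhds hx)

/-- Minimum distance estimators with weights `N(θ)⁻¹` are consistent: the minimum is at most the
distance at `θs`, which tends to zero, so that `m` at the estimator is close to the statistic; it
is also close to `b`, and `b` separates `θs` from the other parameters. -/
theorem tendsto_minimumDistance (hθs : θs ∈ Θ)
    (hsep : ∀ ε : ℝ, 0 < ε → ∃ δ : ℝ, 0 < δ ∧ ∀ θ ∈ Θ, ε ≤ ‖θ - θs‖ → δ ≤ ‖b θ - b θs‖)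
    (hS : Tendsto S l (𝓝 (b θs))) (he : ∀ z, e z ∈ Θ)
    (hm : ∀ g : Z → Vec q, (∀ z, g z ∈ Θ) → Tendsto (fun z => m z (g z) - b (g z)) l (𝓝 0))
    (hSig₀ : Sig₀.PosDef)
    (hN : ∃ C : ℝ, 0 < C ∧ ∀ᶠ z in l, ∀ θ ∈ Θ,
      (N z θ).PosDef ∧ ∀ x, quadForm (N z θ) x ≤ C * ‖x‖ ^ 2)
    (hNlim : Tendsto (fun z => N z θs) l (𝓝 Sig₀))
    (hmin : ∀ᶠ z in l, ∀ θ ∈ Θ,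
      quadForm (N z (e z))⁻¹ (S z - m z (e z)) ≤ quadForm (N z θ)⁻¹ (S z - m z θ)) :
    Tendsto (fun z => S z - m z (e z)) l (𝓝 0) ∧ Tendsto e l (𝓝 θs) := by
  obtain ⟨C, hC, hNC⟩ := hN
  have hms : Tendsto (fun z => m z θs) l (𝓝 (b θs)) := by
    have h1 := (hm (fun _ => θs) fun _ => hθs).add_const (b θs)
    simpa using h1
  have hQ : Tendsto (fun z => C * quadForm (N z θs)⁻¹ (S z - m z θs)) l (𝓝 0) := by
    have h1 := (tendsto_quadForm (tendsto_matrix_inv hNlim hSig₀.isUnit_det)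
      (hS.sub hms)).const_mul C
    simpa [quadForm] using h1
  have hW2 : Tendsto (fun z => ‖S z - m z (e z)‖ ^ 2) l (𝓝 0) := by
    refine tendsto_of_tendsto_of_tendsto_of_le_of_le' tendsto_const_nhds hQ
      (Eventually.of_forall fun z => by positivity) ?_
    filter_upwards [hNC, hmin] with z hz1 hz2
    have h1 := le_quadForm_inv (hz1 (e z) (he z)).1 hC (hz1 (e z) (he z)).2 (S z - m z (e z))
    have h2 := h1.trans (hz2 θs hθs)
    rwa [inv_mul_le_iff₀ hC] at h2
  have hW : Tendsto (fun z => S z - m z (e z)) l (𝓝 0) := by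
    rw [tendsto_zero_iff_norm_tendsto_zero]
    have h1 := hW2.sqrt
    simpa using h1
  refine ⟨hW, ?_⟩
  have hb : Tendsto (fun z => b (e z) - b θs) l (𝓝 0) := by
    have h1 : Tendsto (fun z => S z - b θs) l (𝓝 0) := by simpa using hS.sub_const (b θs)
    have h2 := (h1.sub hW).sub (hm e he)
    simp only [sub_zero] at h2
    refine h2.congr fun z => ?_
    abel
  rw [Metric.tendsto_nhds]
  intro ε hε
  obtain ⟨δ, hδ, hsepδ⟩ := hsep ε hε
  filter_upwards [hb.eventually (Metric.ball_mem_nhds 0 hδ)] with z hz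
  rw [dist_zero_right] at hz
  rw [dist_eq_norm]
  by_contra hcon
  exact absurd hz (not_lt.2 (hsepδ _ (he z) (not_lt.1 hcon)))

/-- Linearization of a consistent minimum distance estimator with weights `N(θ)⁻¹`. -/
theorem isLittleO_minimumDistance_gain (hθs : θs ∈ interior Θ)
    (hB : Function.Injective (fderiv ℝ b θs))
    (hW : Tendsto (fun z => S z - m z (e z)) l (𝓝 0)) (he : Tendsto e l (𝓝 θs))
    (hmd : ∀ z, ∀ θ ∈ interior Θ, DifferentiableAt ℝ (m z) θ)
    (hm' : ∀ g : Z → Vec q, Tendsto g l (𝓝 θs) →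
      Tendsto (fun z => fderiv ℝ (m z) (g z)) l (𝓝 (fderiv ℝ b θs)))
    (hSig₀ : Sig₀.PosDef) (hN : ∀ᶠ z in l, ∀ θ ∈ Θ, (N z θ).PosDef)
    (hNlim : Tendsto (fun z => N z (e z)) l (𝓝 Sig₀))
    (hNd : ∀ z, ∀ θ ∈ interior Θ, ∀ i j, DifferentiableAt ℝ (fun t => N z t i j) θ)
    (hNd' : ∀ a : Z → ℝ, Tendsto a l (𝓝 0) → ∀ i j,
      Tendsto (fun z => ‖fderiv ℝ (fun t => N z t i j) (e z)‖ * a z) l (𝓝 0))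
    (hmin : ∀ᶠ z in l, ∀ θ ∈ Θ,
      quadForm (N z (e z))⁻¹ (S z - m z (e z)) ≤ quadForm (N z θ)⁻¹ (S z - m z θ)) :
    (fun z => e z - θs - matCLM (gain Sig₀⁻¹ (jacobian b θs)) (S z - m z θs)) =o[l]
      fun z => S z - m z θs := by
  have hint : ∀ᶠ z in l, e z ∈ interior Θ := he.eventually (isOpen_interior.mem_nhds hθs)
  have hgram := isUnit_det_gram (B := jacobian b θs) hSig₀.inv
    (by rw [matCLM_jacobian]; exact hB)
  have hKlim : Tendsto (fun z => matCLM (N z (e z))⁻¹) l (𝓝 (matCLM Sig₀⁻¹)) :=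
    (continuous_matCLM.tendsto _).comp (tendsto_matrix_inv hNlim hSig₀.isUnit_det)
  obtain ⟨r, hr, hball⟩ := Metric.isOpen_iff.1 isOpen_interior θs hθs
  refine isLittleO_minimumDistance (K := fun z t => matCLM (N z t)⁻¹)
    (B := fderiv ℝ b θs) (Om := matCLM Sig₀⁻¹)
    (G' := matCLM ((jacobian b θs)ᵀ * Sig₀⁻¹ * jacobian b θs)⁻¹) ?_ ?_ ?_ ?_ (hm' e he) hKlim ?_
    (isLittleO_sub_of_forall_tendsto_fderiv hr (fun z x hx => hmd z x (hball hx)) hm' he)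
    (fun x => ?_) (fun x => ?_)
  · filter_upwards [hint, hmin] with z hz1 hz2
    filter_upwards [isOpen_interior.mem_nhds hz1] with t ht
    have h1 := hz2 t (interior_subset ht)
    rwa [quadForm_eq_inner, quadForm_eq_inner] at h1
  · exact hint.mono fun z hz => hmd z _ hz
  · filter_upwards [hint, hN] with z hz1 hz2
    exact (differentiableAt_matCLM_inv (hNd z _ hz1) (hz2 _ (interior_subset hz1)).isUnit_det).1
  · filter_upwards [hint, hN] with z hz1 hz2 x y
    have h1 := (posDef_iff_quadForm.1 (hz2 _ (interior_subset hz1)).inv).1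
    rw [inner_matCLM, h1]
  · have h1 : Tendsto (fun z => ‖S z - m z (e z)‖) l (𝓝 0) :=
      tendsto_zero_iff_norm_tendsto_zero.1 hW
    have h2 : Tendsto (fun z => ‖matCLM (N z (e z))⁻¹‖ ^ 2 *
        ∑ i, ∑ j, (‖fderiv ℝ (fun t => N z t i j) (e z)‖ * ‖S z - m z (e z)‖) *
          ‖matCLM (Matrix.single i j (1 : ℝ) : Matrix (Fin p) (Fin p) ℝ)‖) l (𝓝 0) := by
      have h3 := (hKlim.norm.pow 2).mul (tendsto_finsetSum Finset.univ fun i _ =>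
        tendsto_finsetSum Finset.univ fun j _ => (hNd' _ h1 i j).mul_const
          ‖matCLM (Matrix.single i j (1 : ℝ) : Matrix (Fin p) (Fin p) ℝ)‖)
      simpa using h3
    refine tendsto_of_tendsto_of_tendsto_of_le_of_le' tendsto_const_nhds h2
      (Eventually.of_forall fun z => by positivity) ?_
    filter_upwards [hint, hN] with z hz1 hz2
    have h3 := (differentiableAt_matCLM_inv (hNd z _ hz1)
      (hz2 _ (interior_subset hz1)).isUnit_det).2
    refine (mul_le_mul_of_nonneg_right h3 (norm_nonneg _)).trans (le_of_eq ?_)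
    rw [mul_assoc, Finset.sum_mul]
    congr 1
    refine Finset.sum_congr rfl fun i _ => ?_
    rw [Finset.sum_mul]
    exact Finset.sum_congr rfl fun j _ => by ring
  · rw [matCLM_gain_apply, matCLM_jacobian]
  · rw [← matCLM_jacobian, matCLM_gain_apply_self hgram]

end MinimumDistanceEstimator

/-! ### Linearization of the released statistic -/

section Statistic

theorem gradient_apply {p : ℕ} (f : Vec p → ℝ) (x : Vec p) (i : Fin p) :
    gradient f x i = fderiv ℝ f x (EuclideanSpace.single i 1) := by
  rw [gradient, ← InnerProductSpace.toDual_symm_apply (𝕜 := ℝ), EuclideanSpace.inner_single_right]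
  simp

variable {p q : ℕ} {U W 𝒟 : ℕ → Type*} [∀ n, MeasurableSpace (U n)]
  [∀ n, MeasurableSpace (W n)] [∀ n, MeasurableSpace (𝒟 n)] (M : Model p q U W 𝒟)

namespace Model

/-- The scaled score `-√n ∂ρ_n(β*)` at `β* = b(θs)`. -/
def score (θs : Vec q) (b : Vec q → Vec p) (n : ℕ) (ω : U n × W n) : Vec p :=
  √(n : ℝ) • (-gradient (fun β => M.ρ n β (M.G n θs ω.1) ω.2) (b θs))

/-- The scaled error `√n (s - β*)` of the released statistic under `θs`. -/
def scaledStat (θs : Vec q) (b : Vec q → Vec p) (n : ℕ) (ω : U n × W n) : Vec p :=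
  √(n : ℝ) • (M.stat n θs ω - b θs)

variable {M} {θs : Vec q} {ρinf : Vec q → Vec p → ℝ} {b : Vec q → Vec p} {F : Measure (Vec p)}
  [IsProbabilityMeasure F]

/-- The released statistic minimizes the criterion in the interior of `𝔹`; expanding the gradient
of the criterion around `b θs` shows that its scaled error is asymptotically linear in the score. -/
theorem tendsto_scaledStat_sub (hθs : θs ∈ M.Θ) (h2 : M.A2 θs ρinf b) (h3 : M.A3 b)
    (h6 : M.A6 θs b F) (h7 : M.A7 θs ρinf b) :
    Tendsto (fun z : Σ n, U n × W n => M.scaledStat θs b z.1 z.2 -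
      matCLM (hessian (ρinf θs) (b θs))⁻¹ (M.score θs b z.1 z.2)) (probFilter M.seedLaw)
      (𝓝 0) := by
  have hstat : Tendsto (fun z : Σ n, U n × W n => M.stat z.1 θs z.2) (probFilter M.seedLaw)
      (𝓝 (b θs)) := by
    have h0 := (TendstoInProbUniformlyOn.tendsto_comp h3 (fun n => MeasurePreserving.id _)
      (g := fun _ => θs) fun _ => hθs).add_const (b θs)
    simpa using h0
  obtain ⟨r, hr, hball⟩ := Metric.isOpen_iff.1 isOpen_interior (b θs) h2.b_interior
  set f : (Σ n, U n × W n) → Vec p → Vec p := fun z =>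
    gradient (fun β => M.ρ z.1 β (M.G z.1 θs z.2.1) z.2.2) with hf
  have hfd : ∀ z, ∀ β ∈ Metric.ball (b θs) r, DifferentiableAt ℝ (f z) β := by
    intro z β hβ
    rw [differentiableAt_euclidean]
    intro i
    simp only [hf, gradient_apply]
    have h0 : ContDiffAt ℝ 2 (fun β => M.ρ z.1 β (M.G z.1 θs z.2.1) z.2.2) β :=
      (h7.smooth _ _ _).contDiffAt (isOpen_interior.mem_nhds (hball hβ))
    have h4 : DifferentiableAt ℝ (fderiv ℝ fun β => M.ρ z.1 β (M.G z.1 θs z.2.1) z.2.2) β :=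
      (h0.fderiv_right (m := 1) (by norm_num)).differentiableAt one_ne_zero
    exact h4.clm_apply (differentiableAt_const _)
  -- the minimizer is interior, so the gradient vanishes there
  have hf0 : ∀ z, f z (M.stat z.1 θs z.2) = 0 := by
    intro z
    have h0 : IsLocalMin (fun β => M.ρ z.1 β (M.G z.1 θs z.2.1) z.2.2) (M.stat z.1 θs z.2) := by
      filter_upwards [isOpen_interior.mem_nhds (h2.s_interior z.1 (M.G z.1 θs z.2.1) z.2.2)]
        with β hβ
      exact M.s_min _ _ _ _ (interior_subset hβ)
    simp only [hf]
    rw [gradient, h0.fderiv_eq_zero, map_zero]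
  have hexp := isLittleO_sub_of_forall_tendsto_fderiv hr hfd
    (D := hessianMap (ρinf θs) (b θs))
    (fun g hg => tendstoInProb_iff.1 (h7.tendsto (fun n ω => g ⟨n, ω⟩) (tendstoInProb_iff.2 hg)))
    hstat
  have hlin := isLittleO_sub_of_leftInverse (e := fun z : Σ n, U n × W n =>
      M.stat z.1 θs z.2 - b θs) (y := fun z => -f z (b θs))
    (A := hessianMap (ρinf θs) (b θs)) (A' := matCLM (hessian (ρinf θs) (b θs))⁻¹)
    (fun x => by
      rw [hessianMap, ← matCLM_jacobian]
      exact matCLM_inv_apply h7.invertible x)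
    (hexp.neg_left.congr_left fun z => by rw [hf0]; abel)
  have hscaled := (isBigO_refl (fun z : Σ n, U n × W n => √(z.1 : ℝ))
    (probFilter M.seedLaw)).smul_isLittleO hlin
  refine ((boundedInProb_of_tendstoInDistribution h6.tendsto).tendsto_zero_of_isLittleO
    hscaled).congr fun z => ?_
  rw [smul_sub, ← map_smul]
  rfl

theorem boundedInProb_scaledStat (hθs : θs ∈ M.Θ) (h2 : M.A2 θs ρinf b) (h3 : M.A3 b)
    (h6 : M.A6 θs b F) (h7 : M.A7 θs ρinf b) :
    BoundedInProb M.seedLaw (M.scaledStat θs b) := by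
  have h1 := boundedInProb_of_tendsto (X := fun n ω => M.scaledStat θs b n ω -
    matCLM (hessian (ρinf θs) (b θs))⁻¹ (M.score θs b n ω)) (tendsto_scaledStat_sub hθs h2 h3 h6 h7)
  have h4 : BoundedInProb M.seedLaw (M.score θs b) :=
    boundedInProb_of_tendstoInDistribution h6.tendsto
  have h5 := h1.add (h4.of_isBigO
    (Y := fun n ω => matCLM (hessian (ρinf θs) (b θs))⁻¹ (M.score θs b n ω))
    ((matCLM (hessian (ρinf θs) (b θs))⁻¹).isBigO_comp (fun z : Σ n, U n × W n =>
      M.score θs b z.1 z.2) (probFilter M.seedLaw)))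
  simpa using h5

theorem differentiableAt_stat (h5 : M.A5 θs b) (n : ℕ) (ω : U n × W n) {θ : Vec q}
    (hθ : θ ∈ interior M.Θ) : DifferentiableAt ℝ (fun θ => M.stat n θ ω) θ :=
  ((h5.stat_smooth n ω).contDiffAt (isOpen_interior.mem_nhds hθ)).differentiableAt one_ne_zero

theorem tendsto_fderiv_stat (h5 : M.A5 θs b) {Ω' : ℕ → Type*}
    [∀ n, MeasurableSpace (Ω' n)] {ν : ∀ n, Measure (Ω' n)} [∀ n, IsProbabilityMeasure (ν n)]
    {π : ∀ n, Ω' n → U n × W n} (hπ : ∀ n, MeasurePreserving (π n) (ν n) (M.seedLaw n))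
    {g : (Σ n, Ω' n) → Vec q} (hg : Tendsto g (probFilter ν) (𝓝 θs)) :
    Tendsto (fun z => fderiv ℝ (fun θ => M.stat z.1 θ (π z.1 z.2)) (g z)) (probFilter ν)
      (𝓝 (fderiv ℝ b θs)) := by
  have hY : ∀ g : (Σ n, U n × W n) → Vec q, Tendsto g (probFilter M.seedLaw) (𝓝 θs) →
      Tendsto (fun z : Σ n, U n × W n => fderiv ℝ (fun θ => M.stat z.1 θ z.2) (g z))
        (probFilter M.seedLaw) (𝓝 (fderiv ℝ b θs)) := fun g hg =>
    (tendstoInProb_iff (X := fun n ω => fderiv ℝ (fun θ => M.stat n θ ω) (g ⟨n, ω⟩))).1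
      (h5.tendsto (fun n ω => g ⟨n, ω⟩) ((tendstoInProb_iff (X := fun n ω => g ⟨n, ω⟩)).2 hg))
  exact tendsto_comp_of_forall_tendsto hπ hY hg

/-- First-order expansion of the simulated statistic in the parameter, on any space that carries
the seeds. -/
theorem isLittleO_stat_sub (hθs : θs ∈ interior M.Θ) (h5 : M.A5 θs b) {Ω' : ℕ → Type*}
    [∀ n, MeasurableSpace (Ω' n)] {ν : ∀ n, Measure (Ω' n)} [∀ n, IsProbabilityMeasure (ν n)]
    {π : ∀ n, Ω' n → U n × W n} (hπ : ∀ n, MeasurePreserving (π n) (ν n) (M.seedLaw n))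
    {g : (Σ n, Ω' n) → Vec q} (hg : Tendsto g (probFilter ν) (𝓝 θs)) :
    (fun z => M.stat z.1 (g z) (π z.1 z.2) - M.stat z.1 θs (π z.1 z.2) -
      fderiv ℝ b θs (g z - θs)) =o[probFilter ν] fun z => g z - θs := by
  obtain ⟨r, hr, hball⟩ := Metric.isOpen_iff.1 isOpen_interior θs hθs
  exact isLittleO_sub_of_forall_tendsto_fderiv hr
    (f := fun (z : Σ n, Ω' n) θ => M.stat z.1 θ (π z.1 z.2))
    (fun z θ hθ => differentiableAt_stat h5 z.1 _ (hball hθ))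
    (fun g' hg' => tendsto_fderiv_stat h5 hπ hg') hg

end Model

end Statistic

/-! ### Deterministic sequences and the delta method -/

section DeltaMethod

open scoped InnerProductSpace

theorem tendsto_of_sqrt_smul_bounded {k : ℕ} {x : ℕ → Vec k} {x₀ : Vec k}
    (h : ∃ C, ∀ n : ℕ, ‖√(n : ℝ) • (x n - x₀)‖ ≤ C) : Tendsto x atTop (𝓝 x₀) := by
  obtain ⟨C, hC⟩ := h
  rw [tendsto_iff_norm_sub_tendsto_zero]
  have h1 : Tendsto (fun n : ℕ => C / √(n : ℝ)) atTop (𝓝 0) :=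
    tendsto_const_nhds.div_atTop (Real.tendsto_sqrt_atTop.comp tendsto_natCast_atTop_atTop)
  refine tendsto_of_tendsto_of_tendsto_of_le_of_le' tendsto_const_nhds h1
    (Eventually.of_forall fun n => norm_nonneg _) ?_
  filter_upwards [eventually_gt_atTop 0] with n hn
  have h2 : 0 < √(n : ℝ) := Real.sqrt_pos.2 (by exact_mod_cast hn)
  rw [le_div_iff₀ h2]
  have h3 := hC n
  rwa [norm_smul, Real.norm_of_nonneg h2.le, mul_comm] at h3

theorem boundedInProb_deterministic {k : ℕ} {x : ℕ → Vec k} {Ω : ℕ → Type*}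
    [∀ n, MeasurableSpace (Ω n)] {μ : ∀ n, Measure (Ω n)} (h : ∃ C, ∀ n : ℕ, ‖x n‖ ≤ C) :
    BoundedInProb μ fun n _ => x n := by
  obtain ⟨C, hC⟩ := h
  exact boundedInProb_of_eventually_le (C := C) (Eventually.of_forall fun z => hC z.1)

/-- The delta method for the difference of a function at two random points. -/
theorem tendsto_sqrt_mul_sub {Ω : ℕ → Type*} [∀ n, MeasurableSpace (Ω n)]
    {μ : ∀ n, Measure (Ω n)} {k : ℕ} {η : Vec k → ℝ} {x₀ : Vec k} (hη : DifferentiableAt ℝ η x₀)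
    {x y L : ∀ n, Ω n → Vec k}
    (hx : Tendsto (fun z : Σ n, Ω n => x z.1 z.2) (probFilter μ) (𝓝 x₀))
    (hy : Tendsto (fun z : Σ n, Ω n => y z.1 z.2) (probFilter μ) (𝓝 x₀))
    (hxb : BoundedInProb μ fun n ω => √(n : ℝ) • (x n ω - x₀))
    (hyb : BoundedInProb μ fun n ω => √(n : ℝ) • (y n ω - x₀))
    (hL : Tendsto (fun z : Σ n, Ω n => √(z.1 : ℝ) • (x z.1 z.2 - x₀) - (L z.1 z.2 +
      √(z.1 : ℝ) • (y z.1 z.2 - x₀))) (probFilter μ) (𝓝 0)) :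
    Tendsto (fun z : Σ n, Ω n => √(z.1 : ℝ) * (η (x z.1 z.2) - η (y z.1 z.2)) -
      ⟪gradient η x₀, L z.1 z.2⟫_ℝ) (probFilter μ) (𝓝 0) := by
  have key : ∀ w : ∀ n, Ω n → Vec k,
      Tendsto (fun z : Σ n, Ω n => w z.1 z.2) (probFilter μ) (𝓝 x₀) →
      BoundedInProb μ (fun n ω => √(n : ℝ) • (w n ω - x₀)) →
      Tendsto (fun z : Σ n, Ω n => √(z.1 : ℝ) * (η (w z.1 z.2) - η x₀) -
        ⟪gradient η x₀, √(z.1 : ℝ) • (w z.1 z.2 - x₀)⟫_ℝ) (probFilter μ) (𝓝 0) := by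
    intro w hw hwb
    have h1 := hη.hasGradientAt.hasFDerivAt.isLittleO.comp_tendsto hw
    have h2 := (isBigO_refl (fun z : Σ n, Ω n => √(z.1 : ℝ)) (probFilter μ)).smul_isLittleO h1
    refine (hwb.tendsto_zero_of_isLittleO h2).congr fun z => ?_
    simp only [Function.comp_apply, InnerProductSpace.toDual_apply_apply, smul_eq_mul,
      real_inner_smul_right]
    ring
  have h3 : Tendsto (fun z : Σ n, Ω n => ⟪gradient η x₀, √(z.1 : ℝ) • (x z.1 z.2 - x₀) -
      (L z.1 z.2 + √(z.1 : ℝ) • (y z.1 z.2 - x₀))⟫_ℝ) (probFilter μ) (𝓝 0) := by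
    have h4 := (tendsto_const_nhds (x := gradient η x₀)).inner (𝕜 := ℝ) hL
    rwa [inner_zero_right] at h4
  have h5 := ((key x hx hxb).sub (key y hy hyb)).add h3
  simp only [sub_zero, add_zero] at h5
  refine h5.congr fun z => ?_
  rw [inner_sub_right, inner_add_right]
  ring

end DeltaMethod

/-! ### Expansions under the joint law of the data and the simulations -/

section Joint

open scoped InnerProductSpace

/-- The disjoint union over `n` of the spaces of the seeds of the data and of the simulations. -/
abbrev JointSeeds (U W : ℕ → Type*) (R : ℕ → ℕ) : Type _ :=
  Σ n, (U n × W n) × (Fin (R n) → U n × W n)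

variable {p q : ℕ} {U W 𝒟 : ℕ → Type*} [∀ n, MeasurableSpace (U n)]
  [∀ n, MeasurableSpace (W n)] [∀ n, MeasurableSpace (𝒟 n)] (M : Model p q U W 𝒟)

namespace Model

/-- Events whose probability tends to `1` under the joint law of all seeds. -/
abbrev lawFilter (R : ℕ → ℕ) : Filter (JointSeeds U W R) := probFilter fun n => M.law n (R n)

theorem measurePreserving_data (n R : ℕ) :
    MeasurePreserving Prod.fst (M.law n R) (M.seedLaw n) := by
  unfold law
  exact measurePreserving_fst

theorem measurePreserving_sim (n R : ℕ) :
    MeasurePreserving Prod.snd (M.law n R) (M.simLaw n R) := by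
  unfold law
  exact measurePreserving_snd

theorem measurePreserving_simSeed (n R : ℕ) (k : Fin R) :
    MeasurePreserving (fun ω : (U n × W n) × (Fin R → U n × W n) => ω.2 k) (M.law n R)
      (M.seedLaw n) :=
  (measurePreserving_eval (fun _ : Fin R => M.seedLaw n) k).comp (M.measurePreserving_sim n R)

variable {M} {θs : Vec q} {ρinf : Vec q → Vec p → ℝ} {b : Vec q → Vec p} {F : Measure (Vec p)}
  [IsProbabilityMeasure F] {R : ℕ → ℕ} {θn : ℕ → Vec q}

theorem tendsto_stat_local (hθs : θs ∈ interior M.Θ) (h2 : M.A2 θs ρinf b) (h3 : M.A3 b)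
    (hθn : ∀ n, θn n ∈ M.Θ) (hlim : Tendsto θn atTop (𝓝 θs)) :
    Tendsto (fun z : JointSeeds U W R => M.stat z.1 (θn z.1) z.2.1) (M.lawFilter R)
      (𝓝 (b θs)) := by
  have h4 := TendstoInProbUniformlyOn.tendsto_comp h3
    (fun n => M.measurePreserving_data n (R n)) (g := fun z => θn z.1) fun z => hθn z.1
  have h5 : Tendsto (fun z : JointSeeds U W R => b (θn z.1)) (M.lawFilter R) (𝓝 (b θs)) :=
    (((h2.differentiableAt θs hθs).continuousAt.tendsto).comp hlim).comp tendsto_fst_probFilter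
  have h6 := h4.add h5
  simpa using h6

/-- Under a parameter at distance `O(1 / √n)` from `θs`, the scaled error of the released statistic
is that under `θs`, with the same seeds, plus a shift. -/
theorem tendsto_scaledStat_local (hθs : θs ∈ interior M.Θ) (h5 : M.A5 θs b)
    (hbdd : ∃ C, ∀ n : ℕ, ‖√(n : ℝ) • (θn n - θs)‖ ≤ C) :
    Tendsto (fun z : JointSeeds U W R => √(z.1 : ℝ) • (M.stat z.1 (θn z.1) z.2.1 - b θs) -
      (M.scaledStat θs b z.1 z.2.1 + fderiv ℝ b θs (√(z.1 : ℝ) • (θn z.1 - θs)))) (M.lawFilter R)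
      (𝓝 0) := by
  have h6 := isLittleO_stat_sub hθs h5 (fun n => M.measurePreserving_data n (R n))
    (g := fun z => θn z.1) ((tendsto_of_sqrt_smul_bounded hbdd).comp tendsto_fst_probFilter)
  have h7 := (isBigO_refl (fun z : JointSeeds U W R => √(z.1 : ℝ))
    (M.lawFilter R)).smul_isLittleO h6
  refine ((boundedInProb_deterministic hbdd).tendsto_zero_of_isLittleO h7).congr fun z => ?_
  rw [scaledStat, map_smul]
  simp only [smul_sub]
  abel

/-- The scaled error of an estimator that is asymptotically linear in `s - m^R(θs)`, under a
parameter at distance `O(1 / √n)` from `θs`. -/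
theorem tendsto_scaled_estimator (hθs : θs ∈ interior M.Θ) (h2 : M.A2 θs ρinf b) (h3 : M.A3 b)
    (h5 : M.A5 θs b) (h6 : M.A6 θs b F) (h7 : M.A7 θs ρinf b)
    (hbdd : ∃ C, ∀ n : ℕ, ‖√(n : ℝ) • (θn n - θs)‖ ≤ C)
    (hm : BoundedInProb (fun n => M.law n (R n))
      fun n ω => √(n : ℝ) • (M.simMean n (R n) ω.2 θs - b θs))
    {G : Vec p →L[ℝ] Vec q} (hG : ∀ x, G (fderiv ℝ b θs x) = x)
    {e : ∀ n, (U n × W n) × (Fin (R n) → U n × W n) → Vec q}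
    (he : (fun z : JointSeeds U W R => e z.1 z.2 - θs -
      G (M.stat z.1 (θn z.1) z.2.1 - M.simMean z.1 (R z.1) z.2.2 θs)) =o[M.lawFilter R]
        fun z => M.stat z.1 (θn z.1) z.2.1 - M.simMean z.1 (R z.1) z.2.2 θs) :
    BoundedInProb (fun n => M.law n (R n)) (fun n ω => √(n : ℝ) • (e n ω - θs)) ∧
    Tendsto (fun z : JointSeeds U W R => √(z.1 : ℝ) • (e z.1 z.2 - θs) -
      (G (M.scaledStat θs b z.1 z.2.1 - √(z.1 : ℝ) • (M.simMean z.1 (R z.1) z.2.2 θs - b θs)) +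
        √(z.1 : ℝ) • (θn z.1 - θs))) (M.lawFilter R) (𝓝 0) := by
  have hX : BoundedInProb (fun n => M.law n (R n)) fun n ω => M.scaledStat θs b n ω.1 :=
    (boundedInProb_scaledStat (interior_subset hθs) h2 h3 h6 h7).comp
      fun n => M.measurePreserving_data n (R n)
  have hY := tendsto_scaledStat_local (R := R) hθs h5 hbdd
  have hhn : BoundedInProb (fun n => M.law n (R n))
      (fun n _ => √(n : ℝ) • (θn n - θs)) := boundedInProb_deterministic hbdd
  have hneg : ∀ {k : ℕ} {X : ∀ n, (U n × W n) × (Fin (R n) → U n × W n) → Vec k},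
      BoundedInProb (fun n => M.law n (R n)) X →
      BoundedInProb (fun n => M.law n (R n)) fun n ω => -X n ω := fun h => by
    simpa only [BoundedInProb, norm_neg] using h
  have hd : BoundedInProb (fun n => M.law n (R n)) fun n ω =>
      √(n : ℝ) • (M.stat n (θn n) ω.1 - M.simMean n (R n) ω.2 θs) := by
    have hBh := hhn.of_isBigO (Y := fun n _ => fderiv ℝ b θs (√(n : ℝ) • (θn n - θs)))
      ((fderiv ℝ b θs).isBigO_comp (fun z : JointSeeds U W R => √(z.1 : ℝ) • (θn z.1 - θs))
        (M.lawFilter R))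
    have h8 := ((boundedInProb_of_tendsto (X := fun n (ω : (U n × W n) × _) =>
      √(n : ℝ) • (M.stat n (θn n) ω.1 - b θs) - (M.scaledStat θs b n ω.1 +
        fderiv ℝ b θs (√(n : ℝ) • (θn n - θs)))) hY).add (hX.add hBh)).add (hneg hm)
    convert h8 using 3 with n ω
    simp only [smul_sub]
    abel
  have hlin : Tendsto (fun z : JointSeeds U W R => √(z.1 : ℝ) • (e z.1 z.2 - θs) -
      G (√(z.1 : ℝ) • (M.stat z.1 (θn z.1) z.2.1 - M.simMean z.1 (R z.1) z.2.2 θs)))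
      (M.lawFilter R) (𝓝 0) := by
    have h8 := (isBigO_refl (fun z : JointSeeds U W R => √(z.1 : ℝ))
      (M.lawFilter R)).smul_isLittleO he
    refine (hd.tendsto_zero_of_isLittleO h8).congr fun z => ?_
    rw [map_smul, smul_sub (√(z.1 : ℝ)) (e z.1 z.2 - θs)]
  constructor
  · have h8 := (boundedInProb_of_tendsto (X := fun n ω => √(n : ℝ) • (e n ω - θs) -
      G (√(n : ℝ) • (M.stat n (θn n) ω.1 - M.simMean n (R n) ω.2 θs))) hlin).add
      (hd.of_isBigO (Y := fun n ω => G (√(n : ℝ) • (M.stat n (θn n) ω.1 -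
        M.simMean n (R n) ω.2 θs))) (G.isBigO_comp (fun z : JointSeeds U W R =>
          √(z.1 : ℝ) • (M.stat z.1 (θn z.1) z.2.1 - M.simMean z.1 (R z.1) z.2.2 θs))
          (M.lawFilter R)))
    simpa using h8
  · have h8 := hlin.add ((G.continuous.tendsto 0).comp hY)
    rw [map_zero, add_zero] at h8
    refine h8.congr fun z => ?_
    simp only [Function.comp_apply, map_sub, map_add, map_smul, hG, smul_sub]
    abel

/-! ### The simulated mean and covariance -/

theorem differentiableAt_simMean (h5 : M.A5 θs b) (n R : ℕ) (r : Fin R → U n × W n) {θ : Vec q}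
    (hθ : θ ∈ interior M.Θ) : DifferentiableAt ℝ (M.simMean n R r) θ :=
  DifferentiableAt.fun_const_smul
    (DifferentiableAt.fun_sum fun k _ => differentiableAt_stat h5 n (r k) hθ) (R : ℝ)⁻¹

theorem differentiableAt_simCov (h5 : M.A5 θs b) (n R : ℕ) (r : Fin R → U n × W n) {θ : Vec q}
    (hθ : θ ∈ interior M.Θ) (i j : Fin p) :
    DifferentiableAt ℝ (fun θ => M.simCov n R r θ i j) θ := by
  have h1 : ∀ k i, DifferentiableAt ℝ
      (fun θ => (M.stat n θ (r k) - M.simMean n R r θ) i) θ := fun k i =>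
    differentiableAt_euclidean.1
      ((differentiableAt_stat h5 n (r k) hθ).sub (differentiableAt_simMean h5 n R r hθ)) i
  have h2 : (fun θ => M.simCov n R r θ i j) = fun θ => ((R : ℝ) - 1)⁻¹ *
      ∑ k, (M.stat n θ (r k) - M.simMean n R r θ) i *
        (M.stat n θ (r k) - M.simMean n R r θ) j := by
    ext θ
    simp only [simCov, Matrix.smul_apply, Matrix.sum_apply, vecMulVec_apply, smul_eq_mul]
  rw [h2]
  exact (DifferentiableAt.fun_sum fun k _ => (h1 k i).mul (h1 k j)).const_mul _

theorem transpose_simCov (n R : ℕ) (r : Fin R → U n × W n) (θ : Vec q) :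
    (M.simCov n R r θ)ᵀ = M.simCov n R r θ := by
  ext i j
  simp only [simCov, Matrix.transpose_apply, Matrix.smul_apply, Matrix.sum_apply, vecMulVec_apply,
    mul_comm]

/-! ### The indirect estimator -/

section IND

variable {R : ℕ}

/-- With a fixed number of simulations, the scaled error of the simulated mean is the mean of the
scaled errors of the simulated statistics. -/
theorem scaled_simMean_eq (hR : 0 < R) (n : ℕ) (r : Fin R → U n × W n) :
    √(n : ℝ) • (M.simMean n R r θs - b θs) = (R : ℝ)⁻¹ • ∑ k, M.scaledStat θs b n (r k) := by
  have hR' : (R : ℝ) ≠ 0 := by exact_mod_cast hR.ne'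
  simp only [scaledStat, simMean, ← Finset.smul_sum, Finset.sum_sub_distrib, Finset.sum_const,
    Finset.card_univ, Fintype.card_fin]
  rw [smul_comm (R : ℝ)⁻¹, smul_sub (R : ℝ)⁻¹, ← Nat.cast_smul_eq_nsmul ℝ, inv_smul_smul₀ hR']

theorem boundedInProb_scaled_simMean (hR : 0 < R) (hθs : θs ∈ M.Θ) (h2 : M.A2 θs ρinf b)
    (h3 : M.A3 b) (h6 : M.A6 θs b F) (h7 : M.A7 θs ρinf b) :
    BoundedInProb (fun n => M.law n R)
      fun n ω => √(n : ℝ) • (M.simMean n R ω.2 θs - b θs) := by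
  simp only [scaled_simMean_eq hR]
  have h8 := BoundedInProb.sum (μ := fun n => M.law n R) Finset.univ
    (X := fun k n (ω : (U n × W n) × (Fin R → U n × W n)) => M.scaledStat θs b n (ω.2 k))
    fun k _ => (boundedInProb_scaledStat hθs h2 h3 h6 h7).comp
      fun n => M.measurePreserving_simSeed n R k
  exact h8.of_isBigO (Y := fun n (ω : (U n × W n) × (Fin R → U n × W n)) =>
      (R : ℝ)⁻¹ • ∑ k, M.scaledStat θs b n (ω.2 k))
    ((isBigO_refl (fun z : JointSeeds U W fun _ => R => ∑ k, M.scaledStat θs b z.1 (z.2.2 k))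
      (M.lawFilter fun _ => R)).const_smul_left (R : ℝ)⁻¹)

theorem tendsto_simMean_sub (hR : 0 < R) (h3 : M.A3 b) {g : JointSeeds U W (fun _ => R) → Vec q}
    (hg : ∀ z, g z ∈ M.Θ) :
    Tendsto (fun z => M.simMean z.1 R z.2.2 (g z) - b (g z)) (M.lawFilter fun _ => R) (𝓝 0) := by
  have hR' : (R : ℝ) ≠ 0 := by exact_mod_cast hR.ne'
  have h4 := (tendsto_finsetSum Finset.univ fun k _ =>
    TendstoInProbUniformlyOn.tendsto_comp h3
      (fun n => M.measurePreserving_simSeed n R k) hg).const_smul (R : ℝ)⁻¹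
  simp only [Finset.sum_const_zero, smul_zero] at h4
  refine h4.congr fun z => ?_
  simp only [simMean, Finset.sum_sub_distrib, Finset.sum_const, Finset.card_univ,
    Fintype.card_fin]
  rw [smul_sub (R : ℝ)⁻¹, ← Nat.cast_smul_eq_nsmul ℝ, inv_smul_smul₀ hR']

theorem tendsto_fderiv_simMean (hR : 0 < R) (hθs : θs ∈ interior M.Θ) (h5 : M.A5 θs b)
    {g : JointSeeds U W (fun _ => R) → Vec q} (hg : Tendsto g (M.lawFilter fun _ => R) (𝓝 θs)) :
    Tendsto (fun z => fderiv ℝ (M.simMean z.1 R z.2.2) (g z)) (M.lawFilter fun _ => R)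
      (𝓝 (fderiv ℝ b θs)) := by
  have hR' : (R : ℝ) ≠ 0 := by exact_mod_cast hR.ne'
  have h4 := (tendsto_finsetSum Finset.univ fun k _ => tendsto_fderiv_stat h5
      (fun n => M.measurePreserving_simSeed n R k) hg).const_smul (R : ℝ)⁻¹
  simp only [Finset.sum_const, Finset.card_univ, Fintype.card_fin] at h4
  rw [← Nat.cast_smul_eq_nsmul ℝ, inv_smul_smul₀ hR'] at h4
  refine h4.congr' ?_
  filter_upwards [hg.eventually (isOpen_interior.mem_nhds hθs)] with z hz
  have h6 : HasFDerivAt (M.simMean z.1 R z.2.2)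
      ((R : ℝ)⁻¹ • ∑ k, fderiv ℝ (fun θ => M.stat z.1 θ (z.2.2 k)) (g z)) (g z) :=
    HasFDerivAt.fun_const_smul (HasFDerivAt.fun_sum fun k _ =>
      (differentiableAt_stat h5 z.1 (z.2.2 k) hz).hasFDerivAt) (R : ℝ)⁻¹
  exact h6.fderiv.symm

/-- Consistency and linearization of the indirect estimator, when the data come from `θn n`. -/
theorem IsIND.linearization (hR : 0 < R) (hθs : θs ∈ interior M.Θ) (h2 : M.A2 θs ρinf b)
    (hsep : M.WellSeparated θs b) (h3 : M.A3 b) (h5 : M.A5 θs b)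
    {Om : ℕ → Matrix (Fin p) (Fin p) ℝ} {Om₀ : Matrix (Fin p) (Fin p) ℝ}
    (hOm : ∀ n, (Om n).PosDef) (hOm₀ : Om₀.PosDef) (hlim : Tendsto Om atTop (𝓝 Om₀))
    {est : ∀ n, Vec p × (Fin R → U n × W n) → Vec q} (hest : M.IsIND (fun _ => R) Om est)
    (hθn : ∀ n, θn n ∈ M.Θ) (hθnlim : Tendsto θn atTop (𝓝 θs)) :
    Tendsto (fun z : JointSeeds U W fun _ => R => est z.1 (M.draw z.1 R (θn z.1) z.2))
      (M.lawFilter fun _ => R) (𝓝 θs) ∧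
    (fun z : JointSeeds U W fun _ => R => est z.1 (M.draw z.1 R (θn z.1) z.2) - θs -
      matCLM (gain Om₀ (jacobian b θs))
        (M.stat z.1 (θn z.1) z.2.1 - M.simMean z.1 R z.2.2 θs)) =o[M.lawFilter fun _ => R]
      fun z => M.stat z.1 (θn z.1) z.2.1 - M.simMean z.1 R z.2.2 θs := by
  have hS := tendsto_stat_local (R := fun _ => R) hθs h2 h3 hθn hθnlim
  have he : ∀ z : JointSeeds U W fun _ => R, est z.1 (M.draw z.1 R (θn z.1) z.2) ∈ M.Θ :=
    fun z => hest.mem z.1 _ (M.s_mem _ _ _) _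
  have hNlim : Tendsto (fun z : JointSeeds U W fun _ => R => (Om z.1)⁻¹)
      (M.lawFilter fun _ => R) (𝓝 Om₀⁻¹) :=
    (tendsto_matrix_inv hlim hOm₀.isUnit_det).comp tendsto_fst_probFilter
  -- the weights are written as the inverses of `Ω_n⁻¹`, to match the adaptive case
  have hmin : ∀ z : JointSeeds U W fun _ => R, ∀ θ ∈ M.Θ,
      quadForm (Om z.1)⁻¹⁻¹ (M.stat z.1 (θn z.1) z.2.1 -
        M.simMean z.1 R z.2.2 (est z.1 (M.draw z.1 R (θn z.1) z.2))) ≤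
      quadForm (Om z.1)⁻¹⁻¹ (M.stat z.1 (θn z.1) z.2.1 - M.simMean z.1 R z.2.2 θ) := by
    intro z θ hθ
    rw [nonsing_inv_nonsing_inv _ (hOm z.1).isUnit_det]
    exact hest.min z.1 _ (M.s_mem _ _ _) _ θ hθ
  have hNC : ∀ᶠ z : JointSeeds U W fun _ => R in M.lawFilter fun _ => R, ∀ θ ∈ M.Θ,
      ((Om z.1)⁻¹).PosDef ∧
        ∀ x, quadForm (Om z.1)⁻¹ x ≤ (‖matCLM Om₀⁻¹‖ + 1) * ‖x‖ ^ 2 := by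
    have h8 := (((continuous_matCLM.tendsto Om₀⁻¹).comp hNlim).norm).eventually
      (ge_mem_nhds (lt_add_one _))
    filter_upwards [h8] with z hz θ _
    exact ⟨(hOm z.1).inv, fun x => (quadForm_le _ x).trans (by gcongr; exact hz)⟩
  have hd : ∀ (z : JointSeeds U W fun _ => R), ∀ θ ∈ interior M.Θ,
      DifferentiableAt ℝ (M.simMean z.1 R z.2.2) θ :=
    fun z θ hθ => differentiableAt_simMean h5 z.1 R z.2.2 hθ
  obtain ⟨hW, he'⟩ := tendsto_minimumDistance
    (m := fun (z : JointSeeds U W fun _ => R) => M.simMean z.1 R z.2.2)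
    (N := fun (z : JointSeeds U W fun _ => R) _ => (Om z.1)⁻¹) (interior_subset hθs) hsep hS he
    (fun g hg => tendsto_simMean_sub hR h3 hg) hOm₀.inv ⟨_, by positivity, hNC⟩ hNlim
    (Eventually.of_forall hmin)
  refine ⟨he', ?_⟩
  have h9 := isLittleO_minimumDistance_gain
    (m := fun (z : JointSeeds U W fun _ => R) => M.simMean z.1 R z.2.2)
    (N := fun (z : JointSeeds U W fun _ => R) _ => (Om z.1)⁻¹) hθs (h2.full_rank θs hθs) hW he' hd
    (fun g hg => tendsto_fderiv_simMean hR hθs h5 hg) hOm₀.inv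
    (hNC.mono fun z hz θ hθ => (hz θ hθ).1) hNlim
    (fun z θ _ i j => differentiableAt_const _)
    (fun a _ i j => by simp only [fderiv_fun_const, Pi.zero_apply, norm_zero, zero_mul,
      tendsto_const_nhds]) (Eventually.of_forall hmin)
  rwa [nonsing_inv_nonsing_inv _ hOm₀.isUnit_det] at h9

end IND

end Model

end Joint

/-! ### The adaptive indirect estimator -/

section ADI

variable {p q : ℕ} {U W 𝒟 : ℕ → Type*} [∀ n, MeasurableSpace (U n)]
  [∀ n, MeasurableSpace (W n)] [∀ n, MeasurableSpace (𝒟 n)] {M : Model p q U W 𝒟}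
  {θs : Vec q} {ρinf : Vec q → Vec p → ℝ} {b : Vec q → Vec p} {R : ℕ → ℕ} {θn : ℕ → Vec q}
  {Sig : Vec q → Matrix (Fin p) (Fin p) ℝ}

theorem abs_quadForm_sub_le {A B : Matrix (Fin p) (Fin p) ℝ} {ε : ℝ}
    (h : ∀ i j, |A i j - B i j| ≤ ε) (x : Vec p) :
    |quadForm A x - quadForm B x| ≤ p * p * ε * ‖x‖ ^ 2 := by
  have h1 : quadForm A x - quadForm B x = ∑ i, ∑ j, x i * ((A i j - B i j) * x j) := by
    simp only [quadForm, dotProduct, mulVec, Finset.mul_sum, ← Finset.sum_sub_distrib]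
    exact Finset.sum_congr rfl fun i _ => Finset.sum_congr rfl fun j _ => by ring
  have hx : ∀ i, |x i| ≤ ‖x‖ := fun i => PiLp.norm_apply_le x i
  rw [h1]
  calc |∑ i, ∑ j, x i * ((A i j - B i j) * x j)|
      ≤ ∑ i, ∑ j, |x i * ((A i j - B i j) * x j)| :=
        (Finset.abs_sum_le_sum_abs _ _).trans
          (Finset.sum_le_sum fun i _ => Finset.abs_sum_le_sum_abs _ _)
    _ ≤ ∑ _i : Fin p, ∑ _j : Fin p, ‖x‖ * (ε * ‖x‖) := by
        refine Finset.sum_le_sum fun i _ => Finset.sum_le_sum fun j _ => ?_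
        rw [abs_mul, abs_mul]
        have := (abs_nonneg _).trans (h i j)
        gcongr
        exacts [hx i, h i j, hx j]
    _ = p * p * ε * ‖x‖ ^ 2 := by
        simp only [Finset.sum_const, Finset.card_univ, Fintype.card_fin, nsmul_eq_mul]
        ring

namespace Model

/-- With probability tending to `1`, the matrices `n S^R(θ)` are uniformly elliptic over `Θ`. -/
theorem eventually_posDef_simCov (h8 : M.A8 R θs b Sig) (hell : M.UniformlyElliptic Sig) :
    ∃ C : ℝ, 0 < C ∧ ∀ᶠ z : JointSeeds U W R in M.lawFilter R, ∀ θ ∈ M.Θ,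
      ((z.1 : ℝ) • M.simCov z.1 (R z.1) z.2.2 θ).PosDef ∧
        ∀ x, quadForm ((z.1 : ℝ) • M.simCov z.1 (R z.1) z.2.2 θ) x ≤ C * ‖x‖ ^ 2 := by
  obtain ⟨c, C, hc, hcC⟩ := hell
  refine ⟨|C| + c, by positivity, ?_⟩
  set ε : ℝ := c / (2 * (p * p + 1)) with hε
  have hε0 : 0 < ε := by positivity
  have hpε : (p : ℝ) * p * ε ≤ c / 2 := by
    have h1 : ((p : ℝ) * p + 1) * ε = c / 2 := by
      rw [hε]
      field_simp
    nlinarith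
  have hev : ∀ᶠ z : JointSeeds U W R in M.lawFilter R, ∀ i j, ∀ θ ∈ M.Θ,
      ‖(z.1 : ℝ) * M.simCov z.1 (R z.1) z.2.2 θ i j - Sig θ i j‖ < ε := by
    simp only [eventually_all]
    intro i j
    exact (tendsto_map_probFilter fun n => M.measurePreserving_sim n (R n)).eventually
      ((h8.simCov_uniform i j).eventually hε0)
  filter_upwards [hev] with z hz θ hθ
  have hdiff : ∀ x, |quadForm ((z.1 : ℝ) • M.simCov z.1 (R z.1) z.2.2 θ) x -
      quadForm (Sig θ) x| ≤ c / 2 * ‖x‖ ^ 2 := fun x =>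
    (abs_quadForm_sub_le (fun i j => (hz i j θ hθ).le) x).trans (by gcongr)
  constructor
  · refine posDef_iff_quadForm.2 ⟨?_, fun x hx => ?_⟩
    · rw [transpose_smul, transpose_simCov]
    · have h1 := (abs_le.1 (hdiff x)).1
      have h2 := (hcC θ hθ x).1
      have h3 : 0 < c / 2 * ‖x‖ ^ 2 := by positivity
      linarith
  · intro x
    have h1 := (abs_le.1 (hdiff x)).2
    have h2 := (hcC θ hθ x).2
    have h3 : C * ‖x‖ ^ 2 ≤ |C| * ‖x‖ ^ 2 := by gcongr; exact le_abs_self C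
    have h4 : 0 ≤ c / 2 * ‖x‖ ^ 2 := by positivity
    linarith

theorem tendsto_simCov (hθs : θs ∈ interior M.Θ) (h8 : M.A8 R θs b Sig)
    {g : JointSeeds U W R → Vec q} (hg : ∀ z, g z ∈ M.Θ)
    (hlim : Tendsto g (M.lawFilter R) (𝓝 θs)) :
    Tendsto (fun z => (z.1 : ℝ) • M.simCov z.1 (R z.1) z.2.2 (g z)) (M.lawFilter R)
      (𝓝 (Sig θs)) := by
  refine tendsto_pi_nhds.2 fun i => tendsto_pi_nhds.2 fun j => ?_
  have h1 := TendstoInProbUniformlyOn.tendsto_comp (h8.simCov_uniform i j)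
    (fun n => M.measurePreserving_sim n (R n)) hg
  have h2 : Tendsto (fun z => Sig (g z) i j) (M.lawFilter R) (𝓝 (Sig θs i j)) := by
    have h3 : ContinuousAt Sig θs :=
      h8.continuousOn.continuousAt (mem_interior_iff_mem_nhds.1 hθs)
    exact (tendsto_pi_nhds.1 (tendsto_pi_nhds.1 (h3.tendsto.comp hlim) i) j)
  have h4 := h1.add h2
  rw [zero_add] at h4
  refine h4.congr fun z => ?_
  rw [sub_add_cancel, Matrix.smul_apply, smul_eq_mul]

theorem tendsto_norm_fderiv_simCov_mul (h9 : M.A9 R θs b) {g : JointSeeds U W R → Vec q}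
    (hg : Tendsto g (M.lawFilter R) (𝓝 θs)) {a : JointSeeds U W R → ℝ}
    (ha : Tendsto a (M.lawFilter R) (𝓝 0)) (i j : Fin p) :
    Tendsto (fun z => ‖fderiv ℝ (fun θ => ((z.1 : ℝ) • M.simCov z.1 (R z.1) z.2.2 θ) i j) (g z)‖ *
      a z) (M.lawFilter R) (𝓝 0) :=
  tendsto_norm_mul_of_forall_boundedInProb (fun n => M.measurePreserving_sim n (R n))
    (Y := fun n r θ => fderiv ℝ (fun θ => (n : ℝ) * M.simCov n (R n) r θ i j) θ)
    (fun g hg => h9.cov g hg i j) hg ha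

theorem tendsto_fderiv_simMean_of_A9 (h9 : M.A9 R θs b) {g : JointSeeds U W R → Vec q}
    (hg : Tendsto g (M.lawFilter R) (𝓝 θs)) :
    Tendsto (fun z => fderiv ℝ (M.simMean z.1 (R z.1) z.2.2) (g z)) (M.lawFilter R)
      (𝓝 (fderiv ℝ b θs)) := by
  have hY : ∀ g : (Σ n, Fin (R n) → U n × W n) → Vec q,
      Tendsto g (probFilter fun n => M.simLaw n (R n)) (𝓝 θs) →
      Tendsto (fun z : Σ n, Fin (R n) → U n × W n =>
        fderiv ℝ (M.simMean z.1 (R z.1) z.2) (g z))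
        (probFilter fun n => M.simLaw n (R n)) (𝓝 (fderiv ℝ b θs)) := fun g hg =>
    (tendstoInProb_iff (X := fun n r => fderiv ℝ (M.simMean n (R n) r) (g ⟨n, r⟩))).1
      (h9.mean (fun n r => g ⟨n, r⟩) ((tendstoInProb_iff (X := fun n r => g ⟨n, r⟩)).2 hg))
  exact tendsto_comp_of_forall_tendsto (fun n => M.measurePreserving_sim n (R n)) hY hg

/-- Consistency and linearization of the adaptive indirect estimator, when the data come from
`θn n`. -/
theorem IsADI.linearization (hθs : θs ∈ interior M.Θ) (h2 : M.A2 θs ρinf b)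
    (hsep : M.WellSeparated θs b) (h3 : M.A3 b) (h5 : M.A5 θs b) (h8 : M.A8 R θs b Sig)
    (hell : M.UniformlyElliptic Sig) (h9 : M.A9 R θs b)
    {est : ∀ n, Vec p × (Fin (R n) → U n × W n) → Vec q} (hest : M.IsADI R est)
    (hθn : ∀ n, θn n ∈ M.Θ) (hθnlim : Tendsto θn atTop (𝓝 θs)) :
    Tendsto (fun z : JointSeeds U W R => est z.1 (M.draw z.1 (R z.1) (θn z.1) z.2))
      (M.lawFilter R) (𝓝 θs) ∧
    (fun z : JointSeeds U W R => est z.1 (M.draw z.1 (R z.1) (θn z.1) z.2) - θs -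
      matCLM (gain (Sig θs)⁻¹ (jacobian b θs))
        (M.stat z.1 (θn z.1) z.2.1 - M.simMean z.1 (R z.1) z.2.2 θs)) =o[M.lawFilter R]
      fun z => M.stat z.1 (θn z.1) z.2.1 - M.simMean z.1 (R z.1) z.2.2 θs := by
  have hθs' := interior_subset hθs
  have hS := tendsto_stat_local (R := R) hθs h2 h3 hθn hθnlim
  have he : ∀ z : JointSeeds U W R, est z.1 (M.draw z.1 (R z.1) (θn z.1) z.2) ∈ M.Θ :=
    fun z => hest.mem z.1 _ (M.s_mem _ _ _) _
  obtain ⟨C, hC, hNC⟩ := eventually_posDef_simCov h8 hell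
  -- scaling the weights by `n` does not change the minimizer and gives them a limit
  have hmin : ∀ᶠ z : JointSeeds U W R in M.lawFilter R, ∀ θ ∈ M.Θ,
      quadForm ((z.1 : ℝ) • M.simCov z.1 (R z.1) z.2.2
          (est z.1 (M.draw z.1 (R z.1) (θn z.1) z.2)))⁻¹ (M.stat z.1 (θn z.1) z.2.1 -
        M.simMean z.1 (R z.1) z.2.2 (est z.1 (M.draw z.1 (R z.1) (θn z.1) z.2))) ≤
      quadForm ((z.1 : ℝ) • M.simCov z.1 (R z.1) z.2.2 θ)⁻¹
        (M.stat z.1 (θn z.1) z.2.1 - M.simMean z.1 (R z.1) z.2.2 θ) := by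
    filter_upwards [hNC, tendsto_fst_probFilter.eventually (eventually_gt_atTop 0)]
      with z hz hz0 θ hθ
    have hn : (z.1 : ℝ) ≠ 0 := by exact_mod_cast hz0.ne'
    have hunit : ∀ θ ∈ M.Θ, IsUnit (M.simCov z.1 (R z.1) z.2.2 θ).det := by
      intro θ hθ
      have h1 := (hz θ hθ).1.isUnit_det
      rw [det_smul, IsUnit.mul_iff] at h1
      exact h1.2
    rw [quadForm_inv_smul hn (hunit _ (he z)), quadForm_inv_smul hn (hunit θ hθ)]
    exact mul_le_mul_of_nonneg_left (hest.min z.1 _ (M.s_mem _ _ _) _ hunit θ hθ) (by positivity)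
  have hd : ∀ (z : JointSeeds U W R), ∀ θ ∈ interior M.Θ,
      DifferentiableAt ℝ (M.simMean z.1 (R z.1) z.2.2) θ :=
    fun z θ hθ => differentiableAt_simMean h5 z.1 (R z.1) z.2.2 hθ
  have hNd : ∀ (z : JointSeeds U W R), ∀ θ ∈ interior M.Θ, ∀ i j,
      DifferentiableAt ℝ (fun t => ((z.1 : ℝ) • M.simCov z.1 (R z.1) z.2.2 t) i j) θ :=
    fun z θ hθ i j => (differentiableAt_simCov h5 z.1 (R z.1) z.2.2 hθ i j).const_mul (z.1 : ℝ)
  obtain ⟨hW, he'⟩ := tendsto_minimumDistance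
    (m := fun (z : JointSeeds U W R) => M.simMean z.1 (R z.1) z.2.2)
    (N := fun (z : JointSeeds U W R) θ => (z.1 : ℝ) • M.simCov z.1 (R z.1) z.2.2 θ) hθs' hsep hS he
    (fun g hg => TendstoInProbUniformlyOn.tendsto_comp h8.simMean_uniform
      (fun n => M.measurePreserving_sim n (R n)) hg) (h8.posDef θs hθs') ⟨C, hC, hNC⟩
    (tendsto_simCov hθs h8 (fun _ => hθs') tendsto_const_nhds) hmin
  exact ⟨he', isLittleO_minimumDistance_gain
    (m := fun (z : JointSeeds U W R) => M.simMean z.1 (R z.1) z.2.2)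
    (N := fun (z : JointSeeds U W R) θ => (z.1 : ℝ) • M.simCov z.1 (R z.1) z.2.2 θ) hθs
    (h2.full_rank θs hθs) hW he' hd
    (fun g hg => tendsto_fderiv_simMean_of_A9 h9 hg) (h8.posDef θs hθs')
    (hNC.mono fun z hz θ hθ => (hz θ hθ).1) (tendsto_simCov hθs h8 he he') hNd
    (fun a ha i j => tendsto_norm_fderiv_simCov_mul h9 he' ha i j) hmin⟩

end Model

end ADI

/-! ### Limits in distribution of the roots -/

section Roots

open scoped InnerProductSpace

theorem TendstoInDistribution.comp_measurePreserving {Ω Ω' : ℕ → Type*}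
    [∀ n, MeasurableSpace (Ω n)] [∀ n, MeasurableSpace (Ω' n)] {μ : ∀ n, Measure (Ω n)}
    {ν : ∀ n, Measure (Ω' n)} [∀ n, IsProbabilityMeasure (μ n)] [∀ n, IsProbabilityMeasure (ν n)]
    {Ω'' : Type*} [MeasurableSpace Ω''] {μ'' : Measure Ω''} [IsProbabilityMeasure μ'']
    {E : Type*} [TopologicalSpace E] [MeasurableSpace E] [OpensMeasurableSpace E]
    {X : ∀ n, Ω n → E} {Z : Ω'' → E} (h : TendstoInDistribution X atTop Z μ μ'')
    {π : ∀ n, Ω' n → Ω n} (hπ : ∀ n, MeasurePreserving (π n) (ν n) (μ n)) :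
    TendstoInDistribution (fun n ω => X n (π n ω)) atTop Z ν μ'' := by
  have hX := h.forall_aemeasurable
  refine ⟨fun n => (hX n).comp_quasiMeasurePreserving (hπ n).quasiMeasurePreserving,
    h.aemeasurable_limit, h.tendsto.congr fun n => Subtype.ext ?_⟩
  change (μ n).map (X n) = (ν n).map (X n ∘ π n)
  rw [← AEMeasurable.map_map_of_aemeasurable (by rw [(hπ n).map_eq]; exact hX n)
    (hπ n).measurable.aemeasurable, (hπ n).map_eq]

theorem continuous_limitVar {k p : ℕ} (η : Vec k → ℝ) (x : Vec k) (A : Matrix (Fin k) (Fin p) ℝ)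
    (J : Matrix (Fin p) (Fin p) ℝ) : Continuous (limitVar η x A J) := by
  have h1 : limitVar η x A J = fun v => ⟪gradient η x, matCLM A (matCLM J⁻¹ v)⟫_ℝ :=
    funext (limitVar_eq_inner η x A J)
  rw [h1]
  exact continuous_const.inner ((matCLM A).continuous.comp (matCLM J⁻¹).continuous)

variable {p q : ℕ} {U W 𝒟 : ℕ → Type*} [∀ n, MeasurableSpace (U n)]
  [∀ n, MeasurableSpace (W n)] [∀ n, MeasurableSpace (𝒟 n)] {M : Model p q U W 𝒟}
  {θs : Vec q} {ρinf : Vec q → Vec p → ℝ} {b : Vec q → Vec p} {F : Measure (Vec p)}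
  [IsProbabilityMeasure F] {R : ℕ → ℕ} {θn : ℕ → Vec q}
  {Sig : Vec q → Matrix (Fin p) (Fin p) ℝ}

namespace Model

theorem measurable_stat (M : Model p q U W 𝒟) (n : ℕ) {θ : Vec q} (hθ : θ ∈ M.Θ) :
    Measurable (M.stat n θ) :=
  (M.measurable_s n).comp
    (((M.measurable_G n θ hθ).comp measurable_fst).prodMk measurable_snd)

theorem measurable_draw (M : Model p q U W 𝒟) (n R : ℕ) {θ : Vec q} (hθ : θ ∈ M.Θ) :
    Measurable (M.draw n R θ) :=
  ((M.measurable_stat n hθ).comp measurable_fst).prodMk measurable_snd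

theorem tendsto_score_law (h6 : M.A6 θs b F) :
    TendstoInDistribution (fun n (ω : (U n × W n) × (Fin (R n) → U n × W n)) =>
      M.score θs b n ω.1) atTop id (fun n => M.law n (R n)) F :=
  TendstoInDistribution.comp_measurePreserving (X := M.score θs b) h6.tendsto
    fun n => M.measurePreserving_data n (R n)

/-- A root that is asymptotically a linear function of the scaled error of the released statistic
under `θs` converges in distribution to the same function of `J⁻¹ v`. -/
theorem tendstoInDistribution_of_linear (hθs : θs ∈ M.Θ) (h2 : M.A2 θs ρinf b) (h3 : M.A3 b)
    (h6 : M.A6 θs b F) (h7 : M.A7 θs ρinf b) {k : ℕ} {η : Vec k → ℝ} {x₀ : Vec k}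
    {A : Matrix (Fin k) (Fin p) ℝ}
    {T : ∀ n, (U n × W n) × (Fin (R n) → U n × W n) → ℝ}
    (hT : ∀ n, AEMeasurable (T n) (M.law n (R n)))
    (hlin : Tendsto (fun z : JointSeeds U W R => T z.1 z.2 -
      ⟪gradient η x₀, matCLM A (M.scaledStat θs b z.1 z.2.1)⟫_ℝ) (M.lawFilter R) (𝓝 0)) :
    TendstoInDistribution T atTop (limitVar η x₀ A (hessian (ρinf θs) (b θs)))
      (fun n => M.law n (R n)) F := by
  have h8 := (tendsto_score_law (R := R) h6).continuous_comp
    (continuous_limitVar η x₀ A (hessian (ρinf θs) (b θs)))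
  refine tendstoInDistribution_of_tendsto_sub h8 hT ?_
  have h9 := (tendsto_scaledStat_sub hθs h2 h3 h6 h7).comp
    (tendsto_map_probFilter fun n => M.measurePreserving_data n (R n))
  have h10 := (tendsto_const_nhds (x := gradient η x₀)).inner (𝕜 := ℝ)
    (((matCLM A).continuous.tendsto 0).comp h9)
  rw [map_zero, inner_zero_right] at h10
  have h11 := hlin.add h10
  rw [add_zero] at h11
  refine h11.congr fun z => ?_
  simp only [Function.comp_apply, limitVar_eq_inner, map_sub, inner_sub_right]
  ring

/-- The scaled displacement of the binding function along parameters at distance `O(1 / √n)` of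
`θs`. -/
theorem tendsto_scaled_binding (hb : DifferentiableAt ℝ b θs)
    (hbdd : ∃ C, ∀ n : ℕ, ‖√(n : ℝ) • (θn n - θs)‖ ≤ C) :
    Tendsto (fun z : JointSeeds U W R => √(z.1 : ℝ) • (b (θn z.1) - b θs) -
      fderiv ℝ b θs (√(z.1 : ℝ) • (θn z.1 - θs))) (M.lawFilter R) (𝓝 0) := by
  have h8 := hb.hasFDerivAt.isLittleO.comp_tendsto ((tendsto_of_sqrt_smul_bounded hbdd).comp
    (tendsto_fst_probFilter (μ := fun n => M.law n (R n))))
  have h9 := (isBigO_refl (fun z : JointSeeds U W R => √(z.1 : ℝ))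
    (M.lawFilter R)).smul_isLittleO h8
  have h10 : BoundedInProb (fun n => M.law n (R n)) (fun n _ => √(n : ℝ) • (θn n - θs)) :=
    boundedInProb_deterministic hbdd
  refine (h10.tendsto_zero_of_isLittleO h9).congr fun z => ?_
  simp only [Function.comp_apply, map_smul]
  rw [smul_sub]

theorem boundedInProb_fderiv_binding
    (hbdd : ∃ C, ∀ n : ℕ, ‖√(n : ℝ) • (θn n - θs)‖ ≤ C) :
    BoundedInProb (fun n => M.law n (R n))
      (fun n _ => fderiv ℝ b θs (√(n : ℝ) • (θn n - θs))) := by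
  obtain ⟨C, hC⟩ := hbdd
  refine boundedInProb_deterministic ⟨‖fderiv ℝ b θs‖ * C, fun n => ?_⟩
  exact ((fderiv ℝ b θs).le_opNorm _).trans
    (mul_le_mul_of_nonneg_left (hC n) (norm_nonneg _))

theorem boundedInProb_scaled_binding (hb : DifferentiableAt ℝ b θs)
    (hbdd : ∃ C, ∀ n : ℕ, ‖√(n : ℝ) • (θn n - θs)‖ ≤ C) :
    BoundedInProb (fun n => M.law n (R n)) (fun n _ => √(n : ℝ) • (b (θn n) - b θs)) := by
  have h8 : BoundedInProb (fun n => M.law n (R n)) (fun n _ => √(n : ℝ) • (b (θn n) - b θs) -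
      fderiv ℝ b θs (√(n : ℝ) • (θn n - θs))) :=
    boundedInProb_of_tendsto (tendsto_scaled_binding hb hbdd)
  have h9 := h8.add (boundedInProb_fderiv_binding (b := b) hbdd)
  simpa only [sub_add_cancel] using h9

theorem boundedInProb_scaledStat_local (hθs : θs ∈ interior M.Θ) (h2 : M.A2 θs ρinf b)
    (h3 : M.A3 b) (h5 : M.A5 θs b) (h6 : M.A6 θs b F) (h7 : M.A7 θs ρinf b)
    (hbdd : ∃ C, ∀ n : ℕ, ‖√(n : ℝ) • (θn n - θs)‖ ≤ C) :
    BoundedInProb (fun n => M.law n (R n))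
      (fun n ω => √(n : ℝ) • (M.stat n (θn n) ω.1 - b θs)) := by
  have hX : BoundedInProb (fun n => M.law n (R n)) fun n ω => M.scaledStat θs b n ω.1 :=
    (boundedInProb_scaledStat (interior_subset hθs) h2 h3 h6 h7).comp
      fun n => M.measurePreserving_data n (R n)
  have h8 : BoundedInProb (fun n => M.law n (R n)) (fun n ω =>
      √(n : ℝ) • (M.stat n (θn n) ω.1 - b θs) - (M.scaledStat θs b n ω.1 +
        fderiv ℝ b θs (√(n : ℝ) • (θn n - θs)))) :=
    boundedInProb_of_tendsto (tendsto_scaledStat_local (R := R) hθs h5 hbdd)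
  have h9 := h8.add (hX.add (boundedInProb_fderiv_binding (b := b) hbdd))
  simpa only [sub_add_cancel] using h9

/-- The root of `η₂` of the released statistic, under parameters at distance `O(1 / √n)` of
`θs`. -/
theorem tendsto_root_stat (hθs : θs ∈ interior M.Θ) (h2 : M.A2 θs ρinf b) (h3 : M.A3 b)
    (h5 : M.A5 θs b) (h6 : M.A6 θs b F) (h7 : M.A7 θs ρinf b) {η₂ : Vec p → ℝ}
    (hη₂m : Measurable η₂) (hη₂ : ContDiffAt ℝ 1 η₂ (b θs)) (hθn : ∀ n, θn n ∈ M.Θ)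
    (hbdd : ∃ C, ∀ n : ℕ, ‖√(n : ℝ) • (θn n - θs)‖ ≤ C) :
    TendstoInDistribution (fun n ω => M.root R (fun _ z => η₂ z.1) (fun n _ => 1 / √(n : ℝ))
      (fun θ => η₂ (b θ)) n (θn n) ω) atTop
      (limitVar η₂ (b θs) 1 (hessian (ρinf θs) (b θs))) (fun n => M.law n (R n)) F := by
  have hlim := tendsto_of_sqrt_smul_bounded hbdd
  have hb := h2.differentiableAt θs hθs
  have hbn : Tendsto (fun z : JointSeeds U W R => b (θn z.1)) (M.lawFilter R) (𝓝 (b θs)) :=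
    ((hb.continuousAt.tendsto).comp hlim).comp tendsto_fst_probFilter
  have hdiff : Tendsto (fun z : JointSeeds U W R =>
      √(z.1 : ℝ) • (M.stat z.1 (θn z.1) z.2.1 - b θs) - (M.scaledStat θs b z.1 z.2.1 +
        √(z.1 : ℝ) • (b (θn z.1) - b θs))) (M.lawFilter R) (𝓝 0) := by
    have h8 := (tendsto_scaledStat_local (R := R) hθs h5 hbdd).sub
      (tendsto_scaled_binding hb hbdd)
    rw [sub_zero] at h8
    refine h8.congr fun z => ?_
    abel
  have hdelta := tendsto_sqrt_mul_sub (μ := fun n => M.law n (R n))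
    (hη₂.differentiableAt one_ne_zero)
    (x := fun n ω => M.stat n (θn n) ω.1) (y := fun n _ => b (θn n))
    (L := fun n ω => M.scaledStat θs b n ω.1)
    (tendsto_stat_local hθs h2 h3 hθn hlim) hbn
    (boundedInProb_scaledStat_local hθs h2 h3 h5 h6 h7 hbdd)
    (boundedInProb_scaled_binding hb hbdd) hdiff
  refine tendstoInDistribution_of_linear (R := R) (A := 1) (interior_subset hθs) h2 h3 h6 h7
    (fun n => ?_) (hdelta.congr fun z => ?_)
  · refine Measurable.aemeasurable ?_
    exact ((hη₂m.comp (measurable_fst.comp (M.measurable_draw n (R n) (hθn n)))).sub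
      measurable_const).div measurable_const
  · rw [matCLM_one_apply, root, draw, div_div_eq_mul_div, div_one, mul_comm]

/-- The numerator of the root of `η₁` of an estimator that is asymptotically linear in
`s - m^R(θs)`. -/
theorem tendsto_root_estimator (hθs : θs ∈ interior M.Θ) (h2 : M.A2 θs ρinf b) (h3 : M.A3 b)
    (h5 : M.A5 θs b) (h6 : M.A6 θs b F) (h7 : M.A7 θs ρinf b) {η₁ : Vec q → ℝ}
    (hη₁ : ContDiffAt ℝ 1 η₁ θs)
    (hbdd : ∃ C, ∀ n : ℕ, ‖√(n : ℝ) • (θn n - θs)‖ ≤ C)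
    (hm : BoundedInProb (fun n => M.law n (R n))
      fun n ω => √(n : ℝ) • (M.simMean n (R n) ω.2 θs - b θs))
    {G : Vec p →L[ℝ] Vec q} (hG : ∀ x, G (fderiv ℝ b θs x) = x)
    {e : ∀ n, (U n × W n) × (Fin (R n) → U n × W n) → Vec q}
    (he : Tendsto (fun z : JointSeeds U W R => e z.1 z.2) (M.lawFilter R) (𝓝 θs))
    (hlin : (fun z : JointSeeds U W R => e z.1 z.2 - θs -
      G (M.stat z.1 (θn z.1) z.2.1 - M.simMean z.1 (R z.1) z.2.2 θs)) =o[M.lawFilter R]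
        fun z => M.stat z.1 (θn z.1) z.2.1 - M.simMean z.1 (R z.1) z.2.2 θs) :
    Tendsto (fun z : JointSeeds U W R => √(z.1 : ℝ) * (η₁ (e z.1 z.2) - η₁ (θn z.1)) -
      ⟪gradient η₁ θs, G (M.scaledStat θs b z.1 z.2.1 -
        √(z.1 : ℝ) • (M.simMean z.1 (R z.1) z.2.2 θs - b θs))⟫_ℝ) (M.lawFilter R) (𝓝 0) := by
  obtain ⟨hb, hL⟩ := tendsto_scaled_estimator hθs h2 h3 h5 h6 h7 hbdd hm hG hlin
  exact tendsto_sqrt_mul_sub (hη₁.differentiableAt one_ne_zero) (x := e) (y := fun n _ => θn n)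
    (L := fun n ω => G (M.scaledStat θs b n ω.1 -
        √(n : ℝ) • (M.simMean n (R n) ω.2 θs - b θs)))
    he ((tendsto_of_sqrt_smul_bounded hbdd).comp tendsto_fst_probFilter) hb
    (boundedInProb_deterministic hbdd) hL

/-- The gain is a left inverse of the derivative of the binding function. -/
theorem matCLM_gain_apply_fderiv (hθs : θs ∈ interior M.Θ) (h2 : M.A2 θs ρinf b)
    {Om : Matrix (Fin p) (Fin p) ℝ} (hOm : Om.PosDef) (x : Vec q) :
    matCLM (gain Om (jacobian b θs)) (fderiv ℝ b θs x) = x := by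
  rw [← matCLM_jacobian]
  exact matCLM_gain_apply_self (isUnit_det_gram hOm
    (by rw [matCLM_jacobian]; exact h2.full_rank θs hθs)) x

/-- The root of `η₁` of the indirect estimator. -/
theorem IsIND.tendsto_root {R : ℕ} (hR : 0 < R) (hθs : θs ∈ interior M.Θ) (h2 : M.A2 θs ρinf b)
    (hsep : M.WellSeparated θs b) (h3 : M.A3 b) (h5 : M.A5 θs b) (h6 : M.A6 θs b F)
    (h7 : M.A7 θs ρinf b) {η₁ : Vec q → ℝ} (hη₁m : Measurable η₁) (hη₁ : ContDiffAt ℝ 1 η₁ θs)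
    {Om : ℕ → Matrix (Fin p) (Fin p) ℝ} {Om₀ : Matrix (Fin p) (Fin p) ℝ}
    (hOm : ∀ n, (Om n).PosDef) (hOm₀ : Om₀.PosDef) (hlim : Tendsto Om atTop (𝓝 Om₀))
    {est : ∀ n, Vec p × (Fin R → U n × W n) → Vec q} (hest : M.IsIND (fun _ => R) Om est)
    (hθn : ∀ n, θn n ∈ M.Θ) (hbdd : ∃ C, ∀ n : ℕ, ‖√(n : ℝ) • (θn n - θs)‖ ≤ C) :
    TendstoInDistribution (fun n ω => M.root (fun _ => R) (fun n z => η₁ (est n z))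
      (fun n _ => 1 / √(n : ℝ)) η₁ n (θn n) ω) atTop
      (fun v : Fin (R + 1) → Vec p => limitVar η₁ θs (gain Om₀ (jacobian b θs))
        (hessian (ρinf θs) (b θs)) (v 0 - (R : ℝ)⁻¹ • ∑ r : Fin R, v r.succ))
      (fun n => M.law n R) (Measure.pi fun _ => F) := by
  have hθs' := interior_subset hθs
  set G := matCLM (gain Om₀ (jacobian b θs)) with hGdef
  set J := hessian (ρinf θs) (b θs) with hJ
  obtain ⟨he, hlin⟩ := hest.linearization hR hθs h2 hsep h3 h5 hOm hOm₀ hlim hθn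
    (tendsto_of_sqrt_smul_bounded hbdd)
  have hroot := tendsto_root_estimator hθs h2 h3 h5 h6 h7 hη₁ hbdd
    (boundedInProb_scaled_simMean hR hθs' h2 h3 h6 h7)
    (matCLM_gain_apply_fderiv hθs h2 hOm₀)
    (e := fun n ω => est n (M.draw n R (θn n) ω)) he hlin
  have hc : Continuous fun v : Fin (R + 1) → Vec p => limitVar η₁ θs (gain Om₀ (jacobian b θs))
        J (v 0 - (R : ℝ)⁻¹ • ∑ r : Fin R, v r.succ) :=
    (continuous_limitVar _ _ _ _).comp (by fun_prop)
  have hscore := (TendstoInDistribution.cons_pi (V := M.score θs b) h6.tendsto R).continuous_comp hc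
  refine tendstoInDistribution_of_tendsto_sub (μ := fun n => M.law n R) hscore (fun n => ?_) ?_
  · refine Measurable.aemeasurable ?_
    exact ((hη₁m.comp ((hest.measurable n).comp (M.measurable_draw n R (hθn n)))).sub
      measurable_const).div measurable_const
  · have h0 := (tendsto_scaledStat_sub hθs' h2 h3 h6 h7).comp
      (tendsto_map_probFilter fun n => M.measurePreserving_data n R)
    have hk := (tendsto_finsetSum Finset.univ fun k _ =>
      (tendsto_scaledStat_sub hθs' h2 h3 h6 h7).comp
        (tendsto_map_probFilter fun n => M.measurePreserving_simSeed n R k)).const_smul (R : ℝ)⁻¹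
    have h10 := (tendsto_const_nhds (x := gradient η₁ θs)).inner (𝕜 := ℝ)
      ((G.continuous.tendsto _).comp (h0.sub hk))
    simp only [Finset.sum_const_zero, smul_zero, sub_zero, map_zero, inner_zero_right] at h10
    have h11 := hroot.add h10
    rw [add_zero] at h11
    refine h11.congr fun z => ?_
    have hkey : G (matCLM J⁻¹ (M.score θs b z.1 z.2.1 -
        (R : ℝ)⁻¹ • ∑ k, M.score θs b z.1 (z.2.2 k))) =
        G (M.scaledStat θs b z.1 z.2.1 - (R : ℝ)⁻¹ • ∑ k, M.scaledStat θs b z.1 (z.2.2 k)) -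
        G (M.scaledStat θs b z.1 z.2.1 - matCLM J⁻¹ (M.score θs b z.1 z.2.1) -
          (R : ℝ)⁻¹ • ∑ k, (M.scaledStat θs b z.1 (z.2.2 k) -
            matCLM J⁻¹ (M.score θs b z.1 (z.2.2 k)))) := by
      rw [← map_sub]
      refine congrArg G ?_
      simp only [Finset.sum_sub_distrib, map_sub, map_smul, map_sum, smul_sub]
      abel
    simp only [Function.comp_apply, limitVar_eq_inner, root, Fin.cons_zero, Fin.cons_succ,
      ← hGdef, scaled_simMean_eq hR, div_div_eq_mul_div, div_one, ← hJ]
    rw [hkey, inner_sub_right]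
    ring

end Model

end Roots

/-! ### Roots of the adaptive indirect estimator -/

section ADIRoots

open scoped InnerProductSpace

variable {p q : ℕ} {U W 𝒟 : ℕ → Type*} [∀ n, MeasurableSpace (U n)]
  [∀ n, MeasurableSpace (W n)] [∀ n, MeasurableSpace (𝒟 n)] {M : Model p q U W 𝒟}
  {θs : Vec q} {ρinf : Vec q → Vec p → ℝ} {b : Vec q → Vec p} {F : Measure (Vec p)}
  [IsProbabilityMeasure F] {R : ℕ → ℕ} {θn : ℕ → Vec q}
  {Sig : Vec q → Matrix (Fin p) (Fin p) ℝ}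

namespace Model

theorem tendsto_sim_probFilter (M : Model p q U W 𝒟) (R : ℕ → ℕ) :
    Tendsto (fun z : JointSeeds U W R => (⟨z.1, z.2.2⟩ : Σ n, Fin (R n) → U n × W n))
      (M.lawFilter R) (probFilter fun n => M.simLaw n (R n)) :=
  tendsto_map_probFilter (Ω := fun n => Fin (R n) → U n × W n) (μ := fun n => M.simLaw n (R n))
    (ν := fun n => M.law n (R n)) (π := fun _ ω => ω.2) fun n => M.measurePreserving_sim n (R n)

theorem tendsto_scaled_simMean (h8 : M.A8 R θs b Sig) :
    Tendsto (fun z : JointSeeds U W R =>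
      √(z.1 : ℝ) • (M.simMean z.1 (R z.1) z.2.2 θs - b θs)) (M.lawFilter R) (𝓝 0) := by
  have h1 := h8.simMean_rate
  rw [tendstoInProb_iff] at h1
  have h2 := h1.comp (M.tendsto_sim_probFilter R)
  refine h2.congr fun z => ?_
  simp only [Function.comp_apply]

theorem boundedInProb_scaled_simMean_of_A8 (h8 : M.A8 R θs b Sig) :
    BoundedInProb (fun n => M.law n (R n))
      fun n ω => √(n : ℝ) • (M.simMean n (R n) ω.2 θs - b θs) :=
  boundedInProb_of_tendsto (tendsto_scaled_simMean h8)

/-- The indirect estimator converges at rate `√n`. -/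
theorem IsIND.boundedInProb {R : ℕ} (hR : 0 < R) (hθs : θs ∈ interior M.Θ) (h2 : M.A2 θs ρinf b)
    (hsep : M.WellSeparated θs b) (h3 : M.A3 b) (h5 : M.A5 θs b) (h6 : M.A6 θs b F)
    (h7 : M.A7 θs ρinf b)
    {Om : ℕ → Matrix (Fin p) (Fin p) ℝ} {Om₀ : Matrix (Fin p) (Fin p) ℝ}
    (hOm : ∀ n, (Om n).PosDef) (hOm₀ : Om₀.PosDef) (hlim : Tendsto Om atTop (𝓝 Om₀))
    {est : ∀ n, Vec p × (Fin R → U n × W n) → Vec q} (hest : M.IsIND (fun _ => R) Om est) :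
    BoundedInProb (fun n => M.law n R)
      fun n ω => √(n : ℝ) • (est n (M.draw n R θs ω) - θs) := by
  have hθs' := interior_subset hθs
  exact (tendsto_scaled_estimator (θn := fun _ => θs) hθs h2 h3 h5 h6 h7 ⟨0, fun n => by simp⟩
    (boundedInProb_scaled_simMean hR hθs' h2 h3 h6 h7)
    (matCLM_gain_apply_fderiv hθs h2 hOm₀)
    (e := fun n ω => est n (M.draw n R θs ω)) (hest.linearization hR hθs h2 hsep h3 h5 hOm hOm₀
      hlim (fun _ => hθs') tendsto_const_nhds).2).1

/-- The adaptive indirect estimator converges at rate `√n`. -/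
theorem IsADI.boundedInProb (hθs : θs ∈ interior M.Θ) (h2 : M.A2 θs ρinf b)
    (hsep : M.WellSeparated θs b) (h3 : M.A3 b) (h5 : M.A5 θs b) (h6 : M.A6 θs b F)
    (h7 : M.A7 θs ρinf b) (h8 : M.A8 R θs b Sig) (hell : M.UniformlyElliptic Sig)
    (h9 : M.A9 R θs b) {est : ∀ n, Vec p × (Fin (R n) → U n × W n) → Vec q} (hest : M.IsADI R est) :
    BoundedInProb (fun n => M.law n (R n))
      fun n ω => √(n : ℝ) • (est n (M.draw n (R n) θs ω) - θs) := by
  have hθs' := interior_subset hθs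
  exact (tendsto_scaled_estimator (θn := fun _ => θs) hθs h2 h3 h5 h6 h7 ⟨0, fun n => by simp⟩
    (boundedInProb_scaled_simMean_of_A8 h8)
    (matCLM_gain_apply_fderiv hθs h2 (h8.posDef θs hθs').inv)
    (e := fun n ω => est n (M.draw n (R n) θs ω)) (hest.linearization hθs h2 hsep h3 h5 h8 hell
      h9 (fun _ => hθs') tendsto_const_nhds).2).1

/-- The numerator of the root of `η₁` of the adaptive indirect estimator. -/
theorem IsADI.tendsto_numerator (hθs : θs ∈ interior M.Θ) (h2 : M.A2 θs ρinf b)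
    (hsep : M.WellSeparated θs b) (h3 : M.A3 b) (h5 : M.A5 θs b) (h6 : M.A6 θs b F)
    (h7 : M.A7 θs ρinf b) (h8 : M.A8 R θs b Sig) (hell : M.UniformlyElliptic Sig)
    (h9 : M.A9 R θs b) {est : ∀ n, Vec p × (Fin (R n) → U n × W n) → Vec q} (hest : M.IsADI R est)
    {η₁ : Vec q → ℝ} (hη₁ : ContDiffAt ℝ 1 η₁ θs)
    (hθn : ∀ n, θn n ∈ M.Θ) (hbdd : ∃ C, ∀ n : ℕ, ‖√(n : ℝ) • (θn n - θs)‖ ≤ C) :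
    Tendsto (fun z : JointSeeds U W R =>
      √(z.1 : ℝ) * (η₁ (est z.1 (M.draw z.1 (R z.1) (θn z.1) z.2)) - η₁ (θn z.1)) -
      ⟪gradient η₁ θs, matCLM (gain (Sig θs)⁻¹ (jacobian b θs)) (M.scaledStat θs b z.1 z.2.1)⟫_ℝ)
      (M.lawFilter R) (𝓝 0) := by
  have hθs' := interior_subset hθs
  set G := matCLM (gain (Sig θs)⁻¹ (jacobian b θs)) with hGdef
  obtain ⟨he, hlin⟩ := hest.linearization hθs h2 hsep h3 h5 h8 hell h9 hθn
    (tendsto_of_sqrt_smul_bounded hbdd)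
  have hroot := tendsto_root_estimator hθs h2 h3 h5 h6 h7 hη₁ hbdd
    (boundedInProb_scaled_simMean_of_A8 h8)
    (matCLM_gain_apply_fderiv hθs h2 (h8.posDef θs hθs').inv)
    (e := fun n ω => est n (M.draw n (R n) (θn n) ω)) he hlin
  have h10 := (tendsto_const_nhds (x := gradient η₁ θs)).inner (𝕜 := ℝ)
    ((G.continuous.tendsto 0).comp (tendsto_scaled_simMean h8))
  rw [map_zero, inner_zero_right] at h10
  have h11 := hroot.sub h10
  rw [sub_zero] at h11
  refine h11.congr fun z => ?_
  simp only [Function.comp_apply, ← hGdef, map_sub G, inner_sub_right]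
  ring

/-- The root of `η₁` of the adaptive indirect estimator. -/
theorem IsADI.tendsto_root (hθs : θs ∈ interior M.Θ) (h2 : M.A2 θs ρinf b)
    (hsep : M.WellSeparated θs b) (h3 : M.A3 b) (h5 : M.A5 θs b) (h6 : M.A6 θs b F)
    (h7 : M.A7 θs ρinf b) (h8 : M.A8 R θs b Sig) (hell : M.UniformlyElliptic Sig)
    (h9 : M.A9 R θs b) {est : ∀ n, Vec p × (Fin (R n) → U n × W n) → Vec q} (hest : M.IsADI R est)
    {η₁ : Vec q → ℝ} (hη₁m : Measurable η₁) (hη₁ : ContDiffAt ℝ 1 η₁ θs)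
    (hθn : ∀ n, θn n ∈ M.Θ) (hbdd : ∃ C, ∀ n : ℕ, ‖√(n : ℝ) • (θn n - θs)‖ ≤ C) :
    TendstoInDistribution (fun n ω => M.root R (fun n z => η₁ (est n z))
      (fun n _ => 1 / √(n : ℝ)) η₁ n (θn n) ω) atTop
      (limitVar η₁ θs (gain (Sig θs)⁻¹ (jacobian b θs)) (hessian (ρinf θs) (b θs)))
      (fun n => M.law n (R n)) F := by
  refine tendstoInDistribution_of_linear (R := R) (interior_subset hθs) h2 h3 h6 h7
    (fun n => ?_) ((hest.tendsto_numerator hθs h2 hsep h3 h5 h6 h7 h8 hell h9 hη₁ hθn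
      hbdd).congr fun z => ?_)
  · refine Measurable.aemeasurable ?_
    exact ((hη₁m.comp ((hest.measurable n).comp (M.measurable_draw n (R n) (hθn n)))).sub
      measurable_const).div measurable_const
  · rw [root, div_div_eq_mul_div, div_one, mul_comm]

end Model

end ADIRoots

/-! ### Studentization -/

section Studentization

open scoped InnerProductSpace

variable {p q : ℕ}

theorem hasContinuousCdf_map_div {V : Type*} [MeasurableSpace V] {P : Measure V} {f : V → ℝ}
    (hf : Measurable f) {c : ℝ} (hc : 0 < c) (h : HasContinuousCdf (P.map f)) :
    HasContinuousCdf (P.map fun v => f v / c) := by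
  have h1 : (fun t => (P.map fun v => f v / c).real (Set.Iic t)) =
      fun t => (P.map f).real (Set.Iic (t * c)) := by
    ext t
    rw [map_measureReal_apply (hf.div_const c) measurableSet_Iic,
      map_measureReal_apply hf measurableSet_Iic]
    congr 1
    ext v
    simp only [Set.mem_preimage, Set.mem_Iic, div_le_iff₀ hc]
  rw [HasContinuousCdf, h1]
  exact Continuous.comp (g := fun t => (P.map f).real (Set.Iic t)) h (by fun_prop)

/-- A point mass does not have a continuous distribution function. -/
theorem not_hasContinuousCdf_map_zero {V : Type*} [MeasurableSpace V] (P : Measure V)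
    [IsProbabilityMeasure P] : ¬ HasContinuousCdf (P.map fun _ => (0 : ℝ)) := by
  intro h
  have h1 : (P.map fun _ => (0 : ℝ)) = Measure.dirac 0 := by simp
  rw [h1, HasContinuousCdf] at h
  have h2 : Tendsto (fun t : ℝ => (Measure.dirac (0 : ℝ)).real (Set.Iic t)) (𝓝[<] 0) (𝓝 0) := by
    refine tendsto_const_nhds.congr' ?_
    filter_upwards [self_mem_nhdsWithin] with t ht
    have h3 : (0 : ℝ) ∉ Set.Iic t := by simpa using ht
    simp [Measure.real, h3]
  have h4 := tendsto_nhds_unique h2 (h.continuousAt.tendsto.mono_left nhdsWithin_le_nhds)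
  simp [Measure.real] at h4

/-- If the gradient vanished, the limit variable would be constant. -/
theorem gradient_ne_zero_of_hasContinuousCdf {k : ℕ} {F : Measure (Vec p)}
    [IsProbabilityMeasure F] {η : Vec k → ℝ} {x : Vec k} {A : Matrix (Fin k) (Fin p) ℝ}
    {J : Matrix (Fin p) (Fin p) ℝ} (h : HasContinuousCdf (F.map (limitVar η x A J))) :
    gradient η x ≠ 0 := by
  intro h0
  have h1 : limitVar η x A J = fun _ => 0 := by
    ext v
    rw [limitVar_eq_inner, h0, inner_zero_left]
  rw [h1] at h
  exact not_hasContinuousCdf_map_zero F h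

/-- Studentization as a rescaling of the gain matrix. -/
theorem studentizedLimit_eq_limitVar (η₁ : Vec q → ℝ) (b : Vec q → Vec p)
    (Sig : Vec q → Matrix (Fin p) (Fin p) ℝ) (J : Matrix (Fin p) (Fin p) ℝ) (θs : Vec q) :
    studentizedLimit η₁ b Sig J θs = limitVar η₁ θs
      ((eta3 η₁ b Sig θs)⁻¹ • gain (Sig θs)⁻¹ (jacobian b θs)) J := by
  ext v
  rw [studentizedLimit, limitVar_eq_inner, limitVar_eq_inner, map_smul,
    _root_.smul_apply, inner_smul_right, div_eq_inv_mul]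

theorem eta3_pos_and_sq {η₁ : Vec q → ℝ} {b : Vec q → Vec p}
    {Sig : Vec q → Matrix (Fin p) (Fin p) ℝ} {θ : Vec q} (hSig : (Sig θ).PosDef)
    (hb : Function.Injective (fderiv ℝ b θ))
    (hη : gradient η₁ θ ≠ 0) :
    0 < eta3 η₁ b Sig θ ∧ eta3 η₁ b Sig θ ^ 2 =
      quadForm ((jacobian b θ)ᵀ * (Sig θ)⁻¹ * jacobian b θ)⁻¹ (gradient η₁ θ) := by
  have h1 := (posDef_iff_quadForm.1 (posDef_gram hSig.inv (B := jacobian b θ)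
    (by rwa [matCLM_jacobian])).inv).2 _ hη
  exact ⟨Real.sqrt_pos.2 h1, Real.sq_sqrt h1.le⟩

theorem continuousAt_gradient {k : ℕ} {η : Vec k → ℝ} {x : Vec k} (h : ContDiffAt ℝ 1 η x) :
    ContinuousAt (gradient η) x :=
  (InnerProductSpace.toDual ℝ (Vec k)).symm.continuous.continuousAt.comp
    (h.continuousAt_fderiv one_ne_zero)

theorem continuousAt_jacobian {f : Vec q → Vec p} {x : Vec q} (h : ContDiffAt ℝ 1 f x) :
    ContinuousAt (jacobian f) x := by
  refine tendsto_pi_nhds.2 fun i => tendsto_pi_nhds.2 fun j => ?_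
  have h1 : ContinuousAt (fun y => fderiv ℝ f y (EuclideanSpace.single j 1)) x :=
    (h.continuousAt_fderiv one_ne_zero).clm_apply continuousAt_const
  exact ((EuclideanSpace.proj (𝕜 := ℝ) i).continuous.continuousAt.comp h1).tendsto

theorem continuousAt_eta3 {η₁ : Vec q → ℝ} {b : Vec q → Vec p}
    {Sig : Vec q → Matrix (Fin p) (Fin p) ℝ} {θ : Vec q} (hη : ContDiffAt ℝ 1 η₁ θ)
    (hb : ContDiffAt ℝ 1 b θ) (hbinj : Function.Injective (fderiv ℝ b θ))
    (hSig : ContinuousAt Sig θ) (hpos : (Sig θ).PosDef) : ContinuousAt (eta3 η₁ b Sig) θ := by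
  have h1 := continuousAt_jacobian hb
  have h2 : Tendsto (fun x => (Sig x)⁻¹) (𝓝 θ) (𝓝 (Sig θ)⁻¹) :=
    tendsto_matrix_inv hSig hpos.isUnit_det
  have h3 : ContinuousAt (fun x => (jacobian b x)ᵀ * (Sig x)⁻¹ * jacobian b x) θ := by
    have h4 : ContinuousAt (fun x => (Sig x)⁻¹) θ := h2
    fun_prop
  have h4 := tendsto_matrix_inv h3.tendsto
    (isUnit_det_gram hpos.inv (B := jacobian b θ) (by rwa [matCLM_jacobian]))
  exact (tendsto_quadForm h4 (continuousAt_gradient hη).tendsto).sqrt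

/-! ### Measurability of the studentization -/

section Measurability

variable {Z : Type*} [MeasurableSpace Z]

theorem measurable_det {k : ℕ} {A : Z → Matrix (Fin k) (Fin k) ℝ}
    (hA : ∀ i j, Measurable fun z => A z i j) : Measurable fun z => (A z).det := by
  simp only [Matrix.det_apply]
  exact Finset.measurable_fun_sum _ fun σ _ =>
    (Finset.measurable_fun_prod _ fun i _ => hA _ _).const_smul _

theorem measurable_matrix_inv {k : ℕ} {A : Z → Matrix (Fin k) (Fin k) ℝ}
    (hA : ∀ i j, Measurable fun z => A z i j) (i j : Fin k) :
    Measurable fun z => (A z)⁻¹ i j := by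
  simp only [Matrix.inv_def, Ring.inverse_eq_inv', Matrix.smul_apply, smul_eq_mul,
    Matrix.adjugate_apply]
  refine (measurable_det hA).inv.mul (measurable_det fun i' j' => ?_)
  rcases eq_or_ne i' j with rfl | h
  · simp only [Matrix.updateRow_self]
    exact measurable_const
  · simp only [Matrix.updateRow_ne h]
    exact hA _ _

theorem measurable_matrix_mul {k l m : ℕ} {A : Z → Matrix (Fin k) (Fin l) ℝ}
    {B : Z → Matrix (Fin l) (Fin m) ℝ} (hA : ∀ i j, Measurable fun z => A z i j)
    (hB : ∀ i j, Measurable fun z => B z i j) (i : Fin k) (j : Fin m) :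
    Measurable fun z => (A z * B z) i j := by
  simp only [Matrix.mul_apply]
  exact Finset.measurable_fun_sum _ fun l _ => (hA _ _).mul (hB _ _)

/-- The studentization is measurable although `Σ` is only known to be continuous on `Θ`, which
contains the values of the estimator. -/
theorem measurable_eta3 {η₁ : Vec q → ℝ} {b : Vec q → Vec p}
    {Sig : Vec q → Matrix (Fin p) (Fin p) ℝ} {Θ : Set (Vec q)} (hSig : ContinuousOn Sig Θ)
    {e : Z → Vec q} (he : Measurable e) (hmem : ∀ z, e z ∈ Θ) :
    Measurable fun z => eta3 η₁ b Sig (e z) := by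
  have h1 : ∀ i j, Measurable fun z => jacobian b (e z) i j := fun i j =>
    (EuclideanSpace.proj (𝕜 := ℝ) i).continuous.measurable.comp
      ((measurable_fderiv_apply_const ℝ b (EuclideanSpace.single j 1)).comp he)
  have h2 : ∀ i j, Measurable fun z => Sig (e z) i j := fun i j => by
    -- `Θ` need not be measurable, so the continuity of `Σ` is used on the subtype
    have h3 : Continuous fun x : Θ => Sig x i j :=
      (continuous_apply_apply i j).comp (continuousOn_iff_continuous_domRestrict.1 hSig)
    exact h3.measurable.comp (he.subtype_mk (h := hmem))
  have h4 : ∀ i, Measurable fun z => gradient η₁ (e z) i := fun i => by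
    simp only [gradient_apply]
    exact (measurable_fderiv_apply_const ℝ η₁ _).comp he
  have h5 := measurable_matrix_inv (measurable_matrix_mul (measurable_matrix_mul
    (A := fun z => (jacobian b (e z))ᵀ) (fun i j => h1 j i) (measurable_matrix_inv h2)) h1)
  refine Measurable.sqrt ?_
  simp only [quadForm, dotProduct, mulVec]
  exact Finset.measurable_fun_sum _ fun i _ => (h4 i).mul
    (Finset.measurable_fun_sum _ fun j _ => (h5 i j).mul (h4 j))

end Measurability

variable {U W 𝒟 : ℕ → Type*} [∀ n, MeasurableSpace (U n)]
  [∀ n, MeasurableSpace (W n)] [∀ n, MeasurableSpace (𝒟 n)] {M : Model p q U W 𝒟}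
  {θs : Vec q} {ρinf : Vec q → Vec p → ℝ} {b : Vec q → Vec p} {F : Measure (Vec p)}
  [IsProbabilityMeasure F] {R : ℕ → ℕ} {θn : ℕ → Vec q}
  {Sig : Vec q → Matrix (Fin p) (Fin p) ℝ}

namespace Model

/-- The studentized root of `η₁` of the adaptive indirect estimator. -/
theorem IsADI.tendsto_studentized (hθs : θs ∈ interior M.Θ) (h2 : M.A2 θs ρinf b)
    (hsep : M.WellSeparated θs b) (h3 : M.A3 b) (h5 : M.A5 θs b) (h6 : M.A6 θs b F)
    (h7 : M.A7 θs ρinf b) (h8 : M.A8 R θs b Sig) (hell : M.UniformlyElliptic Sig)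
    (h9 : M.A9 R θs b) {est : ∀ n, Vec p × (Fin (R n) → U n × W n) → Vec q} (hest : M.IsADI R est)
    {η₁ : Vec q → ℝ} (hη₁m : Measurable η₁) (hη₁ : ContDiffAt ℝ 1 η₁ θs)
    (hη₁' : gradient η₁ θs ≠ 0)
    (hθn : ∀ n, θn n ∈ M.Θ) (hbdd : ∃ C, ∀ n : ℕ, ‖√(n : ℝ) • (θn n - θs)‖ ≤ C) :
    TendstoInDistribution (fun n ω => M.root R (fun n z => η₁ (est n z))
      (fun n z => eta3 η₁ b Sig (est n z) / √(n : ℝ)) η₁ n (θn n) ω) atTop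
      (studentizedLimit η₁ b Sig (hessian (ρinf θs) (b θs)) θs)
      (fun n => M.law n (R n)) F := by
  have hθs' := interior_subset hθs
  have hnhds := mem_interior_iff_mem_nhds.1 hθs
  obtain ⟨hσ, -⟩ := eta3_pos_and_sq (η₁ := η₁) (h8.posDef θs hθs') (h2.full_rank θs hθs) hη₁'
  set σ := eta3 η₁ b Sig θs with hσdef
  rw [studentizedLimit_eq_limitVar, ← hσdef]
  have hmeas : ∀ n, Measurable fun ω => est n (M.draw n (R n) (θn n) ω) := fun n =>
    (hest.measurable n).comp (M.measurable_draw n (R n) (hθn n))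
  have hmem : ∀ n ω, est n (M.draw n (R n) (θn n) ω) ∈ M.Θ :=
    fun n ω => hest.mem n _ (M.s_mem _ _ _) _
  refine tendstoInDistribution_of_linear (R := R) hθs' h2 h3 h6 h7 (fun n => ?_) ?_
  · refine Measurable.aemeasurable ?_
    exact ((hη₁m.comp (hmeas n)).sub measurable_const).div
      ((measurable_eta3 h8.continuousOn (hmeas n) (hmem n)).div_const _)
  · have hnum := hest.tendsto_numerator hθs h2 hsep h3 h5 h6 h7 h8 hell h9 hη₁ hθn hbdd
    have he := (hest.linearization hθs h2 hsep h3 h5 h8 hell h9 hθn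
      (tendsto_of_sqrt_smul_bounded hbdd)).1
    have hη3 : ContinuousAt (eta3 η₁ b Sig) θs := continuousAt_eta3 hη₁
      (h5.b_smooth.contDiffAt (isOpen_interior.mem_nhds hθs)) (h2.full_rank θs hθs)
      (h8.continuousOn.continuousAt hnhds) (h8.posDef θs hθs')
    have hinv := (hη3.tendsto.comp he).inv₀ hσ.ne'
    have hX : BoundedInProb (fun n => M.law n (R n)) fun n ω => M.scaledStat θs b n ω.1 :=
      (boundedInProb_scaledStat hθs' h2 h3 h6 h7).comp
        fun n => M.measurePreserving_data n (R n)
    -- replacing `1 / η₃(θ̂)` by `1 / σ` changes the linear part by a negligible term, as the scaled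
    -- error is stochastically bounded
    have hdiff := hinv.sub_const σ⁻¹
    rw [sub_self] at hdiff
    have hlin := (tendsto_const_nhds (x := gradient η₁ θs)).inner (𝕜 := ℝ)
      (((matCLM (gain (Sig θs)⁻¹ (jacobian b θs))).continuous.tendsto 0).comp
        (hX.tendsto_smul_zero hdiff))
    have hsum := (hinv.mul hnum).add hlin
    rw [mul_zero, map_zero, inner_zero_right, add_zero] at hsum
    refine hsum.congr fun z => ?_
    simp only [Function.comp_apply, root, map_smul, _root_.smul_apply,
      inner_smul_right]
    rw [div_div_eq_mul_div, div_eq_mul_inv]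
    ring

end Model

end Studentization

/-! ### Moments of the limit law -/

section Moments

open scoped InnerProductSpace

theorem abs_sub_clip_le {C : ℝ} (hC : 0 < C) (x : ℝ) :
    |x - max (-C) (min C x)| ≤ x ^ 2 / C := by
  rw [le_div_iff₀ hC]
  rcases le_total x C with h1 | h1
  · rw [min_eq_right h1]
    rcases le_total (-C) x with h2 | h2
    · rw [max_eq_right h2, sub_self, abs_zero, zero_mul]
      exact sq_nonneg x
    · rw [max_eq_left h2, abs_of_nonpos (by linarith)]
      nlinarith
  · rw [min_eq_left h1, max_eq_right (by linarith), abs_of_nonneg (by linarith)]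
    nlinarith

theorem abs_clip_le {C : ℝ} (hC : 0 < C) (x : ℝ) : |max (-C) (min C x)| ≤ C :=
  abs_le.2 ⟨le_max_left _ _, max_le (by linarith) (min_le_left _ _)⟩

theorem abs_integral_sub_integral_clip_le {V : Type*} [MeasurableSpace V] {P : Measure V}
    [IsProbabilityMeasure P] {f : V → ℝ} (hf : MemLp f 2 P) {C : ℝ} (hC : 0 < C) :
    |∫ v, f v ∂P - ∫ v, max (-C) (min C (f v)) ∂P| ≤ (∫ v, f v ^ 2 ∂P) / C := by
  have h1 : Integrable f P := hf.integrable one_le_two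
  have h2 : Integrable (fun v => max (-C) (min C (f v))) P := by
    refine (integrable_const C).mono' ?_ (ae_of_all _ fun v => abs_clip_le hC _)
    exact (aestronglyMeasurable_const.sup (aestronglyMeasurable_const.inf hf.1))
  rw [← integral_sub h1 h2, ← integral_div]
  refine (abs_integral_le_integral_abs).trans (integral_mono_of_nonneg
    (ae_of_all _ fun _ => abs_nonneg _) (hf.integrable_sq.div_const C)
    (ae_of_all _ fun v => abs_sub_clip_le hC _))

/-- Convergence in distribution with bounded second moments implies convergence of the means. -/
theorem tendsto_integral_of_tendstoInDistribution {Ω : ℕ → Type*} [∀ n, MeasurableSpace (Ω n)]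
    {μ : ∀ n, Measure (Ω n)} [∀ n, IsProbabilityMeasure (μ n)] {Ω'' : Type*}
    [MeasurableSpace Ω''] {μ'' : Measure Ω''} [IsProbabilityMeasure μ''] {X : ∀ n, Ω n → ℝ}
    {Z : Ω'' → ℝ} (h : TendstoInDistribution X atTop Z μ μ'')
    (hX : ∀ᶠ n in atTop, MemLp (X n) 2 (μ n)) {K : ℝ}
    (hK : ∀ᶠ n in atTop, ∫ ω, X n ω ^ 2 ∂μ n ≤ K) (hZ : MemLp Z 2 μ'') :
    Tendsto (fun n => ∫ ω, X n ω ∂μ n) atTop (𝓝 (∫ v, Z v ∂μ'')) := by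
  rw [Metric.tendsto_nhds]
  intro ε hε
  set K' := ∫ v, Z v ^ 2 ∂μ'' with hK'
  have hK'0 : 0 ≤ K' := integral_nonneg fun _ => sq_nonneg _
  -- truncation at `C` changes both means by at most `(|K| + K') / C ≤ ε / 4`
  set C := 4 * (|K| + K' + 1) / ε with hC
  have hC0 : 0 < C := by positivity
  have hCε : (|K| + K') / C ≤ ε / 4 := by
    rw [hC, div_div_eq_mul_div, div_le_div_iff₀ (by positivity) (by positivity)]
    nlinarith [abs_nonneg K]
  have hclip : Continuous fun x : ℝ => max (-C) (min C x) := by fun_prop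
  let φ : BoundedContinuousFunction ℝ ℝ := BoundedContinuousFunction.ofNormedAddCommGroup
    (fun x => max (-C) (min C x)) hclip C (abs_clip_le hC0)
  have h1 := ProbabilityMeasure.tendsto_iff_forall_integral_tendsto.1 h.tendsto φ
  have h2 : Tendsto (fun n => ∫ ω, max (-C) (min C (X n ω)) ∂μ n) atTop
      (𝓝 (∫ v, max (-C) (min C (Z v)) ∂μ'')) := by
    have h3 : ∫ x, φ x ∂(μ''.map Z) = ∫ v, max (-C) (min C (Z v)) ∂μ'' :=
      integral_map h.aemeasurable_limit hclip.aestronglyMeasurable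
    rw [← h3]
    exact h1.congr fun n => integral_map (h.forall_aemeasurable n) hclip.aestronglyMeasurable
  filter_upwards [hX, hK, Metric.tendsto_nhds.1 h2 (ε / 4) (by positivity)] with n hXn hKn hn
  have h5 := abs_integral_sub_integral_clip_le hXn hC0
  have h6 := abs_integral_sub_integral_clip_le hZ hC0
  have h7 : (∫ ω, X n ω ^ 2 ∂μ n) / C ≤ |K| / C := by
    gcongr
    exact hKn.trans (le_abs_self K)
  rw [Real.dist_eq] at hn ⊢
  rw [add_div] at hCε
  rw [abs_lt] at hn ⊢
  rw [abs_le] at h5 h6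
  constructor <;> linarith [h5.1, h5.2, h6.1, h6.2, hn.1, hn.2]

/-- The variance of a linear function, from the covariance matrix of the coordinates. -/
theorem variance_inner_eq_quadForm {p : ℕ} {L : Measure (Vec p)} [IsProbabilityMeasure L]
    (hL : MemLp id 2 L) {S : Matrix (Fin p) (Fin p) ℝ}
    (hS : ∀ i j, cov[fun x : Vec p => x i, fun x => x j; L] = S i j) (a : Vec p) :
    Var[fun x => ⟪a, x⟫_ℝ; L] = quadForm S a := by
  have h1 : (fun x : Vec p => ⟪a, x⟫_ℝ) = fun x => ∑ i, a i * x i := by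
    ext x
    rw [inner_eq_dotProduct, dotProduct]
  have h2 : ∀ i : Fin p, MemLp (fun x : Vec p => x i) 2 L := fun i =>
    (EuclideanSpace.proj (𝕜 := ℝ) i).comp_memLp' hL
  rw [h1, variance_fun_sum fun i => (h2 i).const_mul (a i)]
  simp only [covariance_const_mul_left, covariance_const_mul_right, hS, quadForm, dotProduct,
    mulVec, Finset.mul_sum]
  exact Finset.sum_congr rfl fun i _ => Finset.sum_congr rfl fun j _ => by ring

theorem integral_inner_eq_zero {p : ℕ} {L : Measure (Vec p)} [IsProbabilityMeasure L]
    (hL : MemLp id 2 L) (h0 : ∀ i, ∫ x : Vec p, x i ∂L = 0) (a : Vec p) :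
    ∫ x, ⟪a, x⟫_ℝ ∂L = 0 := by
  have h2 : ∀ i : Fin p, Integrable (fun x : Vec p => a i * x i) L := fun i =>
    (((EuclideanSpace.proj (𝕜 := ℝ) i).comp_memLp' hL).integrable one_le_two).const_mul _
  simp only [inner_eq_dotProduct, dotProduct]
  rw [integral_finsetSum _ fun i _ => h2 i]
  simp only [integral_const_mul, h0, mul_zero, Finset.sum_const_zero]

variable {p q : ℕ} {U W 𝒟 : ℕ → Type*} [∀ n, MeasurableSpace (U n)]
  [∀ n, MeasurableSpace (W n)] [∀ n, MeasurableSpace (𝒟 n)] {M : Model p q U W 𝒟}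
  {θs : Vec q} {ρinf : Vec q → Vec p → ℝ} {b : Vec q → Vec p} {F : Measure (Vec p)}
  [IsProbabilityMeasure F] {R : ℕ → ℕ} {Sig : Vec q → Matrix (Fin p) (Fin p) ℝ}

namespace Model

theorem eventually_memLp_scaledStat (hθs : θs ∈ M.Θ) (h8 : M.A8 R θs b Sig) (i : Fin p) :
    ∀ᶠ n in atTop, MemLp (fun ω => M.scaledStat θs b n ω i) 2 (M.seedLaw n) := by
  filter_upwards [h8.memLp θs hθs] with n hn
  exact (EuclideanSpace.proj (𝕜 := ℝ) i).comp_memLp'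
    ((hn.sub (memLp_const (b θs))).const_smul √(n : ℝ))

theorem tendsto_variance_scaledStat (hθs : θs ∈ M.Θ) (h8 : M.A8 R θs b Sig) (i : Fin p) :
    Tendsto (fun n => Var[fun ω => M.scaledStat θs b n ω i; M.seedLaw n]) atTop
      (𝓝 (Sig θs i i)) := by
  refine (h8.tendsto_var θs hθs i i).congr' ?_
  filter_upwards [eventually_memLp_scaledStat hθs h8 i] with n hn
  exact covariance_self hn.1.aemeasurable

theorem scaled_simMean_apply {n R : ℕ} (hR : 0 < R) (r : Fin R → U n × W n) (i : Fin p) :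
    (√(n : ℝ) • (M.simMean n R r θs - b θs)) i =
      (R : ℝ)⁻¹ * ∑ k, M.scaledStat θs b n (r k) i := by
  rw [scaled_simMean_eq hR]
  simp

/-- The simulated mean has the expectation of the released statistic and a variance that vanishes,
so that the assumed rate of the former bounds the bias of the latter. -/
theorem tendsto_integral_scaledStat (hθs : θs ∈ M.Θ) (hR : Tendsto R atTop atTop)
    (h8 : M.A8 R θs b Sig) (i : Fin p) :
    Tendsto (fun n => ∫ ω, M.scaledStat θs b n ω i ∂M.seedLaw n) atTop (𝓝 0) := by
  set X : ∀ n, U n × W n → ℝ := fun n ω => M.scaledStat θs b n ω i with hX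
  set A : ∀ n, (Fin (R n) → U n × W n) → ℝ :=
    fun n r => (R n : ℝ)⁻¹ * ∑ k, X n (r k) with hA
  have hRpos : ∀ᶠ n in atTop, 0 < R n := hR.eventually_gt_atTop 0
  have hmom : ∀ᶠ n in atTop, MemLp (A n) 2 (M.simLaw n (R n)) ∧
      ∫ r, A n r ∂M.simLaw n (R n) = ∫ ω, X n ω ∂M.seedLaw n ∧
      Var[A n; M.simLaw n (R n)] = (R n : ℝ)⁻¹ * Var[X n; M.seedLaw n] := by
    filter_upwards [hRpos, eventually_memLp_scaledStat hθs h8 i] with n hRn hn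
    have hR' : (R n : ℝ) ≠ 0 := by exact_mod_cast hRn.ne'
    have hev : ∀ k, MeasurePreserving (Function.eval k) (M.simLaw n (R n)) (M.seedLaw n) :=
      measurePreserving_eval fun _ : Fin (R n) => M.seedLaw n
    have hk : ∀ k, MemLp (fun r : Fin (R n) → U n × W n => X n (r k)) 2 (M.simLaw n (R n)) :=
      fun k => hn.comp_measurePreserving (hev k)
    have hI : ∀ k, ∫ r, X n (r k) ∂M.simLaw n (R n) = ∫ ω, X n ω ∂M.seedLaw n := fun k => by
      rw [← (hev k).map_eq, integral_map (hev k).measurable.aemeasurable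
        (by rw [(hev k).map_eq]; exact hn.1)]
    refine ⟨(memLp_finsetSum _ fun k _ => hk k).const_mul _, ?_, ?_⟩
    · simp only [hA]
      rw [integral_const_mul, integral_finsetSum _ fun k _ => (hk k).integrable one_le_two]
      simp only [hI, Finset.sum_const, Finset.card_univ, Fintype.card_fin, nsmul_eq_mul]
      rw [inv_mul_cancel_left₀ hR']
    · have hV := variance_sum_pi (μ := fun _ : Fin (R n) => M.seedLaw n) (X := fun _ => X n)
        fun _ => hn
      simp only [Finset.sum_const, Finset.card_univ, Fintype.card_fin, nsmul_eq_mul] at hV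
      have hsum : (∑ k : Fin (R n), fun r : Fin (R n) → U n × W n => X n (r k)) =
          fun r => ∑ k, X n (r k) := by
        ext r
        simp
      rw [hsum] at hV
      simp only [hA]
      rw [variance_const_mul, simLaw, hV]
      field_simp
  have hvar : Tendsto (fun n => (R n : ℝ)⁻¹ * Var[X n; M.seedLaw n]) atTop (𝓝 0) := by
    have h1 := (tendsto_inv_atTop_zero.comp (tendsto_natCast_atTop_atTop.comp hR)).mul
      (tendsto_variance_scaledStat hθs h8 i)
    rwa [zero_mul] at h1
  have hcheb : Tendsto (fun z : Σ n, Fin (R n) → U n × W n =>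
      A z.1 z.2 - ∫ ω, X z.1 ω ∂M.seedLaw z.1) (probFilter fun n => M.simLaw n (R n)) (𝓝 0) := by
    refine (tendstoInProb_iff (X := fun n r => A n r - ∫ ω, X n ω ∂M.seedLaw n)).1
      fun ε hε => ?_
    have h1 : Tendsto (fun n => ENNReal.ofReal ((R n : ℝ)⁻¹ * Var[X n; M.seedLaw n] / ε ^ 2))
        atTop (𝓝 0) := by
      have h2 := ENNReal.tendsto_ofReal (hvar.div_const (ε ^ 2))
      rwa [zero_div, ENNReal.ofReal_zero] at h2
    refine tendsto_of_tendsto_of_tendsto_of_le_of_le' tendsto_const_nhds h1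
      (Eventually.of_forall fun _ => zero_le) ?_
    filter_upwards [hmom] with n hn
    have h3 := meas_ge_le_variance_div_sq hn.1 hε
    rw [hn.2.1, hn.2.2] at h3
    simpa only [sub_zero, Real.norm_eq_abs] using h3
  have hrate : Tendsto (fun z : Σ n, Fin (R n) → U n × W n => A z.1 z.2)
      (probFilter fun n => M.simLaw n (R n)) (𝓝 0) := by
    have h1 := h8.simMean_rate
    rw [tendstoInProb_iff] at h1
    have h2 := ((EuclideanSpace.proj (𝕜 := ℝ) i).continuous.tendsto (0 : Vec p)).comp h1
    rw [map_zero] at h2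
    refine h2.congr' ?_
    filter_upwards [tendsto_fst_probFilter.eventually hRpos] with z hz
    exact scaled_simMean_apply hz z.2 i
  have h1 := hrate.sub hcheb
  simp only [sub_sub_cancel, sub_zero] at h1
  exact tendsto_of_tendsto_fst (μ := fun n => M.simLaw n (R n))
    (a := fun n => ∫ ω, X n ω ∂M.seedLaw n) h1

/-- The law of `J⁻¹ v`, with `v` drawn from the limit law of the score, is square integrable and
centered, and its covariance matrix is `Σ(θs)`. -/
theorem moments_limit (hθs : θs ∈ M.Θ) (h2 : M.A2 θs ρinf b) (h3 : M.A3 b)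
    (h6 : M.A6 θs b F) (h7 : M.A7 θs ρinf b) (hR : Tendsto R atTop atTop)
    (h8 : M.A8 R θs b Sig) {L : Measure (Vec p)}
    (hL : L = F.map (matCLM (hessian (ρinf θs) (b θs))⁻¹)) :
    MemLp id 2 L ∧ (∀ i, ∫ x : Vec p, x i ∂L = 0) ∧
      ∀ i j, cov[fun x : Vec p => x i, fun x => x j; L] = Sig θs i j := by
  set J := hessian (ρinf θs) (b θs)
  obtain ⟨L', hL', hmem, hcov⟩ := h8.var_limit θs hθs
  have hscore : TendstoInDistribution (M.scaledStat θs b) atTop (matCLM J⁻¹) M.seedLaw F :=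
    tendstoInDistribution_of_tendsto_sub
      (h6.tendsto.continuous_comp (matCLM J⁻¹).continuous) hL'.forall_aemeasurable
      (tendsto_scaledStat_sub hθs h2 h3 h6 h7)
  -- limits in distribution are unique
  have hLL' : L = (L' : Measure (Vec p)) := by
    have h1 := congrArg (fun P : ProbabilityMeasure (Vec p) => (P : Measure (Vec p)))
      (tendsto_nhds_unique hscore.tendsto hL'.tendsto)
    simp only [ProbabilityMeasure.coe_mk, Measure.map_id] at h1
    rw [hL, h1]
  rw [hLL']
  refine ⟨hmem, fun i => ?_, hcov⟩
  have hE := tendsto_integral_scaledStat hθs hR h8 i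
  have hV := tendsto_variance_scaledStat hθs h8 i
  have hmem' := eventually_memLp_scaledStat hθs h8 i
  have hsq : ∀ᶠ n in atTop, ∫ ω, M.scaledStat θs b n ω i ^ 2 ∂M.seedLaw n ≤
      Sig θs i i + 0 ^ 2 + 1 := by
    filter_upwards [(hV.add (hE.pow 2)).eventually (gt_mem_nhds (lt_add_one _)), hmem']
      with n hn hn'
    have h1 := variance_eq_sub hn'
    simp only [Pi.pow_apply] at h1
    linarith
  have hproj : TendstoInDistribution (fun n ω => M.scaledStat θs b n ω i) atTop
      (fun x : Vec p => x i) M.seedLaw (L' : Measure (Vec p)) :=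
    hL'.continuous_comp (EuclideanSpace.proj (𝕜 := ℝ) i).continuous
  exact tendsto_nhds_unique (tendsto_integral_of_tendstoInDistribution hproj hmem' hsq
    ((EuclideanSpace.proj (𝕜 := ℝ) i).comp_memLp' hmem)) hE

end Model

end Moments

/-! ### The approximate pivot -/

section Pivot

open scoped InnerProductSpace

variable {p q : ℕ} {U W 𝒟 : ℕ → Type*} [∀ n, MeasurableSpace (U n)]
  [∀ n, MeasurableSpace (W n)] [∀ n, MeasurableSpace (𝒟 n)] {M : Model p q U W 𝒟}
  {θs : Vec q} {ρinf : Vec q → Vec p → ℝ} {b : Vec q → Vec p} {F : Measure (Vec p)}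
  [IsProbabilityMeasure F] {R : ℕ → ℕ} {Sig : Vec q → Matrix (Fin p) (Fin p) ℝ}

/-- With the optimal weights `Σ⁻¹`, the variance `G Σ Gᵀ` of the gain `G` is the inverse of the
Gram matrix. -/
theorem gain_mul_mul_transpose {S : Matrix (Fin p) (Fin p) ℝ} (hS : S.PosDef)
    {B : Matrix (Fin p) (Fin q) ℝ} (hB : Function.Injective (matCLM B)) :
    gain S⁻¹ B * S * (gain S⁻¹ B)ᵀ = (Bᵀ * S⁻¹ * B)⁻¹ := by
  have hdet := isUnit_det_gram hS.inv hB
  have hST : (S⁻¹)ᵀ = S⁻¹ := (posDef_iff_quadForm.1 hS.inv).1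
  have hNT : ((Bᵀ * S⁻¹ * B)⁻¹)ᵀ = (Bᵀ * S⁻¹ * B)⁻¹ :=
    (posDef_iff_quadForm.1 (posDef_gram hS.inv hB).inv).1
  have h1 : gain S⁻¹ B * S = (Bᵀ * S⁻¹ * B)⁻¹ * Bᵀ := by
    rw [gain, Matrix.mul_assoc _ S⁻¹ S, nonsing_inv_mul S hS.isUnit_det, Matrix.mul_one]
  have h2 : (gain S⁻¹ B)ᵀ = S⁻¹ * B * (Bᵀ * S⁻¹ * B)⁻¹ := by
    rw [gain, transpose_mul, transpose_mul, transpose_transpose, hST, hNT]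
    exact (Matrix.mul_assoc _ _ _).symm
  rw [h1, h2]
  calc (Bᵀ * S⁻¹ * B)⁻¹ * Bᵀ * (S⁻¹ * B * (Bᵀ * S⁻¹ * B)⁻¹)
      = (Bᵀ * S⁻¹ * B)⁻¹ * (Bᵀ * S⁻¹ * B) * (Bᵀ * S⁻¹ * B)⁻¹ := by
        simp only [Matrix.mul_assoc]
    _ = (Bᵀ * S⁻¹ * B)⁻¹ := by rw [nonsing_inv_mul _ hdet, Matrix.one_mul]

theorem quadForm_transpose_apply {k : ℕ} (S : Matrix (Fin p) (Fin p) ℝ)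
    (G : Matrix (Fin k) (Fin p) ℝ) (x : Vec k) :
    quadForm S (matCLM Gᵀ x) = quadForm (G * S * Gᵀ) x := by
  rw [quadForm_eq_inner, quadForm_eq_inner, matCLM_mul_apply, matCLM_mul_apply, ← inner_matCLM]

theorem quadForm_smul_right (S : Matrix (Fin p) (Fin p) ℝ) (c : ℝ) (x : Vec p) :
    quadForm S (c • x) = c ^ 2 * quadForm S x := by
  rw [quadForm_eq_inner, quadForm_eq_inner, map_smul, inner_smul_left, inner_smul_right]
  simp only [conj_trivial]
  ring

namespace Model

/-- The studentized root of `η₁` of the adaptive indirect estimator is an approximate pivot. -/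
theorem IsADI.isApproxPivot (hθs : θs ∈ interior M.Θ) (h2 : M.A2 θs ρinf b)
    (hsep : M.WellSeparated θs b) (h3 : M.A3 b) (h5 : M.A5 θs b) (h6 : M.A6 θs b F)
    (h7 : M.A7 θs ρinf b) (hR : Tendsto R atTop atTop) (h8 : M.A8 R θs b Sig)
    (hell : M.UniformlyElliptic Sig) (h9 : M.A9 R θs b)
    {est : ∀ n, Vec p × (Fin (R n) → U n × W n) → Vec q} (hest : M.IsADI R est)
    {η₁ : Vec q → ℝ} (hη₁m : Measurable η₁) (hη₁ : ContDiffAt ℝ 1 η₁ θs)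
    (hη₁' : gradient η₁ θs ≠ 0) :
    M.IsApproxPivot R θs (fun n z => η₁ (est n z))
      (fun n z => eta3 η₁ b Sig (est n z) / √(n : ℝ)) η₁ F
      (studentizedLimit η₁ b Sig (hessian (ρinf θs) (b θs)) θs) := by
  have hθs' := interior_subset hθs
  have hpos := h8.posDef θs hθs'
  have hinj := h2.full_rank θs hθs
  obtain ⟨hσ, hσ2⟩ := eta3_pos_and_sq (η₁ := η₁) hpos hinj hη₁'
  set J := hessian (ρinf θs) (b θs) with hJ
  set σ := eta3 η₁ b Sig θs with hσdef
  set G := gain (Sig θs)⁻¹ (jacobian b θs) with hG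
  -- the limit variable is the linear function with coefficients `a` of `J⁻¹ v`
  set a : Vec p := σ⁻¹ • matCLM Gᵀ (gradient η₁ θs) with ha
  have hT : studentizedLimit η₁ b Sig J θs = fun v => ⟪a, matCLM J⁻¹ v⟫_ℝ := by
    ext v
    rw [studentizedLimit_eq_limitVar, limitVar_eq_inner, inner_matCLM, ← hσdef, ← hG, ha,
      Matrix.transpose_smul, map_smul, _root_.smul_apply]
  set L : Measure (Vec p) := F.map (matCLM J⁻¹) with hL
  have hJm : Measurable (matCLM J⁻¹) := (matCLM J⁻¹).continuous.measurable
  have hLprob : IsProbabilityMeasure L := Measure.isProbabilityMeasure_map hJm.aemeasurable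
  obtain ⟨hLmem, hL0, hLcov⟩ := moments_limit hθs' h2 h3 h6 h7 hR h8 hL
  have hac : Continuous fun x : Vec p => ⟪a, x⟫_ℝ := continuous_const.inner continuous_id
  have hmem : MemLp (fun x : Vec p => ⟪a, x⟫_ℝ) 2 L :=
    (innerSL ℝ a).comp_memLp' hLmem
  have hmean : ∫ v, ⟪a, matCLM J⁻¹ v⟫_ℝ ∂F = 0 := by
    have h1 := integral_map (μ := F) hJm.aemeasurable hac.aestronglyMeasurable
    rw [← h1]
    exact integral_inner_eq_zero hLmem hL0 a
  have hvar : Var[fun v => ⟪a, matCLM J⁻¹ v⟫_ℝ; F] = 1 := by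
    have h1 := variance_map (μ := F) (Y := matCLM J⁻¹) (X := fun x : Vec p => ⟪a, x⟫_ℝ)
      hac.measurable.aemeasurable hJm.aemeasurable
    change _ = Var[fun v => ⟪a, matCLM J⁻¹ v⟫_ℝ; F] at h1
    rw [← h1, variance_inner_eq_quadForm hLmem hLcov, ha, quadForm_smul_right,
      quadForm_transpose_apply, hG, gain_mul_mul_transpose hpos (by rwa [matCLM_jacobian]),
      ← hσ2, inv_pow, inv_mul_cancel₀ (pow_ne_zero 2 hσ.ne')]
  refine ⟨fun h θn hθn hlim => ?_, ?_, ?_, ?_, fun hF => ?_⟩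
  · obtain ⟨C, hC⟩ := (Metric.isBounded_range_of_tendsto _ hlim).exists_norm_le
    exact hest.tendsto_studentized hθs h2 hsep h3 h5 h6 h7 h8 hell h9 hη₁m hη₁ hη₁' hθn
      ⟨C, fun n => hC _ ⟨n, rfl⟩⟩
  · rw [hT]
    exact hmem.comp_measurePreserving (f := matCLM J⁻¹) ⟨hJm, rfl⟩
  · rw [hT]
    exact hmean
  · rw [hT]
    exact hvar
  · have h1 := IsGaussian.map_eq_gaussianReal (μ := F) ((innerSL ℝ a).comp (matCLM J⁻¹))
    have h2 : ⇑((innerSL ℝ a).comp (matCLM J⁻¹)) = fun v => ⟪a, matCLM J⁻¹ v⟫_ℝ := rfl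
    rw [h2, hvar, hmean, Real.toNNReal_one] at h1
    rw [hT, h1]

end Model

end Pivot

end IndirectInference

end

open IndirectInference in
theorem mainTheorem3 {p q : ℕ} {U W 𝒟 : ℕ → Type*} [∀ n, MeasurableSpace (U n)]
    [∀ n, MeasurableSpace (W n)] [∀ n, MeasurableSpace (𝒟 n)] (M : Model p q U W 𝒟)
    (θs : Vec q) (hθs : θs ∈ interior M.Θ)
    (ρinf : Vec q → Vec p → ℝ) (b : Vec q → Vec p)
    (F : Measure (Vec p)) [IsProbabilityMeasure F]
    (h1 : M.A1 θs ρinf) (h2 : M.A2 θs ρinf b) (hsep : M.WellSeparated θs b) (h3 : M.A3 b)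
    (h5 : M.A5 θs b) (h6 : M.A6 θs b F) (h7 : M.A7 θs ρinf b)
    (η₁ : Vec q → ℝ) (hη₁m : Measurable η₁) (hη₁ : ContDiffAt ℝ 1 η₁ θs)
    (η₂ : Vec p → ℝ) (hη₂m : Measurable η₂) (hη₂ : ContDiffAt ℝ 1 η₂ (b θs)) :
    -- the indirect estimator, with a fixed number `R` of simulations
    (∀ (R : ℕ) (Ωn : ℕ → Matrix (Fin p) (Fin p) ℝ) (Ω : Matrix (Fin p) (Fin p) ℝ)
        (est : ∀ n, Vec p × (Fin R → U n × W n) → Vec q),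
      0 < R → (∀ n, (Ωn n).PosDef) → Ω.PosDef → Tendsto Ωn atTop (𝓝 Ω) →
      M.IsIND (fun _ => R) Ωn est →
      (HasContinuousCdf ((Measure.pi fun _ : Fin (R + 1) => F).map fun v =>
          limitVar η₁ θs (gain Ω (jacobian b θs)) (hessian (ρinf θs) (b θs))
            (v 0 - (R : ℝ)⁻¹ • ∑ r : Fin R, v r.succ)) →
        M.PBConsistent (fun _ => R) θs est (fun n z => η₁ (est n z)) (fun n _ => 1 / √(n : ℝ))
          η₁) ∧
      (HasContinuousCdf (F.map (limitVar η₂ (b θs) 1 (hessian (ρinf θs) (b θs)))) →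
        M.PBConsistent (fun _ => R) θs est (fun _ z => η₂ z.1) (fun n _ => 1 / √(n : ℝ))
          (fun θ => η₂ (b θ)))) ∧
    -- the adaptive indirect estimator, with a number `R n → ∞` of simulations
    (∀ (R : ℕ → ℕ) (Sig : Vec q → Matrix (Fin p) (Fin p) ℝ)
        (est : ∀ n, Vec p × (Fin (R n) → U n × W n) → Vec q),
      Tendsto R atTop atTop → M.A8 R θs b Sig → M.UniformlyElliptic Sig → M.A9 R θs b →
      M.IsADI R est →
      (HasContinuousCdf (F.map (limitVar η₁ θs (gain (Sig θs)⁻¹ (jacobian b θs))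
          (hessian (ρinf θs) (b θs)))) →
        M.PBConsistent R θs est (fun n z => η₁ (est n z)) (fun n _ => 1 / √(n : ℝ)) η₁) ∧
      (HasContinuousCdf (F.map (limitVar η₂ (b θs) 1 (hessian (ρinf θs) (b θs)))) →
        M.PBConsistent R θs est (fun _ z => η₂ z.1) (fun n _ => 1 / √(n : ℝ))
          (fun θ => η₂ (b θ))) ∧
      -- studentization by the plug-in asymptotic variance: consistency
      (HasContinuousCdf (F.map (limitVar η₁ θs (gain (Sig θs)⁻¹ (jacobian b θs))
          (hessian (ρinf θs) (b θs)))) →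
        M.PBConsistent R θs est (fun n z => η₁ (est n z))
          (fun n z => eta3 η₁ b Sig (est n z) / √(n : ℝ)) η₁) ∧
      -- and the studentized statistic is an approximate pivot
      (gradient η₁ θs ≠ 0 →
        M.IsApproxPivot R θs (fun n z => η₁ (est n z))
          (fun n z => eta3 η₁ b Sig (est n z) / √(n : ℝ)) η₁ F
          (studentizedLimit η₁ b Sig (hessian (ρinf θs) (b θs)) θs))) := by
  have hθs' := interior_subset hθs
  refine ⟨fun R Ωn Ω est hR hΩn hΩ hlim hest => ?_,
    fun R Sig est hR h8 hell h9 hest => ?_⟩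
  · have hmem : ∀ n ω, est n (M.draw n R θs ω) ∈ M.Θ :=
      fun n ω => hest.mem n _ (M.s_mem _ _ _) _
    have hbdd := hest.boundedInProb hR hθs h2 hsep h3 h5 h6 h7 hΩn hΩ hlim
    exact ⟨fun hcdf => pbConsistent_of_tendstoInDistribution M (R := fun _ => R) hθs' hcdf hmem
        hbdd fun θn hθn hC => hest.tendsto_root hR hθs h2 hsep h3 h5 h6 h7 hη₁m hη₁ hΩn hΩ hlim
          hθn hC,
      fun hcdf => pbConsistent_of_tendstoInDistribution M (R := fun _ => R) hθs' hcdf hmem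
        hbdd fun θn hθn hC => Model.tendsto_root_stat (R := fun _ => R) hθs h2 h3 h5 h6 h7 hη₂m
          hη₂ hθn hC⟩
  · have hmem : ∀ n ω, est n (M.draw n (R n) θs ω) ∈ M.Θ :=
      fun n ω => hest.mem n _ (M.s_mem _ _ _) _
    have hbdd := hest.boundedInProb hθs h2 hsep h3 h5 h6 h7 h8 hell h9
    refine ⟨fun hcdf => pbConsistent_of_tendstoInDistribution M hθs' hcdf hmem hbdd
        fun θn hθn hC => hest.tendsto_root hθs h2 hsep h3 h5 h6 h7 h8 hell h9 hη₁m hη₁ hθn hC,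
      fun hcdf => pbConsistent_of_tendstoInDistribution M hθs' hcdf hmem hbdd
        fun θn hθn hC => Model.tendsto_root_stat hθs h2 h3 h5 h6 h7 hη₂m hη₂ hθn hC,
      fun hcdf => ?_,
      fun hη₁' => hest.isApproxPivot hθs h2 hsep h3 h5 h6 h7 hR h8 hell h9 hη₁m hη₁ hη₁'⟩
    have hη₁' := gradient_ne_zero_of_hasContinuousCdf hcdf
    refine pbConsistent_of_tendstoInDistribution M hθs' (hasContinuousCdf_map_div
      (continuous_limitVar _ _ _ _).measurable (eta3_pos_and_sq (h8.posDef θs hθs')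
        (h2.full_rank θs hθs) hη₁').1 hcdf) hmem hbdd fun θn hθn hC => ?_
    exact hest.tendsto_studentized hθs h2 hsep h3 h5 h6 h7 h8 hell h9 hη₁m hη₁ hη₁' hθn hC
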